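/- **Setting.** Fix a set of built-in gates, each of arity $1$ or $2$ and each interpreted by a unitary matrix ($2\times 2$, resp. $4\times4$). Raw terms of the untyped quantum $\lambda$-calculus, taken modulo $\alpha$-equivalence, are $$M,N,P ::= x \mid {!M} \mid \lambda x.M \mid \lambda^! x.M \mid MN \mid r_i \mid U_A \mid \mathsf{new} \mid \mathsf{meas}(P,M,N),$$ with $i\in\mathbb N$ and $A$ a gate; $\langle M,N\rangle$ abbreviates $\lambda f.\,f\,M\,N$. A context is a term with one hole; it is a *surface* context if the hole is neither inside a $!$ nor inside a branch ($M$ or $N$) of a $\mathsf{meas}(P,M,N)$; an occurrence of a subterm is surface if its context is. A term is *valid* if no register $r_i$ occurs more than once, all occurrences of registers are surface, and for every subterm $\lambda x.P$ the variable $x$ occurs free exactly once in $P$, at a surface position. A *raw program* is a pair $[Q,M]$ with $Q\in(\mathbb C^2)^{\otimes n}$ a normalized vector, for some $n\in\mathbb N$, and $M$ a valid term whose set of register identifiers is $\{0,\dots,n-1\}$. A permutation $\sigma$ of $\{0,\dots,n-1\}$ re-indexes it by moving qubit number $i$ of $Q$ to position $\sigma(i)$ and replacing each $r_i$ in $M$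 by $r_{\sigma(i)}$. A *program* is an equivalence class of raw programs under re-indexing. A *multidistribution* is a finite multiset $[q_i\mathbf p_i]_{i\in I}$ of programs $\mathbf p_i$ with weights $q_i\in(0,1]$ and $\sum_i q_i\le 1$; sum is multiset union, and scalars act on the weights. **Reduction.** The root rules, stated on convenient representatives, are - $(b)$ $[Q,(\lambda x.M)N]\mapsto_\beta[1\,[Q,M\{N/x\}]]$, and $(!b)$ $[Q,(\lambda^!x.M)\,{!N}]\mapsto_\beta[1\,[Q,M\{N/x\}]]$; - $(n)$ $[Q,\mathsf{new}]\mapsto_q[1\,[Q\otimes|0\rangle,r_n]]$, where $Q$ has $n$ qubits; - $(m)$ $[Q,\mathsf{meas}(r_n,M,N)]\mapsto_q[\alpha_0^2[Q_0,M],\ \alpha_1^2[Q_1,N]]$, where $Q=\alpha_0\,Q_0\otimes|0\rangle+\alpha_1\,Q_1\otimes|1\rangle$ has $n+1$ qubits, $\alpha_0,\alpha_1\ge 0$ are real, $Q_0,Q_1$ are normalized, and an outcome of probability $0$ is discarded; - $(u_1)$ $[Q,U_A\,r_0]\mapsto_q[1\,[(A\otimes \mathrm{Id})Q,r_0]]$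 for $A$ unary, and $(u_2)$ $[Q,U_A\langle r_0,r_1\rangle]\mapsto_q[1\,[(A\otimes \mathrm{Id})Q,\langle r_0,r_1\rangle]]$ for $A$ binary. The relation $\to_\beta$ between programs and multidistributions is the closure of $\mapsto_\beta$ under arbitrary contexts (also inside $!$ and inside branches), $\to_q$ is the closure of $\mapsto_q$ under surface contexts only, and $\to\;:=\;\to_\beta\cup\to_q$. Its lifting $\Rightarrow$ to multidistributions is the least relation such that $[1\mathbf p]\Rightarrow[1\mathbf p]$; $[1\mathbf p]\Rightarrow m$ whenever $\mathbf p\to m$; and $[p_i\mathbf p_i]_{i\in I}\Rightarrow\sum_{i\in I}p_i\cdot m_i$ whenever $[1\mathbf p_i]\Rightarrow m_i$ for all $i\in I$. **Theorem (confluence of $\Rightarrow$).** For every set of gates, the general reduction $\Rightarrow$ on multidistributions of programs is confluent: if $m\Rightarrow^* m_1$ and $m\Rightarrow^* m_2$, then there is a multidistribution $m'$ with $m_1\Rightarrow^* m'$ and $m_2\Rightarrow^* m'$. -/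

import Mathlib

/-! An untyped quantum lambda-calculus over Simpson's linear lambda-calculus, and its general
reduction on multidistributions of programs. Terms modulo alpha-equivalence are represented by
de Bruijn indices; the free variables are the dangling indices. -/

universe u

namespace QLambda

/-- The built-in unary and binary unitary gates. Basis states of `ℂ²` are indexed by `Fin 2`,
those of `ℂ² ⊗ ℂ²` by `Fin 2 × Fin 2`. -/
structure GateSet : Type (u + 1) where
  Gate1 : Type u
  Gate2 : Type u
  mat1 : Gate1 → Matrix.unitaryGroup (Fin 2) ℂ
  mat2 : Gate2 → Matrix.unitaryGroup (Fin 2 × Fin 2) ℂ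

/-- Raw terms. `lam` is the linear abstraction `λx.M`, `blam` the nonlinear abstraction `λ!x.M`,
`meas P M N` is `meas(P, M, N)` with branches `M` and `N`. -/
inductive Term (G : GateSet.{u}) : Type u
  | var (k : ℕ)
  | bang (M : Term G)
  | lam (M : Term G)
  | blam (M : Term G)
  | app (M N : Term G)
  | reg (i : ℕ)
  | gate1 (A : G.Gate1)
  | gate2 (A : G.Gate2)
  | new
  | meas (P M N : Term G)

namespace Term

variable {G : GateSet.{u}}

/-- The action of a map of variables on the variables below one more binder. -/
def upr (f : ℕ → ℕ) : ℕ → ℕ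
  | 0 => 0
  | k + 1 => f k + 1

/-- Renaming of the free variables. -/
def rename : (ℕ → ℕ) → Term G → Term G
  | f, var k => var (f k)
  | f, bang M => bang (rename f M)
  | f, lam M => lam (rename (upr f) M)
  | f, blam M => blam (rename (upr f) M)
  | f, app M N => app (rename f M) (rename f N)
  | _, reg i => reg i
  | _, gate1 A => gate1 A
  | _, gate2 A => gate2 A
  | _, new => new
  | f, meas P M N => meas (rename f P) (rename f M) (rename f N)

/-- The action of a substitution on the variables below one more binder. -/
def up (s : ℕ → Term G) : ℕ → Term G
  | 0 => var 0
  | k + 1 => rename Nat.succ (s k)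

/-- Capture-avoiding simultaneous substitution. -/
def subst : (ℕ → Term G) → Term G → Term G
  | s, var k => s k
  | s, bang M => bang (subst s M)
  | s, lam M => lam (subst (up s) M)
  | s, blam M => blam (subst (up s) M)
  | s, app M N => app (subst s M) (subst s N)
  | _, reg i => reg i
  | _, gate1 A => gate1 A
  | _, gate2 A => gate2 A
  | _, new => new
  | s, meas P M N => meas (subst s P) (subst s M) (subst s N)

/-- The substitution that replaces the outermost variable by `N`. -/
def single (N : Term G) : ℕ → Term G
  | 0 => N
  | k + 1 => var k

/-- `M{N/x}`, where `M` is the body of an abstraction and `x` its bound variable. -/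
def inst (M N : Term G) : Term G := subst (single N) M

/-- The pair `⟨M, N⟩ = λf. f M N`. -/
def pair (M N : Term G) : Term G :=
  lam (app (app (var 0) (rename Nat.succ M)) (rename Nat.succ N))

/-- Replacing each `r_i` by `r_{f i}`. -/
def mapReg (f : ℕ → ℕ) : Term G → Term G
  | var k => var k
  | bang M => bang (mapReg f M)
  | lam M => lam (mapReg f M)
  | blam M => blam (mapReg f M)
  | app M N => app (mapReg f M) (mapReg f N)
  | reg i => reg (f i)
  | gate1 A => gate1 A
  | gate2 A => gate2 A
  | new => new
  | meas P M N => meas (mapReg f P) (mapReg f M) (mapReg f N)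

/-- Number of free occurrences of the variable with index `k`. -/
def varOcc : ℕ → Term G → ℕ
  | k, var j => if j = k then 1 else 0
  | k, bang M => varOcc k M
  | k, lam M => varOcc (k + 1) M
  | k, blam M => varOcc (k + 1) M
  | k, app M N => varOcc k M + varOcc k N
  | _, reg _ => 0
  | _, gate1 _ => 0
  | _, gate2 _ => 0
  | _, new => 0
  | k, meas P M N => varOcc k P + varOcc k M + varOcc k N

/-- Number of free surface occurrences of the variable with index `k`: those neither inside a `!`
nor inside a branch of a `meas`. -/
def varSurf : ℕ → Term G → ℕ
  | k, var j => if j = k then 1 else 0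
  | _, bang _ => 0
  | k, lam M => varSurf (k + 1) M
  | k, blam M => varSurf (k + 1) M
  | k, app M N => varSurf k M + varSurf k N
  | _, reg _ => 0
  | _, gate1 _ => 0
  | _, gate2 _ => 0
  | _, new => 0
  | k, meas P _ _ => varSurf k P

/-- Number of occurrences of the register `r_i`. -/
def regOcc (i : ℕ) : Term G → ℕ
  | var _ => 0
  | bang M => regOcc i M
  | lam M => regOcc i M
  | blam M => regOcc i M
  | app M N => regOcc i M + regOcc i N
  | reg j => if j = i then 1 else 0
  | gate1 _ => 0
  | gate2 _ => 0
  | new => 0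
  | meas P M N => regOcc i P + regOcc i M + regOcc i N

/-- Number of surface occurrences of the register `r_i`. -/
def regSurf (i : ℕ) : Term G → ℕ
  | var _ => 0
  | bang _ => 0
  | lam M => regSurf i M
  | blam M => regSurf i M
  | app M N => regSurf i M + regSurf i N
  | reg j => if j = i then 1 else 0
  | gate1 _ => 0
  | gate2 _ => 0
  | new => 0
  | meas P _ _ => regSurf i P

/-- For every subterm `λx.P`, `x` occurs free exactly once in `P`, and that occurrence is
surface. -/
def LinearAbs : Term G → Prop
  | var _ => True
  | bang M => LinearAbs M
  | lam M => (varOcc 0 M = 1 ∧ varSurf 0 M = 1) ∧ LinearAbs M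
  | blam M => LinearAbs M
  | app M N => LinearAbs M ∧ LinearAbs N
  | reg _ => True
  | gate1 _ => True
  | gate2 _ => True
  | new => True
  | meas P M N => LinearAbs P ∧ LinearAbs M ∧ LinearAbs N

/-- Valid terms: no register occurs more than once, all occurrences of registers are surface, and
linear abstractions are linear. -/
def Valid (M : Term G) : Prop :=
  (∀ i, M.regOcc i ≤ 1 ∧ M.regSurf i = M.regOcc i) ∧ M.LinearAbs

/-- `Reg(M)`: the identifiers of the registers that occur in `M`. -/
def regs (M : Term G) : Set ℕ := {i | 0 < M.regOcc i}

end Term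

/-- Contexts: terms with exactly one hole. -/
inductive Ctx (G : GateSet.{u}) : Type u
  | hole
  | appL (C : Ctx G) (N : Term G)
  | appR (M : Term G) (C : Ctx G)
  | lam (C : Ctx G)
  | blam (C : Ctx G)
  | measP (C : Ctx G) (M N : Term G)
  | measL (P : Term G) (C : Ctx G) (N : Term G)
  | measR (P M : Term G) (C : Ctx G)
  | bang (C : Ctx G)

namespace Ctx

variable {G : GateSet.{u}}

/-- Filling the hole, with capture. -/
def fill : Ctx G → Term G → Term G
  | hole, R => R
  | appL C N, R => .app (fill C R) N
  | appR M C, R => .app M (fill C R)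
  | lam C, R => .lam (fill C R)
  | blam C, R => .blam (fill C R)
  | measP C M N, R => .meas (fill C R) M N
  | measL P C N, R => .meas P (fill C R) N
  | measR P M C, R => .meas P M (fill C R)
  | bang C, R => .bang (fill C R)

/-- Surface contexts: the hole is neither inside a `!` nor inside a branch of a `meas`. -/
def IsSurface : Ctx G → Prop
  | hole => True
  | appL C _ => IsSurface C
  | appR _ C => IsSurface C
  | lam C => IsSurface C
  | blam C => IsSurface C
  | measP C _ _ => IsSurface C
  | measL _ _ _ => False
  | measR _ _ _ => False
  | bang _ => False

end Ctx

/-- Vectors of `(ℂ²)^{⊗n}`, by their coordinates in the basis of the bit strings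
`|b_0 … b_{n-1}⟩`. -/
abbrev Vec (n : ℕ) : Type := (Fin n → Fin 2) → ℂ

/-- Normalized vectors. -/
def IsState {n : ℕ} (Q : Vec n) : Prop := ∑ b, ‖Q b‖ ^ 2 = 1

/-- `Q ⊗ |c⟩`. -/
def tensorKet {n : ℕ} (Q : Vec n) (c : Fin 2) : Vec (n + 1) :=
  fun b => if b (Fin.last n) = c then Q (Fin.init b) else 0

/-- `(A ⊗ Id) Q` for a one-qubit gate `A`. -/
def apply1 {n : ℕ} (A : Matrix (Fin 2) (Fin 2) ℂ) (Q : Vec (n + 1)) : Vec (n + 1) :=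
  fun b => ∑ c : Fin 2, A (b 0) c * Q (Function.update b 0 c)

/-- `(A ⊗ Id) Q` for a two-qubit gate `A`. -/
def apply2 {n : ℕ} (A : Matrix (Fin 2 × Fin 2) (Fin 2 × Fin 2) ℂ) (Q : Vec (n + 2)) :
    Vec (n + 2) :=
  fun b => ∑ c : Fin 2 × Fin 2,
    A (b 0, b 1) c * Q (Function.update (Function.update b 0 c.1) 1 c.2)

/-- A pair `⟨Q, M⟩` of a vector and a term, with no condition yet. -/
structure Config (G : GateSet.{u}) : Type u where
  size : ℕ
  vec : Vec size
  term : Term G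

/-- The extension of a permutation of `{0, …, n-1}` to `ℕ` by the identity. -/
def permNat {n : ℕ} (σ : Equiv.Perm (Fin n)) (i : ℕ) : ℕ :=
  if h : i < n then (σ ⟨i, h⟩ : ℕ) else i

/-- Re-indexing: qubit number `i` becomes qubit number `σ i`, in the memory and in the term. -/
def Config.reindex {G : GateSet.{u}} (c : Config G) (σ : Equiv.Perm (Fin c.size)) : Config G where
  size := c.size
  vec := fun b => c.vec (b ∘ σ)
  term := c.term.mapReg (permNat σ)

/-- Raw programs: `⟨Q, M⟩` with `Q` a normalized vector on `n` qubits and `M` a valid term with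
`Reg(M) = {0, …, n-1}`. -/
structure RawProgram (G : GateSet.{u}) : Type u where
  config : Config G
  isState : IsState config.vec
  valid : config.term.Valid
  regs_eq : config.term.regs = {i | i < config.size}

theorem Term.mapReg_id {G : GateSet.{u}} (M : Term G) (f : ℕ → ℕ) (hf : ∀ i, f i = i) :
    M.mapReg f = M := by
  induction M <;> simp_all [Term.mapReg]

theorem Term.mapReg_mapReg {G : GateSet.{u}} (M : Term G) (f g : ℕ → ℕ) :
    (M.mapReg f).mapReg g = M.mapReg (fun i => g (f i)) := by
  induction M <;> simp_all [Term.mapReg]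

theorem permNat_mul {n : ℕ} (σ τ : Equiv.Perm (Fin n)) (i : ℕ) :
    permNat τ (permNat σ i) = permNat (τ * σ) i := by
  by_cases h : i < n <;> simp [permNat, h]

theorem permNat_one {n : ℕ} (i : ℕ) : permNat (1 : Equiv.Perm (Fin n)) i = i := by
  by_cases h : i < n <;> simp [permNat, h]

theorem Config.reindex_one {G : GateSet.{u}} (c : Config G) : c.reindex 1 = c := by
  obtain ⟨n, Q, M⟩ := c
  simp only [Config.reindex]
  rw [Term.mapReg_id M _ permNat_one]
  rfl

theorem Config.reindex_reindex {G : GateSet.{u}} (c : Config G) (σ τ : Equiv.Perm (Fin c.size)) :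
    (c.reindex σ).reindex τ = c.reindex (τ * σ) := by
  obtain ⟨n, Q, M⟩ := c
  simp only [Config.reindex]
  rw [Term.mapReg_mapReg]
  congr 2
  funext i
  exact permNat_mul σ τ i

/-- Equality of raw programs up to re-indexing. -/
instance reindexSetoid (G : GateSet.{u}) : Setoid (RawProgram G) where
  r p q := ∃ σ : Equiv.Perm (Fin p.config.size), q.config = p.config.reindex σ
  iseqv :=
    { refl := fun p => ⟨1, p.config.reindex_one.symm⟩
      symm := by
        rintro ⟨p, _, _, _⟩ ⟨q, _, _, _⟩ ⟨σ, h⟩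
        simp only at σ h
        subst h
        exact ⟨σ⁻¹, by
          rw [show (p.reindex σ).reindex σ⁻¹ = _ from Config.reindex_reindex p σ σ⁻¹,
            inv_mul_cancel, Config.reindex_one]⟩
      trans := by
        rintro ⟨p, _, _, _⟩ ⟨q, _, _, _⟩ ⟨r, _, _, _⟩ ⟨σ, h⟩ ⟨τ, h'⟩
        simp only at σ h τ h'
        subst h
        subst h'
        exact ⟨Equiv.trans σ τ, Config.reindex_reindex p σ τ⟩ }

/-- Programs: equivalence classes of raw programs under re-indexing. -/
def Program (G : GateSet.{u}) : Type u := Quotient (reindexSetoid G)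

/-- The program represented by a raw program. -/
def Program.mk {G : GateSet.{u}} (p : RawProgram G) : Program G := Quotient.mk _ p

/-- Multidistributions: finite multisets of pairs `q a` with `q ∈ ]0,1]` and total weight at
most `1`. -/
@[ext]
structure MDist (α : Type u) : Type u where
  val : Multiset (ℝ × α)
  weight_mem : ∀ x ∈ val, 0 < x.1 ∧ x.1 ≤ 1
  sum_le : (val.map Prod.fst).sum ≤ 1

/-- The multidistribution `[a] = [1 a]`. -/
def MDist.pure {α : Type u} (a : α) : MDist α where
  val := {(1, a)}
  weight_mem := by simp
  sum_le := by simp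

section Reduction

variable {G : GateSet.{u}}

/-- The root rules `(b)` and `(!b)`. -/
inductive BetaRoot : Config G → Multiset (ℝ × Config G) → Prop
  | b {n : ℕ} (Q : Vec n) (M N : Term G) :
      BetaRoot ⟨n, Q, .app (.lam M) N⟩ {(1, ⟨n, Q, M.inst N⟩)}
  | bangb {n : ℕ} (Q : Vec n) (M N : Term G) :
      BetaRoot ⟨n, Q, .app (.blam M) (.bang N)⟩ {(1, ⟨n, Q, M.inst N⟩)}

/-- The root rules `(n)`, `(m)`, `(u₁)`, `(u₂)`, on the convenient representative. In `(m)` the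
coefficients are the nonnegative ones, so that the normalized post-measurement states `Q₀`, `Q₁` are
determined, and outcomes of probability `0` are discarded. -/
inductive QRoot : Config G → Multiset (ℝ × Config G) → Prop
  | n {n : ℕ} (Q : Vec n) :
      QRoot ⟨n, Q, .new⟩ {(1, ⟨n + 1, tensorKet Q 0, .reg n⟩)}
  | m {n : ℕ} (Q : Vec (n + 1)) (a₀ a₁ : ℝ) (Q₀ Q₁ : Vec n) (M N : Term G)
      (ha₀ : 0 ≤ a₀) (ha₁ : 0 ≤ a₁) (hQ₀ : IsState Q₀) (hQ₁ : IsState Q₁)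
      (hQ : Q = (a₀ : ℂ) • tensorKet Q₀ 0 + (a₁ : ℂ) • tensorKet Q₁ 1) :
      QRoot ⟨n + 1, Q, .meas (.reg n) M N⟩
        (({(a₀ ^ 2, ⟨n, Q₀, M⟩), (a₁ ^ 2, ⟨n, Q₁, N⟩)} : Multiset (ℝ × Config G)).filter
          (fun x => 0 < x.1))
  | u₁ {n : ℕ} (Q : Vec (n + 1)) (A : G.Gate1) :
      QRoot ⟨n + 1, Q, .app (.gate1 A) (.reg 0)⟩
        {(1, ⟨n + 1, apply1 (G.mat1 A).1 Q, .reg 0⟩)}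
  | u₂ {n : ℕ} (Q : Vec (n + 2)) (A : G.Gate2) :
      QRoot ⟨n + 2, Q, .app (.gate2 A) (.pair (.reg 0) (.reg 1))⟩
        {(1, ⟨n + 2, apply2 (G.mat2 A).1 Q, .pair (.reg 0) (.reg 1)⟩)}

/-- Closure of the β rules under arbitrary contexts. -/
inductive BetaCtx : Config G → Multiset (ℝ × Config G) → Prop
  | mk {n : ℕ} (Q : Vec n) (M M' : Term G) (C : Ctx G)
      (h : BetaRoot ⟨n, Q, M⟩ {(1, ⟨n, Q, M'⟩)}) :
      BetaCtx ⟨n, Q, C.fill M⟩ {(1, ⟨n, Q, C.fill M'⟩)}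

/-- Closure of the quantum rules under surface contexts. -/
inductive QCtx : Config G → Multiset (ℝ × Config G) → Prop
  | mk {n : ℕ} (Q : Vec n) (M : Term G) (S : Ctx G) (hS : S.IsSurface)
      (μ : Multiset (ℝ × Config G)) (h : QRoot ⟨n, Q, M⟩ μ) :
      QCtx ⟨n, Q, S.fill M⟩
        (μ.map fun x => (x.1, ⟨x.2.size, x.2.vec, S.fill x.2.term⟩))

/-- The relation between programs and multidistributions of programs that a relation on pairs
`⟨Q, M⟩` induces, through representatives. -/
def OnPrograms (r : Config G → Multiset (ℝ × Config G) → Prop)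
    (P : Program G) (m : MDist (Program G)) : Prop :=
  ∃ (p : RawProgram G) (μ : Multiset (ℝ × RawProgram G)),
    Program.mk p = P ∧
    r p.config (μ.map fun x => (x.1, x.2.config)) ∧
    m.val = μ.map fun x => (x.1, Program.mk x.2)

/-- `→_β` on programs. -/
def BetaStep : Program G → MDist (Program G) → Prop := OnPrograms BetaCtx

/-- `→_q` on programs. -/
def QStep : Program G → MDist (Program G) → Prop := OnPrograms QCtx

/-- `→ = →_β ∪ →_q` on programs. -/
def Step (P : Program G) (m : MDist (Program G)) : Prop := BetaStep P m ∨ QStep P m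

end Reduction

/-- Lifting of a relation `r ⊆ α × MDist α` to a relation on `MDist α`:
`[a] ⇒ [a]`; `[a] ⇒ m` if `r a m`; and `[p_i a_i]_i ⇒ ∑ i, p_i · m_i` if `[a_i] ⇒ m_i` for
every `i`. -/
inductive Lifting {α : Type u} (r : α → MDist α → Prop) : MDist α → MDist α → Prop
  | refl (a : α) : Lifting r (MDist.pure a) (MDist.pure a)
  | step (a : α) (m : MDist α) (h : r a m) : Lifting r (MDist.pure a) m
  | sum {k : ℕ} (p : Fin k → ℝ) (a : Fin k → α) (m : Fin k → MDist α) (s t : MDist α)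
      (hs : s.val = ∑ i, {(p i, a i)})
      (ht : t.val = ∑ i, (m i).val.map fun x => (p i * x.1, x.2))
      (h : ∀ i, Lifting r (MDist.pure (a i)) (m i)) : Lifting r s t

/-- The general reduction `⇒` on multidistributions of programs. -/
def Red (G : GateSet.{u}) : MDist (Program G) → MDist (Program G) → Prop := Lifting Step

/-- Confluence: `←* · →*  ⊆  →* · ←*`. -/
def Confluent {α : Type u} (r : α → α → Prop) : Prop :=
  ∀ a b c : α, Relation.ReflTransGen r a b → Relation.ReflTransGen r a c →
    ∃ d : α, Relation.ReflTransGen r b d ∧ Relation.ReflTransGen r c d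

end QLambda

/-! The proof follows Tait and Martin-Löf. Between `Step` and the reflexive transitive closure of
its lifting lies the relation `ParStep`: a parallel β-step or a single quantum step. If two
`ParStep`s from one program can always be joined by at most one lifted step on each side, then the
lifting of `ParStep` has the diamond property, because the elements of a multiset evolve
independently and each may stay put. Confluence of `⇒` follows since both liftings have the same
reflexive transitive closure (`confluent_lifting`).

There are three local cases. Two parallel β-steps join by the usual argument (`Term.Par.diamond`). A
quantum step and a parallel β-step commute (`Term.QT.par`) because β can neither erase nor duplicate
a surface redex: a linear variable occurs exactly once, at a surface position, and the argument of a
`!b`-redex is a `!`, which has no surface redex inside. Two quantum steps are either the same step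
or act at disjoint positions (`Term.QT.join`). In the latter case validity makes their sets of
registers disjoint, so their operators act on different tensor factors and commute (`Lab.op_comm`).

Re-indexing makes these arguments awkward on programs themselves, so they are carried out on
programs with named registers (`NProg`). A memory is a function on all bit strings `ℕ → Fin 2`,
supported on the strings that vanish outside the registers of the term. In this picture allocation
is the identity, measuring qubit `i` with outcome `o` is the operator `|0⟩⟨o|` on that qubit, and no
other qubit is ever renumbered. Programs are exactly the orbits of named programs under permutations
of ℕ (`prog_perm`, `prog_eq_prog`), and steps are equivariant. The choice of a fresh name in an
allocation is then harmless: two choices differ by a transposition that fixes the rest.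

Outcomes are handled through unnormalized memories. `Out φ A μ` normalizes `φ`, with weight its
squared norm, and drops it if it is zero. This determines `μ` (`Out.unique`), and the operators are
linear, so the four outcomes of two successive operations do not depend on their order, weights
included. -/

namespace QLambda

namespace Term

variable {G : GateSet.{u}}

/-! ### Substitution -/

theorem upr_comp (f g : ℕ → ℕ) (k : ℕ) : upr f (upr g k) = upr (f ∘ g) k := by
  cases k <;> rfl

theorem rename_rename (M : Term G) (f g : ℕ → ℕ) :
    rename f (rename g M) = rename (f ∘ g) M := by
  induction M generalizing f g <;>
    simp_all [rename, show ∀ f g : ℕ → ℕ, upr f ∘ upr g = upr (f ∘ g) from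
      fun f g => funext (upr_comp f g)]

theorem up_comp_upr (s : ℕ → Term G) (f : ℕ → ℕ) : up s ∘ upr f = up (s ∘ f) := by
  funext k
  cases k <;> rfl

theorem subst_rename (M : Term G) (s : ℕ → Term G) (f : ℕ → ℕ) :
    subst s (rename f M) = subst (s ∘ f) M := by
  induction M generalizing s f <;> simp_all [rename, subst, up_comp_upr]

theorem rename_upr_comp_up (s : ℕ → Term G) (f : ℕ → ℕ) :
    rename (upr f) ∘ up s = up (rename f ∘ s) := by
  funext k
  cases k with
  | zero => rfl
  | succ k =>
    simp only [Function.comp, up, rename_rename]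
    rfl

theorem rename_subst (M : Term G) (s : ℕ → Term G) (f : ℕ → ℕ) :
    rename f (subst s M) = subst (rename f ∘ s) M := by
  induction M generalizing s f <;> simp_all [rename, subst, rename_upr_comp_up]

theorem subst_up_comp_up (s t : ℕ → Term G) :
    subst (up t) ∘ up s = up (subst t ∘ s) := by
  funext k
  cases k with
  | zero => rfl
  | succ k =>
    simp only [Function.comp, up, subst_rename, rename_subst]
    rfl

theorem subst_subst (M : Term G) (s t : ℕ → Term G) :
    subst t (subst s M) = subst (subst t ∘ s) M := by
  induction M generalizing s t <;> simp_all [subst, subst_up_comp_up]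

theorem up_var : up (var : ℕ → Term G) = var := by
  funext k
  cases k <;> rfl

theorem subst_var (M : Term G) : subst var M = M := by
  induction M <;> simp_all [subst, up_var]

theorem subst_inst (M N : Term G) (s : ℕ → Term G) :
    subst s (inst M N) = inst (subst (up s) M) (subst s N) := by
  simp only [inst, subst_subst]
  congr 1
  funext k
  cases k with
  | zero => rfl
  | succ k =>
    simp only [Function.comp, up, single, subst, subst_rename]
    exact (subst_var _).symm

theorem rename_eq_subst (M : Term G) (f : ℕ → ℕ) : rename f M = subst (var ∘ f) M := by
  rw [← subst_rename, subst_var]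

theorem rename_inst (M N : Term G) (f : ℕ → ℕ) :
    rename f (inst M N) = inst (rename (upr f) M) (rename f N) := by
  rw [rename_eq_subst, subst_inst, rename_eq_subst N, rename_eq_subst M]
  congr 2
  funext k
  cases k <;> rfl

/-! ### Replacement of registers -/

theorem mapReg_rename (M : Term G) (f : ℕ → ℕ) (g : ℕ → ℕ) :
    (rename f M).mapReg g = rename f (M.mapReg g) := by
  induction M generalizing f <;> simp_all [rename, mapReg]

theorem mapReg_subst (M : Term G) (s : ℕ → Term G) (g : ℕ → ℕ) :
    (subst s M).mapReg g = subst (fun k => (s k).mapReg g) (M.mapReg g) := by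
  induction M generalizing s with
  | lam M ih | blam M ih =>
    simp only [subst, mapReg, ih]
    congr 2
    funext k
    cases k
    · rfl
    · simp [up, mapReg_rename]
  | _ => simp_all [subst, mapReg]

theorem mapReg_inst (M N : Term G) (g : ℕ → ℕ) :
    (inst M N).mapReg g = inst (M.mapReg g) (N.mapReg g) := by
  rw [inst, mapReg_subst, inst]
  congr 1
  funext k
  cases k <;> rfl

theorem varOcc_mapReg (M : Term G) (g : ℕ → ℕ) (k : ℕ) :
    (M.mapReg g).varOcc k = M.varOcc k := by
  induction M generalizing k <;> simp_all [mapReg, varOcc]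

theorem varSurf_mapReg (M : Term G) (g : ℕ → ℕ) (k : ℕ) :
    (M.mapReg g).varSurf k = M.varSurf k := by
  induction M generalizing k <;> simp_all [mapReg, varSurf]

theorem linearAbs_mapReg (M : Term G) (g : ℕ → ℕ) :
    (M.mapReg g).LinearAbs ↔ M.LinearAbs := by
  induction M <;> simp_all [mapReg, LinearAbs, varOcc_mapReg, varSurf_mapReg]

theorem regOcc_mapReg (M : Term G) {g : ℕ → ℕ} (hg : g.Injective) (i : ℕ) :
    (M.mapReg g).regOcc (g i) = M.regOcc i := by
  induction M <;> simp_all [mapReg, regOcc, hg.eq_iff]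

theorem regSurf_mapReg (M : Term G) {g : ℕ → ℕ} (hg : g.Injective) (i : ℕ) :
    (M.mapReg g).regSurf (g i) = M.regSurf i := by
  induction M <;> simp_all [mapReg, regSurf, hg.eq_iff]

theorem mapReg_congr (M : Term G) {f g : ℕ → ℕ} (h : ∀ i, 0 < M.regOcc i → f i = g i) :
    M.mapReg f = M.mapReg g := by
  induction M with
  | reg i => simp [mapReg, h i (by simp [regOcc])]
  | app M N ihM ihN =>
    simp only [regOcc] at h
    simp [mapReg, ihM fun i hi => h i (by omega), ihN fun i hi => h i (by omega)]
  | meas P M N ihP ihM ihN =>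
    simp only [regOcc] at h
    simp [mapReg, ihP fun i hi => h i (by omega), ihM fun i hi => h i (by omega),
      ihN fun i hi => h i (by omega)]
  | _ => simp_all [mapReg, regOcc]

theorem finite_regs (M : Term G) : M.regs.Finite := by
  induction M with
  | reg i =>
    refine (Set.finite_singleton i).subset fun j hj => ?_
    by_contra h
    exact absurd hj (by simpa [regs, regOcc] using fun h' => h h'.symm)
  | app M N ihM ihN =>
    refine (ihM.union ihN).subset fun j hj => ?_
    simp only [regs, regOcc, Set.mem_ofPred_eq, Set.mem_union] at hj ⊢
    omega
  | meas P M N ihP ihM ihN =>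
    refine ((ihP.union ihM).union ihN).subset fun j hj => ?_
    simp only [regs, regOcc, Set.mem_ofPred_eq, Set.mem_union] at hj ⊢
    omega
  | _ => simp_all [regs, regOcc]

theorem varSurf_le (M : Term G) (k : ℕ) : M.varSurf k ≤ M.varOcc k := by
  induction M generalizing k with
  | app M N ihM ihN => exact Nat.add_le_add (ihM k) (ihN k)
  | meas P M N ihP ihM ihN => exact (ihP k).trans (by simp [varOcc, add_assoc])
  | _ => simp_all [varSurf, varOcc]

theorem regSurf_le (M : Term G) (i : ℕ) : M.regSurf i ≤ M.regOcc i := by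
  induction M with
  | app M N ihM ihN => exact Nat.add_le_add ihM ihN
  | meas P M N ihP ihM ihN => exact ihP.trans (by simp [regOcc, add_assoc])
  | _ => simp_all [regSurf, regOcc]

/-! ### Occurrences in a substituted term -/

theorem upr_injective {f : ℕ → ℕ} (hf : f.Injective) : (upr f).Injective := by
  intro a b h
  cases a <;> cases b <;> simp_all [upr, hf.eq_iff]

theorem upr_ne {f : ℕ → ℕ} {j : ℕ} (h : ∀ k, f k ≠ j) (k : ℕ) : upr f k ≠ j + 1 := by
  cases k <;> simp_all [upr]

theorem varOcc_rename (M : Term G) {f : ℕ → ℕ} (hf : f.Injective) (k : ℕ) :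
    (rename f M).varOcc (f k) = M.varOcc k := by
  induction M generalizing f k with
  | lam M ih | blam M ih => exact ih (upr_injective hf) (k + 1)
  | _ => simp_all [rename, varOcc, hf.eq_iff]

theorem varSurf_rename (M : Term G) {f : ℕ → ℕ} (hf : f.Injective) (k : ℕ) :
    (rename f M).varSurf (f k) = M.varSurf k := by
  induction M generalizing f k with
  | lam M ih | blam M ih => exact ih (upr_injective hf) (k + 1)
  | _ => simp_all [rename, varSurf, hf.eq_iff]

theorem varOcc_rename_eq_zero (M : Term G) {f : ℕ → ℕ} {j : ℕ} (h : ∀ k, f k ≠ j) :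
    (rename f M).varOcc j = 0 := by
  induction M generalizing f j with
  | lam M ih | blam M ih => exact ih (upr_ne h)
  | _ => simp_all [rename, varOcc]

theorem regOcc_rename (M : Term G) (f : ℕ → ℕ) (i : ℕ) :
    (rename f M).regOcc i = M.regOcc i := by
  induction M generalizing f <;> simp_all [rename, regOcc]

theorem regSurf_rename (M : Term G) (f : ℕ → ℕ) (i : ℕ) :
    (rename f M).regSurf i = M.regSurf i := by
  induction M generalizing f <;> simp_all [rename, regSurf]

theorem linearAbs_rename (M : Term G) {f : ℕ → ℕ} (hf : f.Injective) :
    (rename f M).LinearAbs ↔ M.LinearAbs := by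
  induction M generalizing f with
  | lam M ih =>
    have h1 := varOcc_rename M (upr_injective hf) 0
    have h2 := varSurf_rename M (upr_injective hf) 0
    simp only [upr] at h1 h2
    simp [rename, LinearAbs, ih (upr_injective hf), h1, h2]
  | blam M ih => exact ih (upr_injective hf)
  | _ => simp_all [rename, LinearAbs]

/-- The substitution of `N` for the variable `k`, below `k` binders. -/
def singleAt (k : ℕ) (N : Term G) (j : ℕ) : Term G :=
  if j < k then var j else if j = k then rename (· + k) N else var (j - 1)

theorem singleAt_zero (N : Term G) : singleAt 0 N = single N := by
  funext j
  cases j with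
  | zero =>
    simp only [singleAt, single, rename_eq_subst]
    exact subst_var N
  | succ j => simp [singleAt, single]

/-- The family `singleAt` is closed under passing a binder, unlike `single`; this makes the
inductions below go through. -/
theorem up_singleAt (k : ℕ) (N : Term G) : up (singleAt k N) = singleAt (k + 1) N := by
  funext j
  cases j with
  | zero => simp [singleAt, up]
  | succ j =>
    simp only [singleAt, up, add_lt_add_iff_right, add_left_inj]
    split_ifs with h1 h2
    · rfl
    · rw [rename_rename]
      rfl
    · simp only [rename, Term.var.injEq]
      omega

theorem add_right_injective' (k : ℕ) : Function.Injective (· + k : ℕ → ℕ) :=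
  fun _ _ h => Nat.add_right_cancel h

/-- The variables of `N` are shifted by `k`, so none of the `k` innermost variables is captured.
With `j = 0` this keeps the binders inside `M` linear. -/
theorem varOcc_singleAt_lt (M N : Term G) {j k : ℕ} (h : j < k) :
    (subst (singleAt k N) M).varOcc j = M.varOcc j := by
  induction M generalizing j k with
  | var i =>
    simp only [subst, singleAt]
    split_ifs with h1 h2
    · rfl
    · rw [varOcc_rename_eq_zero _ (fun i => by omega)]
      simp only [varOcc]
      split_ifs <;> omega
    · simp only [varOcc]
      split_ifs <;> omega
  | lam M ih | blam M ih =>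
    simp only [subst, varOcc, up_singleAt]
    exact ih (by omega)
  | _ => simp_all [subst, varOcc]

theorem varSurf_singleAt_lt (M N : Term G) {j k : ℕ} (h : j < k) :
    (subst (singleAt k N) M).varSurf j = M.varSurf j := by
  induction M generalizing j k with
  | var i =>
    simp only [subst, singleAt]
    split_ifs with h1 h2
    · rfl
    · have := varSurf_le (rename (· + k) N) j
      rw [varOcc_rename_eq_zero _ (fun i => by omega)] at this
      simp only [varSurf]
      split_ifs <;> omega
    · simp only [varSurf]
      split_ifs <;> omega
  | lam M ih | blam M ih =>
    simp only [subst, varSurf, up_singleAt]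
    exact ih (by omega)
  | _ => simp_all [subst, varSurf]

/-- Each occurrence of the variable `k` contributes a copy of `N`. The index drops from `j + k + 1`
to `j + k` because the variable `k` disappears. -/
theorem varOcc_singleAt (M N : Term G) (j k : ℕ) :
    (subst (singleAt k N) M).varOcc (j + k) =
      M.varOcc (j + k + 1) + M.varOcc k * N.varOcc j := by
  induction M generalizing k with
  | var i =>
    simp only [subst, singleAt]
    split_ifs with h1 h2
    · simp only [varOcc]
      split_ifs <;> omega
    · have := varOcc_rename N (add_right_injective' k) j
      simp only [this, varOcc]
      split_ifs <;> omega
    · simp only [varOcc]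
      split_ifs <;> omega
  | lam M ih | blam M ih =>
    simp only [subst, varOcc, up_singleAt]
    exact ih (k + 1)
  | app M N ihM ihN =>
    simp only [subst, varOcc, ihM, ihN]
    ring
  | meas P M N ihP ihM ihN =>
    simp only [subst, varOcc, ihM, ihN, ihP]
    ring
  | _ => simp_all [subst, varOcc]

theorem varSurf_singleAt (M N : Term G) (j k : ℕ) :
    (subst (singleAt k N) M).varSurf (j + k) =
      M.varSurf (j + k + 1) + M.varSurf k * N.varSurf j := by
  induction M generalizing k with
  | var i =>
    simp only [subst, singleAt]
    split_ifs with h1 h2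
    · simp only [varSurf]
      split_ifs <;> omega
    · have := varSurf_rename N (add_right_injective' k) j
      simp only [this, varSurf]
      split_ifs <;> omega
    · simp only [varSurf]
      split_ifs <;> omega
  | lam M ih | blam M ih =>
    simp only [subst, varSurf, up_singleAt]
    exact ih (k + 1)
  | app M N ihM ihN =>
    simp only [subst, varSurf, ihM, ihN]
    ring
  | meas P M N ihP ihM ihN =>
    simp only [subst, varSurf, ihP]
  | _ => simp_all [subst, varSurf]

theorem regOcc_singleAt (M N : Term G) (i k : ℕ) :
    (subst (singleAt k N) M).regOcc i = M.regOcc i + M.varOcc k * N.regOcc i := by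
  induction M generalizing k with
  | var j =>
    simp only [subst, singleAt]
    split_ifs with h1 h2
    · simp only [regOcc, varOcc]
      split_ifs
      · omega
      · simp
    · simp [h2, regOcc, varOcc, regOcc_rename]
    · simp [h2, regOcc, varOcc]
  | lam M ih | blam M ih =>
    simp only [subst, regOcc, varOcc, up_singleAt]
    exact ih (k + 1)
  | app M N ihM ihN =>
    simp only [subst, varOcc, regOcc, ihM, ihN]
    ring
  | meas P M N ihP ihM ihN =>
    simp only [subst, varOcc, regOcc, ihM, ihN, ihP]
    ring
  | _ => simp_all [subst, varOcc, regOcc]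

theorem regSurf_singleAt (M N : Term G) (i k : ℕ) :
    (subst (singleAt k N) M).regSurf i = M.regSurf i + M.varSurf k * N.regSurf i := by
  induction M generalizing k with
  | var j =>
    simp only [subst, singleAt]
    split_ifs with h1 h2
    · simp only [regSurf, varSurf]
      split_ifs
      · omega
      · simp
    · simp [h2, regSurf, varSurf, regSurf_rename]
    · simp [h2, regSurf, varSurf]
  | lam M ih | blam M ih =>
    simp only [subst, regSurf, varSurf, up_singleAt]
    exact ih (k + 1)
  | app M N ihM ihN =>
    simp only [subst, varSurf, regSurf, ihM, ihN]
    ring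
  | meas P M N ihP ihM ihN =>
    simp only [subst, varSurf, regSurf, ihP]
  | _ => simp_all [subst, varSurf, regSurf]

theorem linearAbs_singleAt {M N : Term G} (k : ℕ) (hM : M.LinearAbs) (hN : N.LinearAbs) :
    (subst (singleAt k N) M).LinearAbs := by
  induction M generalizing k with
  | var j =>
    simp only [subst, singleAt]
    split_ifs
    · trivial
    · exact (linearAbs_rename N (add_right_injective' k)).2 hN
    · trivial
  | lam M ih =>
    simp only [subst, up_singleAt]
    refine ⟨?_, ih (k + 1) hM.2⟩
    rw [varOcc_singleAt_lt _ _ (Nat.succ_pos k), varSurf_singleAt_lt _ _ (Nat.succ_pos k)]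
    exact hM.1
  | blam M ih =>
    simp only [subst, up_singleAt]
    exact ih (k + 1) hM
  | _ => simp_all [subst, LinearAbs]

theorem varOcc_inst (M N : Term G) (j : ℕ) :
    (inst M N).varOcc j = M.varOcc (j + 1) + M.varOcc 0 * N.varOcc j := by
  rw [inst, ← singleAt_zero]
  exact varOcc_singleAt M N j 0

theorem varSurf_inst (M N : Term G) (j : ℕ) :
    (inst M N).varSurf j = M.varSurf (j + 1) + M.varSurf 0 * N.varSurf j := by
  rw [inst, ← singleAt_zero]
  exact varSurf_singleAt M N j 0

theorem regOcc_inst (M N : Term G) (i : ℕ) :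
    (inst M N).regOcc i = M.regOcc i + M.varOcc 0 * N.regOcc i := by
  rw [inst, ← singleAt_zero]
  exact regOcc_singleAt M N i 0

theorem regSurf_inst (M N : Term G) (i : ℕ) :
    (inst M N).regSurf i = M.regSurf i + M.varSurf 0 * N.regSurf i := by
  rw [inst, ← singleAt_zero]
  exact regSurf_singleAt M N i 0

theorem linearAbs_inst {M N : Term G} (hM : M.LinearAbs) (hN : N.LinearAbs) :
    (inst M N).LinearAbs := by
  rw [inst, ← singleAt_zero]
  exact linearAbs_singleAt 0 hM hN

theorem subst_singleAt_congr {M : Term G} {k : ℕ} (h : M.varOcc k = 0) (N N' : Term G) :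
    subst (singleAt k N) M = subst (singleAt k N') M := by
  induction M generalizing k with
  | var j =>
    simp only [varOcc] at h
    simp only [subst, singleAt]
    split_ifs at h ⊢ <;> simp_all
  | lam M ih | blam M ih =>
    simp only [subst, up_singleAt]
    rw [ih h]
  | _ => simp_all [subst, varOcc]

/-! ### One-step and parallel β-reduction -/

/-- One-step β-reduction of terms. -/
inductive Beta : Term G → Term G → Prop
  | b (M N : Term G) : Beta (.app (.lam M) N) (M.inst N)
  | bangb (M N : Term G) : Beta (.app (.blam M) (.bang N)) (M.inst N)
  | appL {M M'} (N : Term G) (h : Beta M M') : Beta (.app M N) (.app M' N)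
  | appR (M : Term G) {N N'} (h : Beta N N') : Beta (.app M N) (.app M N')
  | lam {M M'} (h : Beta M M') : Beta (.lam M) (.lam M')
  | blam {M M'} (h : Beta M M') : Beta (.blam M) (.blam M')
  | bang {M M'} (h : Beta M M') : Beta (.bang M) (.bang M')
  | measP {P P'} (M N : Term G) (h : Beta P P') : Beta (.meas P M N) (.meas P' M N)
  | measL (P : Term G) {M M'} (N : Term G) (h : Beta M M') : Beta (.meas P M N) (.meas P M' N)
  | measR (P M : Term G) {N N'} (h : Beta N N') : Beta (.meas P M N) (.meas P M N')

/-- Parallel β-reduction of terms. -/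
inductive Par : Term G → Term G → Prop
  | var (k : ℕ) : Par (.var k) (.var k)
  | bang {M M'} (h : Par M M') : Par (.bang M) (.bang M')
  | lam {M M'} (h : Par M M') : Par (.lam M) (.lam M')
  | blam {M M'} (h : Par M M') : Par (.blam M) (.blam M')
  | app {M M' N N'} (hM : Par M M') (hN : Par N N') : Par (.app M N) (.app M' N')
  | reg (i : ℕ) : Par (.reg i) (.reg i)
  | gate1 (A : G.Gate1) : Par (.gate1 A) (.gate1 A)
  | gate2 (A : G.Gate2) : Par (.gate2 A) (.gate2 A)
  | new : Par .new .new
  | meas {P P' M M' N N'} (hP : Par P P') (hM : Par M M') (hN : Par N N') :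
      Par (.meas P M N) (.meas P' M' N')
  | b {M M' N N'} (hM : Par M M') (hN : Par N N') : Par (.app (.lam M) N) (M'.inst N')
  | bangb {M M' N N'} (hM : Par M M') (hN : Par N N') :
      Par (.app (.blam M) (.bang N)) (M'.inst N')

theorem Par.rfl (M : Term G) : Par M M := by
  induction M <;> constructor <;> assumption

theorem Beta.par {M N : Term G} (h : Beta M N) : Par M N := by
  induction h with
  | b M N => exact .b (.rfl _) (.rfl _)
  | bangb M N => exact .bangb (.rfl _) (.rfl _)
  | _ => constructor <;> first | assumption | exact .rfl _

/-- A variable with only surface occurrences does not occur in the argument of a `!b`-redex, which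
is the only part that can be copied or erased; a `b`-redex moves its argument to exactly one surface
place. -/
theorem Beta.varOcc_eq {M N : Term G} (h : Beta M N) {k : ℕ} (hl : M.LinearAbs)
    (hk : M.varSurf k = M.varOcc k) :
    N.varOcc k = M.varOcc k ∧ N.varSurf k = M.varSurf k := by
  induction h generalizing k with
  | b M N => simp_all [varOcc_inst, varSurf_inst, LinearAbs, varOcc, varSurf]
  | bangb M N =>
    simp only [varOcc_inst, varSurf_inst, varOcc, varSurf] at hk ⊢
    have h1 := varSurf_le M (k + 1)
    have h2 := varSurf_le N k
    have h3 : N.varOcc k = 0 := by omega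
    have h4 : N.varSurf k = 0 := by omega
    simp [h3, h4]
  | @appL M M' N h ih =>
    have h1 := varSurf_le M k
    have h2 := varSurf_le N k
    simp only [varOcc, varSurf, LinearAbs] at *
    have := ih hl.1 (k := k) (by omega)
    omega
  | @appR M N N' h ih =>
    have h1 := varSurf_le M k
    have h2 := varSurf_le N k
    simp only [varOcc, varSurf, LinearAbs] at *
    have := ih hl.2 (k := k) (by omega)
    omega
  | lam h ih => exact ih hl.2 hk
  | blam h ih => exact ih hl hk
  | @bang M M' h ih =>
    have h1 := varSurf_le M k
    simp only [varOcc, varSurf, LinearAbs, and_true] at *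
    have := ih hl (k := k) (by omega)
    omega
  | @measP P P' M N h ih =>
    have h1 := varSurf_le P k
    simp only [varOcc, varSurf, LinearAbs] at *
    have := ih hl.1 (k := k) (by omega)
    omega
  | @measL P M M' N h ih =>
    have h1 := varSurf_le P k
    have h2 := varSurf_le M k
    simp only [varOcc, varSurf, LinearAbs, and_true] at *
    have := ih hl.2.1 (k := k) (by omega)
    omega
  | @measR P M N N' h ih =>
    have h1 := varSurf_le P k
    have h2 := varSurf_le N k
    simp only [varOcc, varSurf, LinearAbs, and_true] at *
    have := ih hl.2.2 (k := k) (by omega)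
    omega

/-- The same argument for registers. Hence β-reduction keeps the registers of a valid term, and the
memory can stay unchanged. -/
theorem Beta.regOcc_eq {M N : Term G} (h : Beta M N) {i : ℕ} (hl : M.LinearAbs)
    (hi : M.regSurf i = M.regOcc i) :
    N.regOcc i = M.regOcc i ∧ N.regSurf i = M.regSurf i := by
  induction h with
  | b M N => simp_all [regOcc_inst, regSurf_inst, LinearAbs, regOcc, regSurf]
  | bangb M N =>
    simp only [regOcc_inst, regSurf_inst, regOcc, regSurf] at hi ⊢
    have h1 := regSurf_le M i
    have h2 := regSurf_le N i
    have h3 : N.regOcc i = 0 := by omega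
    have h4 : N.regSurf i = 0 := by omega
    simp [h3, h4]
  | @appL M M' N h ih =>
    have h1 := regSurf_le M i
    have h2 := regSurf_le N i
    simp only [regOcc, regSurf, LinearAbs] at *
    have := ih hl.1 (by omega)
    omega
  | @appR M N N' h ih =>
    have h1 := regSurf_le M i
    have h2 := regSurf_le N i
    simp only [regOcc, regSurf, LinearAbs] at *
    have := ih hl.2 (by omega)
    omega
  | lam h ih => exact ih hl.2 hi
  | blam h ih => exact ih hl hi
  | @bang M M' h ih =>
    have h1 := regSurf_le M i
    simp only [regOcc, regSurf, LinearAbs, and_true] at *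
    have := ih hl (by omega)
    omega
  | @measP P P' M N h ih =>
    have h1 := regSurf_le P i
    simp only [regOcc, regSurf, LinearAbs] at *
    have := ih hl.1 (by omega)
    omega
  | @measL P M M' N h ih =>
    have h1 := regSurf_le P i
    have h2 := regSurf_le M i
    simp only [regOcc, regSurf, LinearAbs, and_true] at *
    have := ih hl.2.1 (by omega)
    omega
  | @measR P M N N' h ih =>
    have h1 := regSurf_le P i
    have h2 := regSurf_le N i
    simp only [regOcc, regSurf, LinearAbs, and_true] at *
    have := ih hl.2.2 (by omega)
    omega

theorem Beta.linearAbs {M N : Term G} (h : Beta M N) (hl : M.LinearAbs) : N.LinearAbs := by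
  induction h with
  | b M N => exact linearAbs_inst hl.1.2 hl.2
  | bangb M N => exact linearAbs_inst hl.1 hl.2
  | @lam M M' h ih =>
    have := h.varOcc_eq hl.2 (k := 0) (by rw [hl.1.1, hl.1.2])
    exact ⟨by rw [this.1, this.2]; exact hl.1, ih hl.2⟩
  | _ => simp_all [LinearAbs]

theorem Beta.valid {M N : Term G} (h : Beta M N) (hM : M.Valid) :
    N.Valid ∧ ∀ i, N.regOcc i = M.regOcc i := by
  have key := fun i => h.regOcc_eq hM.2 (hM.1 i).2
  refine ⟨⟨fun i => ?_, h.linearAbs hM.2⟩, fun i => (key i).1⟩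
  rw [(key i).1, (key i).2]
  exact hM.1 i

theorem star_cong {r : Term G → Term G → Prop} {f : Term G → Term G}
    (hf : ∀ M M', r M M' → r (f M) (f M')) {M M' : Term G}
    (h : Relation.ReflTransGen r M M') : Relation.ReflTransGen r (f M) (f M') :=
  h.lift f hf

theorem Par.star {M N : Term G} (h : Par M N) : Relation.ReflTransGen Beta M N := by
  induction h with
  | bang h ih => exact star_cong (f := .bang) (fun _ _ => .bang) ih
  | lam h ih => exact star_cong (f := .lam) (fun _ _ => .lam) ih
  | blam h ih => exact star_cong (f := .blam) (fun _ _ => .blam) ih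
  | @app M M' N N' _ _ ih1 ih2 =>
    exact (star_cong (f := (.app · N)) (fun _ _ => .appL _) ih1).trans
      (star_cong (f := .app M') (fun _ _ => .appR _) ih2)
  | @meas P P' M M' N N' _ _ _ ih1 ih2 ih3 =>
    exact ((star_cong (f := (.meas · M N)) (fun _ _ => .measP _ _) ih1).trans
      (star_cong (f := (.meas P' · N)) (fun _ _ => .measL _ _) ih2)).trans
      (star_cong (f := .meas P' M') (fun _ _ => .measR _ _) ih3)
  | @b M M' N N' _ _ ih1 ih2 =>
    exact ((star_cong (f := fun X => .app (.lam X) N) (fun _ _ h => .appL _ (.lam h)) ih1).trans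
      (star_cong (f := .app (.lam M')) (fun _ _ => .appR _) ih2)).tail (.b _ _)
  | @bangb M M' N N' _ _ ih1 ih2 =>
    exact ((star_cong (f := fun X => .app (.blam X) (.bang N))
        (fun _ _ h => .appL _ (.blam h)) ih1).trans
      (star_cong (f := fun X => .app (.blam M') (.bang X))
        (fun _ _ h => .appR _ (.bang h)) ih2)).tail (.bangb _ _)
  | _ => exact .refl

theorem star_valid {M N : Term G} (h : Relation.ReflTransGen Beta M N) (hM : M.Valid) :
    N.Valid ∧ ∀ i, N.regOcc i = M.regOcc i := by
  induction h with
  | refl => exact ⟨hM, fun _ => rfl⟩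
  | tail _ h ih => exact ⟨(h.valid ih.1).1, fun i => ((h.valid ih.1).2 i).trans (ih.2 i)⟩

theorem star_linear {M N : Term G} (h : Relation.ReflTransGen Beta M N) (hM : M.LinearAbs)
    {k : ℕ} (hk : M.varSurf k = M.varOcc k) :
    N.LinearAbs ∧ N.varOcc k = M.varOcc k ∧ N.varSurf k = M.varSurf k := by
  induction h with
  | refl => exact ⟨hM, rfl, rfl⟩
  | tail _ h ih =>
    have := h.varOcc_eq ih.1 (k := k) (by rw [ih.2.1, ih.2.2, hk])
    exact ⟨h.linearAbs ih.1, this.1.trans ih.2.1, this.2.trans ih.2.2⟩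

theorem Par.mapReg {M N : Term G} (h : Par M N) (g : ℕ → ℕ) :
    Par (M.mapReg g) (N.mapReg g) := by
  induction h with
  | b _ _ ih1 ih2 =>
    rw [mapReg_inst]
    exact .b ih1 ih2
  | bangb _ _ ih1 ih2 =>
    rw [mapReg_inst]
    exact .bangb ih1 ih2
  | _ => constructor <;> assumption

theorem Par.rename {M N : Term G} (h : Par M N) (f : ℕ → ℕ) :
    Par (Term.rename f M) (Term.rename f N) := by
  induction h generalizing f with
  | b _ _ ih1 ih2 =>
    rw [rename_inst]
    exact .b (ih1 _) (ih2 _)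
  | bangb _ _ ih1 ih2 =>
    rw [rename_inst]
    exact .bangb (ih1 _) (ih2 _)
  | _ => simp only [Term.rename]; constructor <;> simp_all

theorem Par.up {s t : ℕ → Term G} (h : ∀ k, Par (s k) (t k)) (k : ℕ) :
    Par (Term.up s k) (Term.up t k) := by
  cases k with
  | zero => exact .var 0
  | succ k => exact (h k).rename _

theorem Par.subst {M N : Term G} (h : Par M N) {s t : ℕ → Term G}
    (hs : ∀ k, Par (s k) (t k)) : Par (Term.subst s M) (Term.subst t N) := by
  induction h generalizing s t with
  | var k => exact hs k
  | lam _ ih => exact .lam (ih (Par.up hs))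
  | blam _ ih => exact .blam (ih (Par.up hs))
  | b _ _ ih1 ih2 =>
    rw [subst_inst]
    exact .b (ih1 (Par.up hs)) (ih2 hs)
  | bangb _ _ ih1 ih2 =>
    rw [subst_inst]
    exact .bangb (ih1 (Par.up hs)) (ih2 hs)
  | _ => simp only [Term.subst]; constructor <;> simp_all

theorem Par.inst {M M' N N' : Term G} (hM : Par M M') (hN : Par N N') :
    Par (M.inst N) (M'.inst N') := by
  refine hM.subst fun k => ?_
  cases k with
  | zero => exact hN
  | succ k => exact .var k

/-- The critical case is a redex contracted on one side only: its parts join by induction, the side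
that kept the redex contracts it, and the other side uses that parallel reduction is compatible with
substitution. -/
theorem Par.diamond {M A B : Term G} (hA : Par M A) (hB : Par M B) :
    ∃ C, Par A C ∧ Par B C := by
  induction hA generalizing B with
  | bang _ ih =>
    cases hB with | bang h =>
    obtain ⟨C, h1, h2⟩ := ih h
    exact ⟨_, .bang h1, .bang h2⟩
  | lam _ ih =>
    cases hB with | lam h =>
    obtain ⟨C, h1, h2⟩ := ih h
    exact ⟨_, .lam h1, .lam h2⟩
  | blam _ ih =>
    cases hB with | blam h =>
    obtain ⟨C, h1, h2⟩ := ih h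
    exact ⟨_, .blam h1, .blam h2⟩
  | meas _ _ _ ih1 ih2 ih3 =>
    cases hB with | meas h1 h2 h3 =>
    obtain ⟨C1, h1, h1'⟩ := ih1 h1
    obtain ⟨C2, h2, h2'⟩ := ih2 h2
    obtain ⟨C3, h3, h3'⟩ := ih3 h3
    exact ⟨_, .meas h1 h2 h3, .meas h1' h2' h3'⟩
  | app a1 a2 ih1 ih2 =>
    cases hB with
    | app h1 h2 =>
      obtain ⟨C1, h1, h1'⟩ := ih1 h1
      obtain ⟨C2, h2, h2'⟩ := ih2 h2
      exact ⟨_, .app h1 h2, .app h1' h2'⟩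
    | b h1 h2 =>
      -- The induction hypothesis speaks of the whole abstraction, so the reduct of the body is
      -- wrapped in `lam` and unwrapped by inversion afterwards.
      obtain ⟨C1, h1, h1'⟩ := ih1 (.lam h1)
      obtain ⟨C2, h2, h2'⟩ := ih2 h2
      cases a1
      cases h1 with | lam h1 =>
      cases h1' with | lam h1' =>
      exact ⟨_, .b h1 h2, h1'.inst h2'⟩
    | bangb h1 h2 =>
      obtain ⟨C1, h1, h1'⟩ := ih1 (.blam h1)
      obtain ⟨C2, h2, h2'⟩ := ih2 (.bang h2)
      cases a1
      cases a2
      cases h1 with | blam h1 =>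
      cases h1' with | blam h1' =>
      cases h2 with | bang h2 =>
      cases h2' with | bang h2' =>
      exact ⟨_, .bangb h1 h2, h1'.inst h2'⟩
  | b a1 a2 ih1 ih2 =>
    cases hB with
    | app h1 h2 =>
      cases h1 with | lam h1 =>
      obtain ⟨C1, h1, h1'⟩ := ih1 h1
      obtain ⟨C2, h2, h2'⟩ := ih2 h2
      exact ⟨_, h1.inst h2, .b h1' h2'⟩
    | b h1 h2 =>
      obtain ⟨C1, h1, h1'⟩ := ih1 h1
      obtain ⟨C2, h2, h2'⟩ := ih2 h2
      exact ⟨_, h1.inst h2, h1'.inst h2'⟩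
  | bangb a1 a2 ih1 ih2 =>
    cases hB with
    | app h1 h2 =>
      cases h1 with | blam h1 =>
      cases h2 with | bang h2 =>
      obtain ⟨C1, h1, h1'⟩ := ih1 h1
      obtain ⟨C2, h2, h2'⟩ := ih2 h2
      exact ⟨_, h1.inst h2, .bangb h1' h2'⟩
    | bangb h1 h2 =>
      obtain ⟨C1, h1, h1'⟩ := ih1 h1
      obtain ⟨C2, h2, h2'⟩ := ih2 h2
      exact ⟨_, h1.inst h2, h1'.inst h2'⟩
  | _ => cases hB; exact ⟨_, .rfl _, .rfl _⟩

end Term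

end QLambda

/-! ### Quantum redexes of terms and their commutation -/

namespace QLambda

/-- The quantum operations, with the registers on which they act. -/
inductive Lab (G : GateSet.{u}) : Type u
  | new (i : ℕ)
  | meas (i : ℕ)
  | u1 (A : G.Gate1) (i : ℕ)
  | u2 (A : G.Gate2) (i j : ℕ)

namespace Lab

variable {G : GateSet.{u}}

/-- Renaming of the registers of an operation. -/
def map (f : ℕ → ℕ) : Lab G → Lab G
  | new i => new (f i)
  | meas i => meas (f i)
  | u1 A i => u1 A (f i)
  | u2 A i j => u2 A (f i) (f j)

/-- The number of times an operation uses an already allocated register. -/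
def uses : Lab G → ℕ → ℕ
  | new _, _ => 0
  | meas i, k => if i = k then 1 else 0
  | u1 _ i, k => if i = k then 1 else 0
  | u2 _ i j, k => (if i = k then 1 else 0) + (if j = k then 1 else 0)

/-- The number of times an operation allocates a register. -/
def adds : Lab G → ℕ → ℕ
  | new i, k => if i = k then 1 else 0
  | _, _ => 0

/-- The number of times an operation deallocates a register. -/
def dels : Lab G → ℕ → ℕ
  | meas i, k => if i = k then 1 else 0
  | _, _ => 0

/-- The registers allocated by an operation do not occur in a term. -/
def Fresh (ℓ : Lab G) (M : Term G) : Prop := ∀ i, ℓ = new i → M.regOcc i = 0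

theorem Fresh.mono {ℓ : Lab G} {M N : Term G} (h : ℓ.Fresh M)
    (hle : ∀ i, N.regOcc i ≤ M.regOcc i) : ℓ.Fresh N := fun i hi => by
  have := h i hi
  have := hle i
  omega

end Lab

namespace Term

variable {G : GateSet.{u}}

/-- `QT ℓ M A B`: a surface redex of `M` performs the operation `ℓ`, and the term becomes `A` or
`B` according to the outcome of the operation. Operations other than measurements have only the
first outcome, and `A = B`. -/
inductive QT : Lab G → Term G → Term G → Term G → Prop
  | new (i : ℕ) : QT (.new i) .new (.reg i) (.reg i)
  | meas (i : ℕ) (M N : Term G) : QT (.meas i) (.meas (.reg i) M N) M N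
  | u1 (A : G.Gate1) (i : ℕ) : QT (.u1 A i) (.app (.gate1 A) (.reg i)) (.reg i) (.reg i)
  | u2 (A : G.Gate2) (i j : ℕ) :
      QT (.u2 A i j) (.app (.gate2 A) (.lam (.app (.app (.var 0) (.reg i)) (.reg j))))
        (.lam (.app (.app (.var 0) (.reg i)) (.reg j)))
        (.lam (.app (.app (.var 0) (.reg i)) (.reg j)))
  | appL {ℓ M A B} (N : Term G) (h : QT ℓ M A B) : QT ℓ (.app M N) (.app A N) (.app B N)
  | appR {ℓ N A B} (M : Term G) (h : QT ℓ N A B) : QT ℓ (.app M N) (.app M A) (.app M B)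
  | lam {ℓ M A B} (h : QT ℓ M A B) : QT ℓ (.lam M) (.lam A) (.lam B)
  | blam {ℓ M A B} (h : QT ℓ M A B) : QT ℓ (.blam M) (.blam A) (.blam B)
  | measP {ℓ P A B} (M N : Term G) (h : QT ℓ P A B) :
      QT ℓ (.meas P M N) (.meas A M N) (.meas B M N)

namespace QT

theorem mapReg {ℓ : Lab G} {M A B : Term G} (h : QT ℓ M A B) (g : ℕ → ℕ) :
    QT (ℓ.map g) (M.mapReg g) (A.mapReg g) (B.mapReg g) := by
  induction h <;> constructor <;> assumption

theorem rename {ℓ : Lab G} {M A B : Term G} (h : QT ℓ M A B) (f : ℕ → ℕ) :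
    QT ℓ (Term.rename f M) (Term.rename f A) (Term.rename f B) := by
  induction h generalizing f <;> constructor <;> simp_all

theorem subst {ℓ : Lab G} {M A B : Term G} (h : QT ℓ M A B) (s : ℕ → Term G) :
    QT ℓ (Term.subst s M) (Term.subst s A) (Term.subst s B) := by
  induction h generalizing s <;> constructor <;> simp_all

/-- A measurement discards a branch, but a variable with only surface occurrences does not occur in
branches. -/
theorem varOcc_eq {ℓ : Lab G} {M A B : Term G} (h : QT ℓ M A B) {k : ℕ}
    (hk : M.varSurf k = M.varOcc k) :
    (A.varOcc k = M.varOcc k ∧ A.varSurf k = M.varSurf k) ∧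
      (B.varOcc k = M.varOcc k ∧ B.varSurf k = M.varSurf k) := by
  induction h generalizing k with
  | meas i M N =>
    have h1 := varSurf_le M k
    have h2 := varSurf_le N k
    simp only [varOcc, varSurf] at *
    omega
  | @appL _ M A B N h ih =>
    have h1 := varSurf_le M k
    have h2 := varSurf_le N k
    simp only [varOcc, varSurf] at *
    have := ih (k := k) (by omega)
    omega
  | @appR _ N A B M h ih =>
    have h1 := varSurf_le M k
    have h2 := varSurf_le N k
    simp only [varOcc, varSurf] at *
    have := ih (k := k) (by omega)
    omega
  | lam h ih | blam h ih => exact ih hk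
  | @measP _ P A B M N h ih =>
    have h1 := varSurf_le P k
    simp only [varOcc, varSurf] at *
    have := ih (k := k) (by omega)
    omega
  | _ => simp [varOcc, varSurf]

theorem linearAbs {ℓ : Lab G} {M A B : Term G} (h : QT ℓ M A B) (hl : M.LinearAbs) :
    A.LinearAbs ∧ B.LinearAbs := by
  induction h with
  | lam h ih =>
    have := h.varOcc_eq (k := 0) (by rw [hl.1.1, hl.1.2])
    simp_all [LinearAbs]
  | _ => simp_all [LinearAbs]

/-- The balance of allocated and deallocated registers, in additive form to avoid truncated
subtraction. The branch discarded by a measurement contributes nothing, since registers in branches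
are not surface. -/
theorem regOcc_eq {ℓ : Lab G} {M A B : Term G} (h : QT ℓ M A B) {k : ℕ}
    (hk : M.regSurf k = M.regOcc k) :
    (A.regOcc k + ℓ.dels k = M.regOcc k + ℓ.adds k ∧ A.regSurf k = A.regOcc k) ∧
      (B.regOcc k + ℓ.dels k = M.regOcc k + ℓ.adds k ∧ B.regSurf k = B.regOcc k) := by
  induction h with
  | meas i M N =>
    have h1 := regSurf_le M k
    have h2 := regSurf_le N k
    simp only [regOcc, regSurf, Lab.dels, Lab.adds] at *
    omega
  | @appL _ M A B N h ih =>
    have h1 := regSurf_le M k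
    have h2 := regSurf_le N k
    simp only [regOcc, regSurf] at *
    have := ih (by omega)
    omega
  | @appR _ N A B M h ih =>
    have h1 := regSurf_le M k
    have h2 := regSurf_le N k
    simp only [regOcc, regSurf] at *
    have := ih (by omega)
    omega
  | lam h ih | blam h ih => exact ih hk
  | @measP _ P A B M N h ih =>
    have h1 := regSurf_le P k
    simp only [regOcc, regSurf] at *
    have := ih (by omega)
    omega
  | _ => simp [regOcc, regSurf, Lab.dels, Lab.adds]

/-- Since registers of a valid term occur at most once, this gives distinct registers to a binary
gate and to two redexes at disjoint positions. -/
theorem uses_le {ℓ : Lab G} {M A B : Term G} (h : QT ℓ M A B) (k : ℕ) :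
    ℓ.uses k ≤ M.regOcc k := by
  induction h <;> simp only [regOcc, Lab.uses] at * <;> omega

theorem valid {ℓ : Lab G} {M A B : Term G} (h : QT ℓ M A B) (hf : ℓ.Fresh M) (hM : M.Valid) :
    A.Valid ∧ B.Valid := by
  have key := fun k => h.regOcc_eq (hM.1 k).2
  have hadds : ∀ k, M.regOcc k + ℓ.adds k ≤ 1 := by
    intro k
    have := (hM.1 k).1
    cases ℓ with
    | new i =>
      have := hf i rfl
      simp only [Lab.adds]
      split_ifs with hik
      · subst hik
        omega
      · omega
    | _ => simpa [Lab.adds] using this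
  refine ⟨⟨fun k => ?_, (h.linearAbs hM.2).1⟩, ⟨fun k => ?_, (h.linearAbs hM.2).2⟩⟩
  · have := key k
    have := hadds k
    omega
  · have := key k
    have := hadds k
    omega

/-- A variable with a single occurrence, at a surface position, receives exactly one copy of `R`,
and a surface redex of that copy is a surface redex of the whole. -/
theorem subst_singleAt {ℓ : Lab G} {R A B : Term G} (h : QT ℓ R A B) {P : Term G} {k : ℕ}
    (ho : P.varOcc k = 1) (hs : P.varSurf k = 1) :
    QT ℓ (Term.subst (singleAt k R) P) (Term.subst (singleAt k A) P)
      (Term.subst (singleAt k B) P) := by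
  induction P generalizing k with
  | var j =>
    have hj : j = k := by
      by_contra hj
      simp [varOcc, hj] at ho
    subst hj
    simpa [Term.subst, singleAt] using h.rename _
  | lam P ih =>
    simp only [Term.subst, up_singleAt]
    exact .lam (ih ho hs)
  | blam P ih =>
    simp only [Term.subst, up_singleAt]
    exact .blam (ih ho hs)
  | app M N ihM ihN =>
    have h1 := varSurf_le M k
    have h2 := varSurf_le N k
    simp only [varOcc, varSurf] at ho hs
    simp only [Term.subst]
    by_cases hN : N.varOcc k = 0
    -- The variable does not occur in `N`, so substituting `R`, `A` or `B` there gives the same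
    -- term.
    · rw [subst_singleAt_congr hN A R, subst_singleAt_congr hN B R]
      exact .appL _ (ihM (by omega) (by omega))
    · have hM : M.varOcc k = 0 := by omega
      rw [subst_singleAt_congr hM A R, subst_singleAt_congr hM B R]
      exact .appR _ (ihN (by omega) (by omega))
  | meas P M N ihP ihM ihN =>
    have h1 := varSurf_le P k
    simp only [varOcc, varSurf] at ho hs
    simp only [Term.subst]
    have hM : M.varOcc k = 0 := by omega
    have hN : N.varOcc k = 0 := by omega
    rw [subst_singleAt_congr hN A R, subst_singleAt_congr hN B R,
      subst_singleAt_congr hM A R, subst_singleAt_congr hM B R]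
    exact .measP _ _ (ihP (by omega) hs)
  | _ => simp [varOcc, varSurf] at ho hs

theorem inst_right {ℓ : Lab G} {R A B : Term G} (h : QT ℓ R A B) {P : Term G}
    (ho : P.varOcc 0 = 1) (hs : P.varSurf 0 = 1) :
    QT ℓ (P.inst R) (P.inst A) (P.inst B) := by
  simp only [Term.inst, ← singleAt_zero]
  exact h.subst_singleAt ho hs

/-- Quantum steps commute with parallel β-reduction. -/
theorem par {ℓ : Lab G} {M A B N : Term G} (h : QT ℓ M A B) (p : Par M N) (hl : M.LinearAbs) :
    ∃ A' B', QT ℓ N A' B' ∧ Par A A' ∧ Par B B' := by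
  induction h generalizing N with
  | new i =>
    cases p
    exact ⟨_, _, .new i, .rfl _, .rfl _⟩
  | meas i M N =>
    cases p with | meas p1 p2 p3 =>
    cases p1
    exact ⟨_, _, .meas i _ _, p2, p3⟩
  | u1 A i =>
    cases p with | app p1 p2 =>
    cases p1
    cases p2
    exact ⟨_, _, .u1 A i, .rfl _, .rfl _⟩
  | u2 A i j =>
    cases p with | app p1 p2 =>
    cases p1
    cases p2 with | lam p2 =>
    cases p2 with | app p2 p3 =>
    cases p2 with | app p2 p4 =>
    cases p2
    cases p3
    cases p4
    exact ⟨_, _, .u2 A i j, .rfl _, .rfl _⟩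
  | appL N h ih =>
    cases p with
    | app p1 p2 =>
      obtain ⟨A', B', h', a, b⟩ := ih p1 hl.1
      exact ⟨_, _, .appL _ h', .app a p2, .app b p2⟩
    -- The quantum redex is in the body of the contracted abstraction; it survives the substitution
    -- with the same registers.
    | b p1 p2 =>
      obtain ⟨A', B', h', a, b⟩ := ih (.lam p1) hl.1
      cases h with | lam h =>
      cases h' with | lam h' =>
      cases a with | lam a =>
      cases b with | lam b =>
      exact ⟨_, _, h'.subst _, .b a p2, .b b p2⟩
    | bangb p1 p2 =>
      obtain ⟨A', B', h', a, b⟩ := ih (.blam p1) hl.1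
      cases h with | blam h =>
      cases h' with | blam h' =>
      cases a with | blam a =>
      cases b with | blam b =>
      exact ⟨_, _, h'.subst _, .bangb a p2, .bangb b p2⟩
  | appR M h ih =>
    cases p with
    | app p1 p2 =>
      obtain ⟨A', B', h', a, b⟩ := ih p2 hl.2
      exact ⟨_, _, .appR _ h', .app p1 a, .app p1 b⟩
    -- The quantum redex is in the argument. The reduct of the body still has one occurrence of the
    -- bound variable, at a surface position, so the redex is neither lost, copied nor hidden.
    | b p1 p2 =>
      obtain ⟨A', B', h', a, b⟩ := ih p2 hl.2
      have hlin := hl.1.1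
      have := star_linear p1.star hl.1.2 (k := 0) (by rw [hlin.1, hlin.2])
      exact ⟨_, _, h'.inst_right (this.2.1.trans hlin.1) (this.2.2.trans hlin.2),
        .b p1 a, .b p1 b⟩
    -- The argument is a `!`, inside which nothing is surface.
    | bangb p1 p2 => cases h
  | lam h ih =>
    cases p with | lam p =>
    obtain ⟨A', B', h', a, b⟩ := ih p hl.2
    exact ⟨_, _, .lam h', .lam a, .lam b⟩
  | blam h ih =>
    cases p with | blam p =>
    obtain ⟨A', B', h', a, b⟩ := ih p hl
    exact ⟨_, _, .blam h', .blam a, .blam b⟩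
  | measP M N h ih =>
    cases p with | meas p p2 p3 =>
    obtain ⟨A', B', h', a, b⟩ := ih p hl.1
    exact ⟨_, _, .measP _ _ h', .meas a p2 p3, .meas b p2 p3⟩

end QT

theorem mapReg_swap_of_fresh {M : Term G} {i j : ℕ} (hi : M.regOcc i = 0)
    (hj : M.regOcc j = 0) : M.mapReg (Equiv.swap i j) = M := by
  rw [mapReg_congr (g := id) M fun k hk => ?_, mapReg_id M id fun _ => rfl]
  refine Equiv.swap_apply_of_ne_of_ne ?_ ?_
  · rintro rfl
    omega
  · rintro rfl
    omega

/-- The ways in which two quantum steps of one term are related: they are the same, or they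
allocate the same register under two names, or they commute. -/
inductive QJoin : Lab G → Lab G → Term G → Term G → Term G → Term G → Prop
  | same (ℓ A B) : QJoin ℓ ℓ A B A B
  | new (i j A) : QJoin (.new i) (.new j) A A (A.mapReg (Equiv.swap i j))
      (A.mapReg (Equiv.swap i j))
  | square {ℓ ℓ' A B A' B' X₀₀ X₀₁ X₁₀ X₁₁} (hd : ∀ k, ℓ.uses k = 0 ∨ ℓ'.uses k = 0)
      (hA : QT ℓ' A X₀₀ X₀₁) (hB : QT ℓ' B X₁₀ X₁₁)
      (hA' : QT ℓ A' X₀₀ X₁₀) (hB' : QT ℓ B' X₀₁ X₁₁) : QJoin ℓ ℓ' A B A' B'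

/-- A context preserves the relation as long as it does not mention the two names of a doubly
allocated register. -/
theorem QJoin.congr {ℓ ℓ' : Lab G} {A B A' B' : Term G} (h : QJoin ℓ ℓ' A B A' B')
    (f : Term G → Term G) (hf : ∀ ℓ M A B, QT ℓ M A B → QT ℓ (f M) (f A) (f B))
    (hs : ∀ i j, ℓ = .new i → ℓ' = .new j → ∀ X,
      (f X).mapReg (Equiv.swap i j) = f (X.mapReg (Equiv.swap i j))) :
    QJoin ℓ ℓ' (f A) (f B) (f A') (f B') := by
  cases h with
  | same => exact .same _ _ _
  | new i j A =>
    rw [← hs i j rfl rfl]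
    exact .new i j (f A)
  | square hd hA hB hA' hB' =>
    exact .square hd (hf _ _ _ _ hA) (hf _ _ _ _ hB) (hf _ _ _ _ hA') (hf _ _ _ _ hB')

/-- Quantum redexes do not overlap: a register, a gate and a pair of registers contain no quantum
redex. So two redexes coincide or lie in different sides of an application, where no register is
shared. -/
theorem QT.join {ℓ ℓ' : Lab G} {M A B A' B' : Term G} (h : QT ℓ M A B) (h' : QT ℓ' M A' B')
    (hf : ℓ.Fresh M) (hf' : ℓ'.Fresh M) (hM : ∀ k, M.regOcc k ≤ 1) :
    QJoin ℓ ℓ' A B A' B' := by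
  induction h generalizing ℓ' A' B' with
  | new i =>
    cases h' with | new j =>
    simpa [Term.mapReg] using QJoin.new i j (.reg i)
  | meas i M N =>
    cases h' with
    | meas => exact .same _ _ _
    | measP _ _ h => cases h
  | u1 A i =>
    cases h' with
    | u1 => exact .same _ _ _
    | appL _ h | appR _ h => cases h
  | u2 A i j =>
    cases h' with
    | u2 => exact .same _ _ _
    | appL _ h => cases h
    | appR _ h =>
      cases h with | lam h =>
      cases h with
      | appR _ h => cases h
      | appL _ h =>
        cases h with
        | appL _ h | appR _ h => cases h
  | @appL ℓ M A B N h ih =>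
    simp only [regOcc] at hM
    cases h' with
    | u1 | u2 => cases h
    | appL _ h' =>
      refine QJoin.congr (ih h' (Lab.Fresh.mono hf fun i => by simp [regOcc])
        (Lab.Fresh.mono hf' fun i => by simp [regOcc]) fun k => by have := hM k; omega)
        (.app · N) (fun _ _ _ _ => .appL N) fun i j hi hj X => ?_
      have hi := hf i hi
      have hj := hf' j hj
      simp only [regOcc] at hi hj
      simp only [Term.mapReg]
      rw [mapReg_swap_of_fresh (M := N) (by omega) (by omega)]
    | appR _ h' =>
      refine .square (fun k => ?_) (.appR _ h') (.appR _ h') (.appL _ h) (.appL _ h)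
      have := h.uses_le k
      have := h'.uses_le k
      have := hM k
      omega
  | @appR ℓ N A B M h ih =>
    simp only [regOcc] at hM
    cases h' with
    | u1 => cases h
    | u2 =>
      cases h with | lam h =>
      cases h with
      | appR _ h => cases h
      | appL _ h =>
        cases h with
        | appL _ h | appR _ h => cases h
    | appR _ h' =>
      refine QJoin.congr (ih h' (Lab.Fresh.mono hf fun i => by simp [regOcc])
        (Lab.Fresh.mono hf' fun i => by simp [regOcc]) fun k => by have := hM k; omega)
        (.app M ·) (fun _ _ _ _ => .appR M) fun i j hi hj X => ?_
      have hi := hf i hi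
      have hj := hf' j hj
      simp only [regOcc] at hi hj
      simp only [Term.mapReg]
      rw [mapReg_swap_of_fresh (M := M) (by omega) (by omega)]
    | appL _ h' =>
      refine .square (fun k => ?_) (.appL _ h') (.appL _ h') (.appR _ h) (.appR _ h)
      have := h.uses_le k
      have := h'.uses_le k
      have := hM k
      omega
  | lam h ih =>
    cases h' with | lam h' =>
    exact QJoin.congr (ih h' hf hf' hM) .lam (fun _ _ _ _ => .lam) fun _ _ _ _ _ => rfl
  | blam h ih =>
    cases h' with | blam h' =>
    exact QJoin.congr (ih h' hf hf' hM) .blam (fun _ _ _ _ => .blam) fun _ _ _ _ _ => rfl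
  | @measP ℓ P A B M N h ih =>
    simp only [regOcc] at hM
    cases h' with
    | meas => cases h
    | measP _ _ h' =>
      refine QJoin.congr (ih h' (Lab.Fresh.mono hf fun i => by simp [regOcc, add_assoc])
        (Lab.Fresh.mono hf' fun i => by simp [regOcc, add_assoc])
        fun k => by have := hM k; omega)
        (.meas · M N) (fun _ _ _ _ => .measP M N) fun i j hi hj X => ?_
      have hi := hf i hi
      have hj := hf' j hj
      simp only [regOcc] at hi hj
      simp only [Term.mapReg]
      rw [mapReg_swap_of_fresh (M := M) (by omega) (by omega),
        mapReg_swap_of_fresh (M := N) (by omega) (by omega)]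

end Term

end QLambda

/-! ### Memories of named qubits and operators on a part of them -/

namespace QLambda

/-- Memories whose qubits are named by natural numbers, by their coordinates. -/
abbrev Mem : Type := (ℕ → Fin 2) → ℂ

namespace Mem

/-- The squared norm. -/
noncomputable def nrm (ψ : Mem) : ENNReal := ∑' b, ENNReal.ofReal (‖ψ b‖ ^ 2)

/-- Renaming of the qubits. -/
def perm (ψ : Mem) (τ : Equiv.Perm ℕ) : Mem := fun b => ψ (b ∘ τ)

/-- The laws of a part of the memory with basis `C`, that is read by `get` and written by
`put`. -/
structure IsPart {C : Type} (get : (ℕ → Fin 2) → C)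
    (put : (ℕ → Fin 2) → C → (ℕ → Fin 2)) : Prop where
  get_put : ∀ b c, get (put b c) = c
  put_get : ∀ b, put b (get b) = b
  put_put : ∀ b c d, put (put b c) d = put b d

/-- The action of a matrix on a part of the memory. -/
def act {C : Type} [Fintype C] (get : (ℕ → Fin 2) → C)
    (put : (ℕ → Fin 2) → C → (ℕ → Fin 2)) (K : Matrix C C ℂ) (ψ : Mem) : Mem :=
  fun b => ∑ c, K (get b) c * ψ (put b c)

theorem nrm_perm (ψ : Mem) (τ : Equiv.Perm ℕ) : (ψ.perm τ).nrm = ψ.nrm :=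
  (Equiv.arrowCongr τ.symm (Equiv.refl (Fin 2))).tsum_eq fun b => ENNReal.ofReal (‖ψ b‖ ^ 2)

theorem nrm_smul (ψ : Mem) (a : ℝ) :
    ((a : ℂ) • ψ).nrm = ENNReal.ofReal (a ^ 2) * ψ.nrm := by
  simp only [nrm, ← ENNReal.tsum_mul_left]
  refine tsum_congr fun b => ?_
  rw [← ENNReal.ofReal_mul (sq_nonneg a)]
  simp [mul_pow]

theorem nrm_zero : (0 : Mem).nrm = 0 := by simp [nrm]

theorem eq_zero_of_nrm {ψ : Mem} (h : ψ.nrm = 0) : ψ = 0 := by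
  funext b
  have := ENNReal.tsum_eq_zero.1 h b
  rw [ENNReal.ofReal_eq_zero] at this
  simpa using le_antisymm this (sq_nonneg _)

section Act

variable {C D : Type} [Fintype C] [Fintype D]
  {get : (ℕ → Fin 2) → C} {put : (ℕ → Fin 2) → C → (ℕ → Fin 2)}
  {get' : (ℕ → Fin 2) → D} {put' : (ℕ → Fin 2) → D → (ℕ → Fin 2)}

theorem act_smul (K : Matrix C C ℂ) (a : ℂ) (ψ : Mem) :
    act get put K (a • ψ) = a • act get put K ψ := by
  funext b
  simp only [act, Pi.smul_apply, smul_eq_mul, Finset.mul_sum]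
  exact Finset.sum_congr rfl fun c _ => by ring

/-- The hypotheses say that the two parts are disjoint; both sides are then the same double sum. -/
theorem act_comm (K : Matrix C C ℂ) (L : Matrix D D ℂ) (ψ : Mem)
    (h1 : ∀ b d, get (put' b d) = get b) (h2 : ∀ b c, get' (put b c) = get' b)
    (h3 : ∀ b c d, put' (put b c) d = put (put' b d) c) :
    act get put K (act get' put' L ψ) = act get' put' L (act get put K ψ) := by
  funext b
  simp only [act, Finset.mul_sum, h1, h2, h3]
  rw [Finset.sum_comm]
  exact Finset.sum_congr rfl fun d _ => Finset.sum_congr rfl fun c _ => by ring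

/-- Summation over the memory, with a part of it summed separately. -/
theorem tsum_put (h : IsPart get put) [Nonempty C] (f : (ℕ → Fin 2) → ENNReal) :
    ∑' b, ∑ c, f (put b c) = Fintype.card C * ∑' b, f b := by
  -- The involution that exchanges the content of the part with the extra value.
  let e : (ℕ → Fin 2) × C ≃ (ℕ → Fin 2) × C :=
    { toFun := fun x => (put x.1 x.2, get x.1)
      invFun := fun x => (put x.1 x.2, get x.1)
      left_inv := fun x => by simp [h.get_put, h.put_get, h.put_put]
      right_inv := fun x => by simp [h.get_put, h.put_get, h.put_put] }
  calc ∑' b, ∑ c, f (put b c) = ∑' b, ∑' c, f (put b c) := by simp [tsum_fintype]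
    _ = ∑' x : (ℕ → Fin 2) × C, f (put x.1 x.2) := ENNReal.tsum_prod.symm
    _ = ∑' x, (fun y : (ℕ → Fin 2) × C => f y.1) (e x) := rfl
    _ = ∑' x : (ℕ → Fin 2) × C, f x.1 := e.tsum_eq fun y => f y.1
    _ = ∑' b, ∑' _ : C, f b := ENNReal.tsum_prod (f := fun b _ => f b)
    _ = Fintype.card C * ∑' b, f b := by
      rw [← ENNReal.tsum_mul_left]
      simp [tsum_fintype]

/-- A family of operators that preserves the norm on a part preserves it on the memory. -/
theorem sum_nrm_act {ι : Type} [Fintype ι] (h : IsPart get put) [Nonempty C]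
    (K : ι → Matrix C C ℂ)
    (hK : ∀ v : C → ℂ, ∑ o, ∑ e, ‖(K o).mulVec v e‖ ^ 2 = ∑ d, ‖v d‖ ^ 2) (ψ : Mem) :
    ∑ o, (act get put (K o) ψ).nrm = ψ.nrm := by
  have hc : (Fintype.card C : ENNReal) ≠ 0 := by simp
  have hc' : (Fintype.card C : ENNReal) ≠ ⊤ := by simp
  -- After multiplication by the cardinality of `C`, `tsum_put` lets every sum over the memory also
  -- run over all values of the part. For each fixed `b` the claim is then `hK` for the vector `ψ
  -- (put b ·)`.
  refine (ENNReal.mul_right_inj hc hc').1 ?_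
  simp only [nrm, Finset.mul_sum]
  simp only [← tsum_put h]
  rw [← Summable.tsum_finsetSum fun _ _ => ENNReal.summable]
  refine tsum_congr fun b => ?_
  have key := hK fun c => ψ (put b c)
  simp only [act, h.get_put, h.put_put]
  rw [← ENNReal.ofReal_sum_of_nonneg fun _ _ => sq_nonneg _, ← key,
    ENNReal.ofReal_sum_of_nonneg fun _ _ => Finset.sum_nonneg fun _ _ => sq_nonneg _]
  refine Finset.sum_congr rfl fun o _ => ?_
  rw [ENNReal.ofReal_sum_of_nonneg fun _ _ => sq_nonneg _]
  rfl

theorem act_perm {get'' : (ℕ → Fin 2) → C} {put'' : (ℕ → Fin 2) → C → (ℕ → Fin 2)}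
    (K : Matrix C C ℂ) (ψ : Mem) (τ : Equiv.Perm ℕ) (h1 : ∀ b, get'' b = get (b ∘ τ))
    (h2 : ∀ b c, put'' b c ∘ τ = put (b ∘ τ) c) :
    act get'' put'' K (ψ.perm τ) = (act get put K ψ).perm τ := by
  funext b
  simp only [act, perm, h1, h2]

theorem act_ne_zero {K : Matrix C C ℂ} {ψ : Mem} {b : ℕ → Fin 2}
    (h : act get put K ψ b ≠ 0) : ∃ c, K (get b) c ≠ 0 ∧ ψ (put b c) ≠ 0 := by
  obtain ⟨c, -, hc⟩ := Finset.exists_ne_zero_of_sum_ne_zero h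
  exact ⟨c, left_ne_zero_of_mul hc, right_ne_zero_of_mul hc⟩

end Act

/-- Reading one qubit. -/
def get1 (i : ℕ) (b : ℕ → Fin 2) : Fin 2 := b i

/-- Writing one qubit. -/
def put1 (i : ℕ) (b : ℕ → Fin 2) (c : Fin 2) : ℕ → Fin 2 := Function.update b i c

/-- Reading two qubits. -/
def get2 (i j : ℕ) (b : ℕ → Fin 2) : Fin 2 × Fin 2 := (b i, b j)

/-- Writing two qubits. -/
def put2 (i j : ℕ) (b : ℕ → Fin 2) (c : Fin 2 × Fin 2) : ℕ → Fin 2 :=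
  Function.update (Function.update b i c.1) j c.2

theorem isPart1 (i : ℕ) : IsPart (get1 i) (put1 i) where
  get_put b c := by simp [get1, put1]
  put_get b := by simp [get1, put1]
  put_put b c d := by simp [put1]

theorem isPart2 {i j : ℕ} (h : i ≠ j) : IsPart (get2 i j) (put2 i j) where
  get_put b c := by simp [get2, put2, h]
  put_get b := by simp [get2, put2]
  put_put b c d := by
    simp only [put2]
    rw [Function.update_comm h.symm, Function.update_idem, Function.update_idem]

theorem act11_comm {i j : ℕ} (h : i ≠ j) (K L : Matrix (Fin 2) (Fin 2) ℂ) (ψ : Mem) :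
    act (get1 i) (put1 i) K (act (get1 j) (put1 j) L ψ) =
      act (get1 j) (put1 j) L (act (get1 i) (put1 i) K ψ) := by
  refine act_comm _ _ _ (fun b d => ?_) (fun b c => ?_) fun b c d => ?_
  · simp [get1, put1, h]
  · simp [get1, put1, h.symm]
  · exact Function.update_comm h _ _ _

theorem act12_comm {i j k : ℕ} (hj : i ≠ j) (hk : i ≠ k) (K : Matrix (Fin 2) (Fin 2) ℂ)
    (L : Matrix (Fin 2 × Fin 2) (Fin 2 × Fin 2) ℂ) (ψ : Mem) :
    act (get1 i) (put1 i) K (act (get2 j k) (put2 j k) L ψ) =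
      act (get2 j k) (put2 j k) L (act (get1 i) (put1 i) K ψ) := by
  refine act_comm _ _ _ (fun b d => ?_) (fun b c => ?_) fun b c d => ?_
  · simp [get1, put2, hj, hk]
  · simp [get2, put1, hj.symm, hk.symm]
  · simp only [put1, put2]
    rw [Function.update_comm hj, Function.update_comm hk]

theorem act22_comm {i l j k : ℕ} (hij : i ≠ j) (hik : i ≠ k) (hlj : l ≠ j) (hlk : l ≠ k)
    (K L : Matrix (Fin 2 × Fin 2) (Fin 2 × Fin 2) ℂ) (ψ : Mem) :
    act (get2 i l) (put2 i l) K (act (get2 j k) (put2 j k) L ψ) =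
      act (get2 j k) (put2 j k) L (act (get2 i l) (put2 i l) K ψ) := by
  refine act_comm _ _ _ (fun b d => ?_) (fun b c => ?_) fun b c d => ?_
  · simp [get2, put2, hij, hik, hlj, hlk]
  · simp [get2, put2, hij.symm, hik.symm, hlj.symm, hlk.symm]
  · simp only [put2]
    rw [Function.update_comm hlj, Function.update_comm hij, Function.update_comm hlk,
      Function.update_comm hik]

theorem sum_norm_sq_mulVec {C : Type} [Fintype C] [DecidableEq C] {A : Matrix C C ℂ}
    (hA : A ∈ Matrix.unitaryGroup C ℂ) (v : C → ℂ) :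
    ∑ e, ‖A.mulVec v e‖ ^ 2 = ∑ d, ‖v d‖ ^ 2 := by
  have key : ∀ w : C → ℂ, ((∑ e, ‖w e‖ ^ 2 : ℝ) : ℂ) = star w ⬝ᵥ w := by
    intro w
    simp only [dotProduct, Pi.star_apply, Complex.ofReal_sum, Complex.ofReal_pow]
    refine Finset.sum_congr rfl fun e _ => ?_
    rw [← Complex.conj_mul']
    rfl
  have : ((∑ e, ‖A.mulVec v e‖ ^ 2 : ℝ) : ℂ) = ((∑ d, ‖v d‖ ^ 2 : ℝ) : ℂ) := by
    rw [key, key, Matrix.star_mulVec, Matrix.dotProduct_mulVec, Matrix.vecMul_vecMul,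
      ← Matrix.star_eq_conjTranspose, Matrix.mem_unitaryGroup_iff'.1 hA, Matrix.vecMul_one]
  exact_mod_cast this

end Mem

/-! ### The operators of the quantum operations -/

namespace Lab

open Mem

variable {G : GateSet.{u}}

/-- The operator of the outcome `o` of an operation. Operations other than measurements have only
the outcome `0`. -/
noncomputable def op : Lab G → Fin 2 → Mem → Mem
  -- An unallocated qubit is already present with value `0`, so allocation leaves the memory
  -- unchanged.
  | new _, o => fun ψ => if o = 0 then ψ else 0
  -- The operator `|0⟩⟨o|`: project on the outcome, then reset the released qubit to `0`.
  | meas i, o => act (get1 i) (put1 i) (Matrix.single 0 o 1)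
  | u1 A i, o => act (get1 i) (put1 i) (if o = 0 then (G.mat1 A).1 else 0)
  | u2 A i j, o => act (get2 i j) (put2 i j) (if o = 0 then (G.mat2 A).1 else 0)

theorem op_smul (ℓ : Lab G) (o : Fin 2) (a : ℂ) (ψ : Mem) :
    ℓ.op o (a • ψ) = a • ℓ.op o ψ := by
  cases ℓ with
  | new i =>
    simp only [op]
    split_ifs <;> simp
  | _ => exact act_smul _ _ _

theorem op_zero (ℓ : Lab G) (o : Fin 2) : ℓ.op o 0 = 0 := by
  simpa using ℓ.op_smul o 0 0

theorem new_op_comm (i : ℕ) (ℓ : Lab G) (o o' : Fin 2) (ψ : Mem) :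
    (new i : Lab G).op o (ℓ.op o' ψ) = ℓ.op o' ((new i : Lab G).op o ψ) := by
  have hnew : ∀ ψ, (new i : Lab G).op o ψ = if o = 0 then ψ else 0 := fun _ => rfl
  rw [hnew, hnew]
  split_ifs
  · rfl
  · rw [op_zero]

theorem op_comm {ℓ ℓ' : Lab G} (h : ∀ k, ℓ.uses k = 0 ∨ ℓ'.uses k = 0) (o o' : Fin 2)
    (ψ : Mem) : ℓ.op o (ℓ'.op o' ψ) = ℓ'.op o' (ℓ.op o ψ) := by
  have hne : ∀ i j, ℓ.uses i ≠ 0 → ℓ'.uses j ≠ 0 → i ≠ j := by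
    rintro i j hi hj rfl
    rcases h i with h | h <;> contradiction
  cases ℓ with
  | new i => exact new_op_comm _ _ _ _ _
  | u2 A i k =>
    cases ℓ' with
    | new j => exact (new_op_comm _ _ _ _ _).symm
    | u2 B j l =>
      exact act22_comm (hne _ _ (by simp [uses]) (by simp [uses]))
        (hne _ _ (by simp [uses]) (by simp [uses])) (hne _ _ (by simp [uses]) (by simp [uses]))
        (hne _ _ (by simp [uses]) (by simp [uses])) _ _ _
    | _ =>
      exact (act12_comm (hne _ _ (by simp [uses]) (by simp [uses])).symm
        (hne _ _ (by simp [uses]) (by simp [uses])).symm _ _ _).symm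
  | _ =>
    cases ℓ' with
    | new j => exact (new_op_comm _ _ _ _ _).symm
    | u2 B j l =>
      exact act12_comm (hne _ _ (by simp [uses]) (by simp [uses]))
        (hne _ _ (by simp [uses]) (by simp [uses])) _ _ _
    | _ => exact act11_comm (hne _ _ (by simp [uses]) (by simp [uses])) _ _ _

theorem op_perm (ℓ : Lab G) (o : Fin 2) (ψ : Mem) (τ : Equiv.Perm ℕ) :
    (ℓ.map τ).op o (ψ.perm τ) = (ℓ.op o ψ).perm τ := by
  have hu : ∀ (b : ℕ → Fin 2) i c,
      Function.update b (τ i) c ∘ τ = Function.update (b ∘ τ) i c := fun b i c =>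
    Function.update_comp_eq_of_injective b τ.injective i c
  cases ℓ with
  | new i =>
    simp only [op, map]
    split_ifs <;> rfl
  | u2 A i j =>
    exact act_perm _ _ _ (fun _ => rfl) fun b c => by simp only [put2, hu]
  | _ => exact act_perm _ _ _ (fun _ => rfl) fun b c => hu _ _ _

/-- Conservation of probability: gates are unitary, and `|0⟩⟨0|`, `|0⟩⟨1|` together preserve the
squared norm. The bound on `uses` excludes a binary gate applied twice to one qubit. -/
theorem nrm_op (ℓ : Lab G) (h : ∀ k, ℓ.uses k ≤ 1) (ψ : Mem) :
    (ℓ.op 0 ψ).nrm + (ℓ.op 1 ψ).nrm = ψ.nrm := by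
  rw [← Fin.sum_univ_two fun o => (ℓ.op o ψ).nrm]
  cases ℓ with
  | new i => simp [op, nrm_zero]
  | meas i =>
    refine sum_nrm_act (isPart1 i) _ (fun v => ?_) ψ
    simp [Matrix.mulVec, dotProduct, Matrix.single_apply, Fin.sum_univ_two]
  | u1 A i =>
    refine sum_nrm_act (isPart1 i) _ (fun v => ?_) ψ
    rw [← sum_norm_sq_mulVec (G.mat1 A).2, Fin.sum_univ_two]
    simp
  | u2 A i j =>
    refine sum_nrm_act (isPart2 ?_) _ (fun v => ?_) ψ
    · rintro rfl
      simpa [uses] using h i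
    · rw [← sum_norm_sq_mulVec (G.mat2 A).2, Fin.sum_univ_two]
      simp

end Lab

/-- The qubits of a memory are the registers of a term: the other ones are `0`. -/
def Mem.SuppIn {G : GateSet.{u}} (ψ : Mem) (M : Term G) : Prop :=
  ∀ b, ψ b ≠ 0 → ∀ i, M.regOcc i = 0 → b i = 0

theorem Term.QT.suppIn {G : GateSet.{u}} {ℓ : Lab G} {M A B : Term G} (h : QT ℓ M A B)
    (hM : M.Valid) {ψ : Mem} (hψ : ψ.SuppIn M) (o : Fin 2) :
    (ℓ.op o ψ).SuppIn A ∧ (ℓ.op o ψ).SuppIn B := by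
  -- By the balance `regOcc_eq`, the condition on `i` says that the register does not occur in the
  -- reducts: it was absent and is not allocated, or it has just been measured.
  suffices key : ∀ b, ℓ.op o ψ b ≠ 0 → ∀ i, M.regOcc i + ℓ.adds i = ℓ.dels i → b i = 0 by
    have hr := fun i => h.regOcc_eq (hM.1 i).2
    exact ⟨fun b hb i hi => key b hb i (by have := hr i; omega),
      fun b hb i hi => key b hb i (by have := hr i; omega)⟩
  intro b hb i hi
  have hu := h.uses_le i
  cases ℓ with
  | new j =>
    simp only [Lab.op] at hb
    simp only [Lab.adds, Lab.dels] at hi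
    split_ifs at hb with ho
    · exact hψ b hb i (by omega)
    · simp at hb
  | meas j =>
    obtain ⟨c, hc, hc'⟩ := Mem.act_ne_zero hb
    simp only [Lab.adds, Lab.dels] at hi
    split_ifs at hi with hj
    · subst hj
      by_contra hne
      exact hc (by simp [Mem.get1, Ne.symm hne])
    · have := hψ _ hc' i (by omega)
      rwa [Mem.put1, Function.update_of_ne (Ne.symm hj)] at this
  | u1 C j =>
    obtain ⟨c, hc, hc'⟩ := Mem.act_ne_zero hb
    simp only [Lab.adds, Lab.dels, Lab.uses] at hi hu
    have hj : i ≠ j := by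
      rintro rfl
      simp at hu
      omega
    have := hψ _ hc' i (by omega)
    rwa [Mem.put1, Function.update_of_ne hj] at this
  | u2 C j k =>
    obtain ⟨c, hc, hc'⟩ := Mem.act_ne_zero hb
    simp only [Lab.adds, Lab.dels, Lab.uses] at hi hu
    have hj : i ≠ j := by
      rintro rfl
      simp at hu
      omega
    have hk : i ≠ k := by
      rintro rfl
      simp at hu
      omega
    have := hψ _ hc' i (by omega)
    rwa [Mem.put2, Function.update_of_ne hk, Function.update_of_ne hj] at this

end QLambda

namespace QLambda

/-! ### Memories of named qubits and vectors -/

open Classical in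
/-- The memory with qubits `0, …, n-1` given by a vector. -/
noncomputable def embVec {n : ℕ} (Q : Vec n) : Mem :=
  fun b => if ∀ i, n ≤ i → b i = 0 then Q (fun i => b i) else 0

theorem embVec_of {n : ℕ} (Q : Vec n) {b : ℕ → Fin 2} (h : ∀ i, n ≤ i → b i = 0) :
    embVec Q b = Q fun i => b i := if_pos h

theorem embVec_of_not {n : ℕ} (Q : Vec n) {b : ℕ → Fin 2} (h : ¬ ∀ i, n ≤ i → b i = 0) :
    embVec Q b = 0 := if_neg h

/-- Extension of a bit string by `0`. -/
def padBits {n : ℕ} (c : Fin n → Fin 2) : ℕ → Fin 2 := fun i => if h : i < n then c ⟨i, h⟩ else 0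

theorem padBits_apply {n : ℕ} (c : Fin n → Fin 2) (i : Fin n) : padBits c i = c i := by
  simp [padBits]

theorem padBits_of_le {n : ℕ} (c : Fin n → Fin 2) {i : ℕ} (h : n ≤ i) : padBits c i = 0 := by
  simp [padBits, h]

theorem embVec_padBits {n : ℕ} (Q : Vec n) (c : Fin n → Fin 2) : embVec Q (padBits c) = Q c := by
  rw [embVec, if_pos fun i hi => padBits_of_le c hi]
  congr 1
  funext i
  exact padBits_apply c i

theorem eq_padBits {n : ℕ} {b : ℕ → Fin 2} (h : ∀ i, n ≤ i → b i = 0) :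
    padBits (fun i : Fin n => b i) = b := by
  funext i
  by_cases hi : i < n
  · simp [padBits, hi]
  · simp [padBits, hi, h i (not_lt.1 hi)]

theorem embVec_injective {n : ℕ} {Q Q' : Vec n} (h : embVec Q = embVec Q') : Q = Q' := by
  funext c
  rw [← embVec_padBits Q, h, embVec_padBits]

theorem padBits_injective {n : ℕ} : Function.Injective (padBits (n := n)) := by
  intro c d h
  funext i
  rw [← padBits_apply c, h, padBits_apply]

theorem nrm_embVec {n : ℕ} (Q : Vec n) :
    (embVec Q).nrm = ENNReal.ofReal (∑ b, ‖Q b‖ ^ 2) := by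
  rw [Mem.nrm, ← (padBits_injective (n := n)).tsum_eq, tsum_fintype,
    ENNReal.ofReal_sum_of_nonneg fun _ _ => sq_nonneg _]
  · exact Finset.sum_congr rfl fun c _ => by rw [embVec_padBits]
  · intro b hb
    have : ∀ i, n ≤ i → b i = 0 := by
      by_contra h
      simp [embVec, h] at hb
    exact ⟨_, eq_padBits this⟩

theorem isState_iff {n : ℕ} (Q : Vec n) : IsState Q ↔ (embVec Q).nrm = 1 := by
  rw [nrm_embVec, IsState, ENNReal.ofReal_eq_one]

theorem exists_embVec {ψ : Mem} {n : ℕ} (h : ∀ b, ψ b ≠ 0 → ∀ i, n ≤ i → b i = 0) :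
    ∃ Q : Vec n, embVec Q = ψ := by
  refine ⟨fun c => ψ (padBits c), ?_⟩
  funext b
  by_cases hb : ∀ i, n ≤ i → b i = 0
  · rw [embVec, if_pos hb, eq_padBits hb]
  · rw [embVec, if_neg hb]
    by_contra h0
    exact hb (h b (Ne.symm h0))

theorem embVec_smul_add {n : ℕ} (a b : ℂ) (Q Q' : Vec n) :
    embVec (a • Q + b • Q') = a • embVec Q + b • embVec Q' := by
  funext c
  simp only [embVec, Pi.add_apply, Pi.smul_apply]
  split_ifs <;> simp

theorem embVec_tensorKet {n : ℕ} (Q : Vec n) (c : Fin 2) (b : ℕ → Fin 2) :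
    embVec (tensorKet Q c) b = if b n = c then embVec Q (Function.update b n 0) else 0 := by
  have h : (∀ i, n + 1 ≤ i → b i = 0) ↔ ∀ i, n ≤ i → Function.update b n 0 i = 0 := by
    constructor
    · intro h i hi
      by_cases hin : i = n
      · simp [hin]
      · rw [Function.update_of_ne hin]
        exact h i (by omega)
    · intro h i hi
      have := h i (by omega)
      rwa [Function.update_of_ne (by omega)] at this
  have h' : (Fin.init fun i : Fin (n + 1) => b i) =
      fun i : Fin n => Function.update b n 0 (i : ℕ) := by
    funext i
    rw [Function.update_of_ne (Nat.ne_of_lt i.2)]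
    rfl
  by_cases hb : ∀ i, n + 1 ≤ i → b i = 0
  · rw [embVec_of _ hb, embVec_of _ (h.1 hb), tensorKet, h']
    rfl
  · rw [embVec_of_not _ hb, embVec_of_not _ (h.not.1 hb), ite_self]

/-- This justifies reading allocation as the identity on memories. -/
theorem embVec_tensorKet_zero {n : ℕ} (Q : Vec n) : embVec (tensorKet Q 0) = embVec Q := by
  funext b
  rw [embVec_tensorKet]
  split_ifs with h
  · rw [← h, Function.update_eq_self]
  · rw [embVec, if_neg fun h' => h (h' n le_rfl)]

theorem embVec_apply1 {n : ℕ} (A : Matrix (Fin 2) (Fin 2) ℂ) (Q : Vec (n + 1)) :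
    embVec (apply1 A Q) = Mem.act (Mem.get1 0) (Mem.put1 0) A (embVec Q) := by
  funext b
  have h : ∀ c, (∀ i, n + 1 ≤ i → Mem.put1 0 b c i = 0) ↔ ∀ i, n + 1 ≤ i → b i = 0 := fun c =>
    forall₂_congr fun i hi => by rw [Mem.put1, Function.update_of_ne (by omega)]
  have h' : ∀ c, (fun i : Fin (n + 1) => Mem.put1 0 b c i) =
      Function.update (fun i : Fin (n + 1) => b i) 0 c := by
    intro c
    funext i
    by_cases hi : i = 0
    · subst hi
      rw [Function.update_self]
      exact Function.update_self _ _ _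
    · rw [Function.update_of_ne hi, Mem.put1, Function.update_of_ne]
      exact fun h => hi (Fin.ext h)
  by_cases hb : ∀ i, n + 1 ≤ i → b i = 0
  · rw [embVec_of _ hb]
    refine Finset.sum_congr rfl fun c _ => ?_
    rw [embVec_of _ ((h c).2 hb), h']
    rfl
  · rw [embVec_of_not _ hb]
    refine (Finset.sum_eq_zero fun c _ => ?_).symm
    rw [embVec_of_not _ ((h c).not.2 hb), mul_zero]

theorem embVec_apply2 {n : ℕ} (A : Matrix (Fin 2 × Fin 2) (Fin 2 × Fin 2) ℂ) (Q : Vec (n + 2)) :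
    embVec (apply2 A Q) = Mem.act (Mem.get2 0 1) (Mem.put2 0 1) A (embVec Q) := by
  funext b
  have h : ∀ c, (∀ i, n + 2 ≤ i → Mem.put2 0 1 b c i = 0) ↔ ∀ i, n + 2 ≤ i → b i = 0 :=
    fun c => forall₂_congr fun i hi => by
      rw [Mem.put2, Function.update_of_ne (by omega), Function.update_of_ne (by omega)]
  have h' : ∀ c, (fun i : Fin (n + 2) => Mem.put2 0 1 b c i) =
      Function.update (Function.update (fun i : Fin (n + 2) => b i) 0 c.1) 1 c.2 := by
    intro c
    funext i
    by_cases hi : i = 1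
    · simp [hi, Mem.put2]
    · have hi' : (i : ℕ) ≠ 1 := fun h => hi (Fin.ext h)
      rw [Function.update_of_ne hi, Mem.put2, Function.update_of_ne hi']
      by_cases hz : i = 0
      · subst hz
        rw [Function.update_self]
        exact Function.update_self _ _ _
      · rw [Function.update_of_ne hz, Function.update_of_ne]
        exact fun h => hz (Fin.ext h)
  by_cases hb : ∀ i, n + 2 ≤ i → b i = 0
  · rw [embVec_of _ hb]
    refine Finset.sum_congr rfl fun c _ => ?_
    rw [embVec_of _ ((h c).2 hb), h']
    rfl
  · rw [embVec_of_not _ hb]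
    refine (Finset.sum_eq_zero fun c _ => ?_).symm
    rw [embVec_of_not _ ((h c).not.2 hb), mul_zero]

/-- A vector is determined by its projections to the values of the last qubit. -/
theorem embVec_eq_iff {n : ℕ} (Q : Vec (n + 1)) (Q' : Fin 2 → Mem)
    (hQ' : ∀ c b, Q' c b ≠ 0 → b n = 0) :
    (∀ c, Mem.act (Mem.get1 n) (Mem.put1 n) (Matrix.single 0 c 1) (embVec Q) = Q' c) ↔
      ∀ b, embVec Q b = Q' (b n) (Function.update b n 0) := by
  have key : ∀ c b, Mem.act (Mem.get1 n) (Mem.put1 n) (Matrix.single 0 c 1) (embVec Q) b =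
      if b n = 0 then embVec Q (Function.update b n c) else 0 := by
    intro c b
    simp only [Mem.act, Mem.get1, Mem.put1, Matrix.single_apply]
    by_cases h : b n = 0
    · simp [h]
    · simp [h, Ne.symm h]
  constructor
  · intro h b
    rw [← h, key]
    simp
  · intro h c
    funext b
    rw [key]
    split_ifs with hb
    · rw [h]
      simp only [Function.update_self, Function.update_idem]
      rw [← hb, Function.update_eq_self]
    · by_contra hne
      exact hb (hQ' c b (Ne.symm hne))

theorem embVec_last {n : ℕ} (Q : Vec n) (b : ℕ → Fin 2) (h : embVec Q b ≠ 0) : b n = 0 := by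
  by_contra hb
  exact h (if_neg fun h' => hb (h' n le_rfl))

/-- The decomposition demanded by rule `(m)` is expressed by the measurement operators: the
unnormalized outcomes are the components of `Q` along the last qubit. -/
theorem eq_tensorKet_iff {n : ℕ} (Q : Vec (n + 1)) (a : Fin 2 → ℂ) (Q' : Fin 2 → Vec n) :
    Q = a 0 • tensorKet (Q' 0) 0 + a 1 • tensorKet (Q' 1) 1 ↔
      ∀ c, Mem.act (Mem.get1 n) (Mem.put1 n) (Matrix.single 0 c 1) (embVec Q) =
        a c • embVec (Q' c) := by
  rw [embVec_eq_iff Q (fun c => a c • embVec (Q' c)) fun c b h =>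
    embVec_last (Q' c) b fun h' => h (by simp [h'])]
  have key : ∀ b, embVec (a 0 • tensorKet (Q' 0) 0 + a 1 • tensorKet (Q' 1) 1) b =
      a (b n) • embVec (Q' (b n)) (Function.update b n 0) := by
    intro b
    rw [embVec_smul_add]
    simp only [Pi.add_apply, Pi.smul_apply, embVec_tensorKet]
    generalize b n = c
    fin_cases c <;> simp
  constructor
  · intro h b
    rw [h]
    exact key b
  · intro h
    refine embVec_injective (funext fun b => ?_)
    rw [h, key]
    rfl

/-! ### Programs with named registers -/

/-- Programs whose registers are named by natural numbers. -/
@[ext]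
structure NProg (G : GateSet.{u}) : Type u where
  vec : Mem
  term : Term G
  valid : term.Valid
  supp : vec.SuppIn term
  norm : vec.nrm = 1

section

variable {G : GateSet.{u}}

theorem Term.regOcc_mapReg_perm (M : Term G) (τ : Equiv.Perm ℕ) (i : ℕ) :
    (M.mapReg τ).regOcc i = M.regOcc (τ.symm i) := by
  rw [← Term.regOcc_mapReg M τ.injective, Equiv.apply_symm_apply]

theorem Term.Valid.mapReg {M : Term G} (h : M.Valid) (τ : Equiv.Perm ℕ) : (M.mapReg τ).Valid := by
  refine ⟨fun i => ?_, (linearAbs_mapReg M τ).2 h.2⟩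
  obtain ⟨i, rfl⟩ := τ.surjective i
  rw [regOcc_mapReg M τ.injective, regSurf_mapReg M τ.injective]
  exact h.1 i

theorem Mem.SuppIn.perm {ψ : Mem} {M : Term G} (h : ψ.SuppIn M) (τ : Equiv.Perm ℕ) :
    (ψ.perm τ).SuppIn (M.mapReg τ) := by
  intro b hb i hi
  rw [Term.regOcc_mapReg_perm] at hi
  simpa using h _ hb _ hi

namespace NProg

/-- Renaming of the registers. -/
def perm (x : NProg G) (τ : Equiv.Perm ℕ) : NProg G where
  vec := x.vec.perm τ
  term := x.term.mapReg τ
  valid := x.valid.mapReg τ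
  supp := x.supp.perm τ
  norm := (Mem.nrm_perm _ _).trans x.norm

theorem perm_perm (x : NProg G) (σ τ : Equiv.Perm ℕ) :
    (x.perm σ).perm τ = x.perm (τ * σ) :=
  NProg.ext rfl (Term.mapReg_mapReg _ _ _)

theorem perm_one (x : NProg G) : x.perm 1 = x :=
  NProg.ext rfl (Term.mapReg_id _ _ fun _ => rfl)

end NProg

/-- The memory of a pair. -/
noncomputable def Config.mem (c : Config G) : Mem := embVec c.vec

theorem RawProgram.regOcc_pos (p : RawProgram G) (i : ℕ) :
    0 < p.config.term.regOcc i ↔ i < p.config.size :=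
  Set.ext_iff.1 p.regs_eq i

/-- A raw program is a program with named registers. -/
noncomputable def emb (p : RawProgram G) : NProg G where
  vec := p.config.mem
  term := p.config.term
  valid := p.valid
  supp := by
    intro b hb i hi
    have h : ∀ i, p.config.size ≤ i → b i = 0 := by
      by_contra h
      exact hb (if_neg h)
    refine h i (not_lt.1 fun hlt => ?_)
    have := (p.regOcc_pos i).2 hlt
    omega
  norm := (isState_iff _).1 p.isState

theorem exists_emb (x : NProg G) {n : ℕ} (hn : ∀ i, 0 < x.term.regOcc i ↔ i < n) :
    ∃ (Q : Vec n) (hs : IsState Q) (hr : x.term.regs = {i | i < n}),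
      embVec Q = x.vec ∧ emb ⟨⟨n, Q, x.term⟩, hs, x.valid, hr⟩ = x := by
  obtain ⟨Q, hQ⟩ := exists_embVec (ψ := x.vec) (n := n) fun b hb i hi => x.supp b hb i (by
    by_contra h
    have := (hn i).1 (Nat.pos_of_ne_zero h)
    omega)
  exact ⟨Q, (isState_iff Q).2 (by rw [hQ, x.norm]), Set.ext hn, hQ, NProg.ext hQ rfl⟩

/-- Renames the registers of a term to an initial segment, as raw programs require. -/
theorem exists_perm_lt {s : Set ℕ} (hs : s.Finite) :
    ∃ (n : ℕ) (τ : Equiv.Perm ℕ), ∀ i, i ∈ s ↔ τ i < n := by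
  induction s, hs using Set.Finite.induction_on with
  | empty => exact ⟨0, 1, by simp⟩
  | @insert a s ha _ ih =>
    obtain ⟨n, τ, h⟩ := ih
    -- Both `τ a` and `n` are at least `n`, so the swap does not disturb the images of `s` and gives
    -- `a` the new value `n`.
    refine ⟨n + 1, τ.trans (Equiv.swap (τ a) n), fun i => ?_⟩
    have han := (h a).not.1 ha
    have hi := h i
    simp only [Set.mem_insert_iff, Equiv.trans_apply]
    by_cases hia : i = a
    · simp [hia]
    · have hne : τ i ≠ τ a := τ.injective.ne hia
      by_cases hin : τ i = n
      · rw [hin, Equiv.swap_apply_right]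
        rw [hin] at hi
        simp only [hia, hi, false_or]
        have : τ a ≠ n := by omega
        omega
      · rw [Equiv.swap_apply_of_ne_of_ne hne hin]
        simp only [hia, hi, false_or]
        omega

theorem NProg.exists_perm (x : NProg G) :
    ∃ (n : ℕ) (τ : Equiv.Perm ℕ), ∀ i, 0 < (x.perm τ).term.regOcc i ↔ i < n := by
  obtain ⟨n, τ, h⟩ := exists_perm_lt x.term.finite_regs
  refine ⟨n, τ, fun i => ?_⟩
  have : (x.perm τ).term.regOcc i = x.term.regOcc (τ.symm i) := Term.regOcc_mapReg_perm _ _ _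
  rw [this]
  exact (h (τ.symm i)).trans (by rw [Equiv.apply_symm_apply])

theorem exists_prog (x : NProg G) : ∃ p : RawProgram G, ∃ τ, x.perm τ = emb p := by
  obtain ⟨n, τ, h⟩ := x.exists_perm
  obtain ⟨Q, hs, hr, -, he⟩ := exists_emb _ h
  exact ⟨_, τ, he.symm⟩

/-- The program of a program with named registers. -/
noncomputable def prog (x : NProg G) : Program G := Program.mk (exists_prog x).choose

/-- The permutation carries the registers of `p` onto those of `q`. Both sets are initial segments
of ℕ, so they are equal by cardinality, and it restricts to a re-indexing. -/
theorem mk_eq_of_perm {p q : RawProgram G} {τ : Equiv.Perm ℕ} (h : (emb p).perm τ = emb q) :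
    Program.mk p = Program.mk q := by
  have hp := p.regOcc_pos
  have hq := q.regOcc_pos
  obtain ⟨⟨n, Q, M⟩, hs, hv, hr⟩ := p
  obtain ⟨⟨m, Q', M'⟩, hs', hv', hr'⟩ := q
  have hM : M.mapReg τ = M' := congrArg NProg.term h
  have hQ : (embVec Q).perm τ = embVec Q' := congrArg NProg.vec h
  simp only at hp hq
  have hlt : ∀ i, τ i < m ↔ i < n := by
    intro i
    rw [← hp, ← hq, ← hM, Term.regOcc_mapReg M τ.injective]
  have hnm : n = m := by
    have e : (Finset.range n).map τ.toEmbedding = Finset.range m := by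
      ext i
      simp only [Finset.mem_map_equiv, Finset.mem_range]
      rw [← hlt, Equiv.apply_symm_apply]
    simpa using congrArg Finset.card e
  subst hnm
  have hlt' : ∀ i, τ.symm i < n ↔ i < n := fun i => by rw [← hlt, Equiv.apply_symm_apply]
  let σ : Equiv.Perm (Fin n) :=
    { toFun := fun i => ⟨τ i, (hlt i).2 i.2⟩
      invFun := fun i => ⟨τ.symm i, (hlt' i).2 i.2⟩
      left_inv := fun i => by simp
      right_inv := fun i => by simp }
  refine Quotient.sound ⟨σ, ?_⟩
  have hM' : M' = M.mapReg (permNat σ) := by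
    rw [← hM]
    exact M.mapReg_congr fun i hi => by simp [permNat, (hp i).1 hi, σ]
  have hQ' : Q' = fun b => Q (b ∘ σ) := by
    funext c
    rw [← embVec_padBits Q', ← hQ, Mem.perm, embVec, if_pos]
    · congr 1
      funext i
      exact padBits_apply c (σ i)
    · exact fun i hi => padBits_of_le c (not_lt.1 fun h' => by have := (hlt i).1 h'; omega)
  simp only [Config.reindex, ← hM', ← hQ']

/-- The raw program chosen in `prog` is immaterial, since any two candidates differ by a
permutation. -/
theorem prog_eq {x : NProg G} {p : RawProgram G} {τ : Equiv.Perm ℕ} (h : x.perm τ = emb p) :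
    prog x = Program.mk p := by
  obtain ⟨σ, hσ⟩ := (exists_prog x).choose_spec
  refine mk_eq_of_perm (τ := τ * σ⁻¹) ?_
  rw [← hσ, NProg.perm_perm, inv_mul_cancel_right, h]

theorem prog_emb (p : RawProgram G) : prog (emb p) = Program.mk p := prog_eq (NProg.perm_one _)

theorem prog_perm (x : NProg G) (τ : Equiv.Perm ℕ) : prog (x.perm τ) = prog x := by
  obtain ⟨p, σ, h⟩ := exists_prog x
  rw [prog_eq h]
  refine prog_eq (τ := σ * τ⁻¹) ?_
  rw [NProg.perm_perm, inv_mul_cancel_right, h]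

/-- The extension of a permutation of `{0, …, n-1}`. -/
def permExt {n : ℕ} (σ : Equiv.Perm (Fin n)) : Equiv.Perm ℕ where
  toFun := permNat σ
  invFun := permNat σ⁻¹
  left_inv i := by rw [permNat_mul, inv_mul_cancel, permNat_one]
  right_inv i := by rw [permNat_mul, mul_inv_cancel, permNat_one]

theorem embVec_reindex {n : ℕ} (Q : Vec n) (σ : Equiv.Perm (Fin n)) :
    embVec (fun b => Q (b ∘ σ)) = (embVec Q).perm (permExt σ) := by
  funext b
  have h1 : ∀ i, n ≤ i → permExt σ i = i := fun i hi => by simp [permExt, permNat, hi]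
  have h2 : ∀ i : Fin n, permExt σ i = σ i := fun i => by simp [permExt, permNat]
  have h3 : (∀ i, n ≤ i → (b ∘ permExt σ) i = 0) ↔ ∀ i, n ≤ i → b i = 0 :=
    forall₂_congr fun i hi => by rw [Function.comp, h1 i hi]
  by_cases hb : ∀ i, n ≤ i → b i = 0
  · rw [embVec_of _ hb, Mem.perm, embVec_of _ (h3.2 hb)]
    simp only [Function.comp_def, h2]
  · rw [embVec_of_not _ hb, Mem.perm, embVec_of_not _ (h3.not.2 hb)]

theorem exists_perm_of_mk_eq {p q : RawProgram G} (h : Program.mk p = Program.mk q) :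
    ∃ τ, (emb p).perm τ = emb q := by
  obtain ⟨σ, hσ⟩ := Quotient.exact h
  obtain ⟨c, hs, hv, hr⟩ := q
  simp only at hσ
  subst hσ
  exact ⟨permExt σ, NProg.ext (embVec_reindex p.config.vec σ).symm rfl⟩

theorem prog_eq_prog {x y : NProg G} (h : prog x = prog y) : ∃ τ, x.perm τ = y := by
  obtain ⟨p, σ, hp⟩ := exists_prog x
  obtain ⟨q, σ', hq⟩ := exists_prog y
  rw [prog_eq hp, prog_eq hq] at h
  obtain ⟨τ, hτ⟩ := exists_perm_of_mk_eq h
  refine ⟨σ'⁻¹ * τ * σ, ?_⟩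
  rw [← NProg.perm_perm, ← NProg.perm_perm, hp, hτ, ← hq, NProg.perm_perm, inv_mul_cancel,
    NProg.perm_one]

theorem prog_surjective (P : Program G) : ∃ x, prog x = P := by
  obtain ⟨p, rfl⟩ := Quotient.exists_rep P
  exact ⟨emb p, prog_emb p⟩

end

end QLambda

namespace QLambda

section

variable {G : GateSet.{u}}

/-! ### Steps of programs with named registers -/

/-- `Out φ A μ`: `μ` is the part of the result of a quantum step that belongs to an outcome with
unnormalized memory `φ` and term `A`. -/
inductive Out (φ : Mem) (A : Term G) : Multiset (ℝ × NProg G) → Prop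
  | zero (h : φ = 0) : Out φ A 0
  | pos (y : NProg G) (a : ℝ) (ha : 0 < a) (hφ : φ = (a : ℂ) • y.vec) (hA : y.term = A) :
      Out φ A {(a ^ 2, y)}

/-- Parallel β-steps. -/
inductive NBeta (x : NProg G) : Multiset (ℝ × NProg G) → Prop
  | mk (y : NProg G) (h : Term.Par x.term y.term) (hv : y.vec = x.vec) : NBeta x {(1, y)}

/-- Quantum steps. -/
inductive NQuant (x : NProg G) : Multiset (ℝ × NProg G) → Prop
  | mk (ℓ : Lab G) (A B : Term G) (μ ν : Multiset (ℝ × NProg G)) (h : Term.QT ℓ x.term A B)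
      (hf : ℓ.Fresh x.term) (h0 : Out (ℓ.op 0 x.vec) A μ) (h1 : Out (ℓ.op 1 x.vec) B ν) :
      NQuant x (μ + ν)

/-- The second components of a weighted multiset are mapped. -/
def mapSnd {α β : Type u} (f : α → β) (μ : Multiset (ℝ × α)) : Multiset (ℝ × β) :=
  μ.map fun x => (x.1, f x.2)

theorem mapSnd_add {α β : Type u} (f : α → β) (μ ν : Multiset (ℝ × α)) :
    mapSnd f (μ + ν) = mapSnd f μ + mapSnd f ν := Multiset.map_add _ _ _

theorem mapSnd_singleton {α β : Type u} (f : α → β) (q : ℝ) (a : α) :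
    mapSnd f {(q, a)} = {(q, f a)} := Multiset.map_singleton _ _

theorem mapSnd_mapSnd {α β γ : Type u} (g : β → γ) (f : α → β) (μ : Multiset (ℝ × α)) :
    mapSnd g (mapSnd f μ) = mapSnd (fun a => g (f a)) μ := Multiset.map_map _ _ _

theorem mapSnd_prog_perm (μ : Multiset (ℝ × NProg G)) (τ : Equiv.Perm ℕ) :
    mapSnd prog (mapSnd (fun y => y.perm τ) μ) = mapSnd prog μ := by
  rw [mapSnd_mapSnd]
  simp only [prog_perm]

theorem Out.perm {φ : Mem} {A : Term G} {μ : Multiset (ℝ × NProg G)} (h : Out φ A μ)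
    (τ : Equiv.Perm ℕ) : Out (φ.perm τ) (A.mapReg τ) (mapSnd (fun y => y.perm τ) μ) := by
  cases h with
  | zero h =>
    subst h
    exact .zero rfl
  | pos y a ha hφ hA =>
    rw [mapSnd_singleton]
    subst hφ hA
    exact .pos _ a ha rfl rfl

theorem Out.exists {φ : Mem} {A : Term G} (hA : A.Valid) (hs : φ.SuppIn A) (hn : φ.nrm ≠ ⊤) :
    ∃ μ, Out φ A μ := by
  by_cases h0 : φ.nrm = 0
  · exact ⟨0, .zero (Mem.eq_zero_of_nrm h0)⟩
  have hpos : 0 < φ.nrm.toReal := ENNReal.toReal_pos h0 hn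
  have ha : 0 < √φ.nrm.toReal := Real.sqrt_pos.2 hpos
  refine ⟨_, .pos ⟨((√φ.nrm.toReal)⁻¹ : ℝ) • φ, A, hA, fun b hb => hs b fun h => hb (by simp [h]),
    ?_⟩ _ ha ?_ rfl⟩
  · have := Mem.nrm_smul φ (√φ.nrm.toReal)⁻¹
    rw [inv_pow, Real.sq_sqrt hpos.le, ENNReal.ofReal_inv_of_pos hpos, ENNReal.ofReal_toReal hn,
      ENNReal.inv_mul_cancel h0 hn] at this
    exact this
  · funext b
    have : ((√φ.nrm.toReal : ℝ) : ℂ) ≠ 0 := Complex.ofReal_ne_zero.2 ha.ne'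
    simp [this]

/-- The Born rule: `y` is normalized, so the weight `a ^ 2` is the squared norm of `φ`. -/
theorem Out.sum_weights {φ : Mem} {A : Term G} {μ : Multiset (ℝ × NProg G)} (h : Out φ A μ) :
    (∀ x ∈ μ, 0 < x.1) ∧ 0 ≤ (μ.map Prod.fst).sum ∧
      ENNReal.ofReal (μ.map Prod.fst).sum = φ.nrm := by
  cases h with
  | zero h => simp [h, Mem.nrm_zero]
  | pos y a ha hφ hA =>
    subst hφ
    rw [Mem.nrm_smul, y.norm]
    simp only [Multiset.mem_singleton, forall_eq, Multiset.map_singleton,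
      Multiset.sum_singleton, mul_one, and_true]
    exact ⟨pow_pos ha 2, sq_nonneg a⟩

theorem NBeta.perm {x : NProg G} {μ : Multiset (ℝ × NProg G)} (h : NBeta x μ)
    (τ : Equiv.Perm ℕ) : NBeta (x.perm τ) (mapSnd (fun y => y.perm τ) μ) := by
  obtain ⟨y, h, hv⟩ := h
  rw [mapSnd_singleton]
  exact .mk _ (h.mapReg τ) (by simp only [NProg.perm, hv])

theorem Lab.Fresh.perm {ℓ : Lab G} {M : Term G} (h : ℓ.Fresh M) (τ : Equiv.Perm ℕ) :
    (ℓ.map τ).Fresh (M.mapReg τ) := by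
  intro i hi
  cases ℓ with
  | new j =>
    cases hi
    rw [Term.regOcc_mapReg M τ.injective]
    exact h j rfl
  | _ => cases hi

theorem NQuant.perm {x : NProg G} {μ : Multiset (ℝ × NProg G)} (h : NQuant x μ)
    (τ : Equiv.Perm ℕ) : NQuant (x.perm τ) (mapSnd (fun y => y.perm τ) μ) := by
  obtain ⟨ℓ, A, B, μ, ν, h, hf, h0, h1⟩ := h
  rw [mapSnd_add]
  refine .mk (ℓ.map τ) _ _ _ _ (h.mapReg τ) (hf.perm τ) ?_ ?_
  · rw [NProg.perm, Lab.op_perm]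
    exact h0.perm τ
  · rw [NProg.perm, Lab.op_perm]
    exact h1.perm τ

theorem NQuant.weights {x : NProg G} {μ : Multiset (ℝ × NProg G)} (h : NQuant x μ) :
    (∀ y ∈ μ, 0 < y.1) ∧ (μ.map Prod.fst).sum = 1 := by
  obtain ⟨ℓ, A, B, μ, ν, h, hf, h0, h1⟩ := h
  obtain ⟨a1, a2, a3⟩ := h0.sum_weights
  obtain ⟨b1, b2, b3⟩ := h1.sum_weights
  refine ⟨fun y hy => ?_, ?_⟩
  · rcases Multiset.mem_add.1 hy with hy | hy
    · exact a1 y hy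
    · exact b1 y hy
  · rw [Multiset.map_add, Multiset.sum_add, ← ENNReal.ofReal_eq_one, ENNReal.ofReal_add a2 b2,
      a3, b3, ℓ.nrm_op (fun k => (h.uses_le k).trans (x.valid.1 k).1), x.norm]

/-! ### From steps of programs to steps with named registers -/

theorem Term.Beta.fill {M N : Term G} (h : Term.Beta M N) (C : Ctx G) :
    Term.Beta (C.fill M) (C.fill N) := by
  induction C <;> first | exact h | (constructor; assumption)

theorem Term.QT.fill {ℓ : Lab G} {M A B : Term G} (h : Term.QT ℓ M A B) {S : Ctx G}
    (hS : S.IsSurface) : Term.QT ℓ (S.fill M) (S.fill A) (S.fill B) := by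
  induction S <;> first | exact h | exact hS.elim | (constructor; simp_all [Ctx.IsSurface])

theorem BetaRoot.beta {n : ℕ} {Q : Vec n} {M N : Term G}
    (h : BetaRoot ⟨n, Q, M⟩ {(1, ⟨n, Q, N⟩)}) : Term.Beta M N := by
  generalize hμ : ({(1, ⟨n, Q, N⟩)} : Multiset (ℝ × Config G)) = μ at h
  cases h with
  | b Q M N' =>
    simp only [Multiset.singleton_inj, Prod.mk.injEq, Config.mk.injEq, true_and, heq_eq_eq] at hμ
    rw [hμ]
    exact .b _ _
  | bangb Q M N' =>
    simp only [Multiset.singleton_inj, Prod.mk.injEq, Config.mk.injEq, true_and, heq_eq_eq] at hμ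
    rw [hμ]
    exact .bangb _ _

theorem nbeta_of_betaCtx {p : RawProgram G} {μ : Multiset (ℝ × RawProgram G)}
    (h : BetaCtx p.config (mapSnd RawProgram.config μ)) : NBeta (emb p) (mapSnd emb μ) := by
  generalize hc : p.config = c at h
  generalize hν : mapSnd RawProgram.config μ = ν at h
  obtain ⟨Q, M, M', C, h⟩ := h
  obtain ⟨⟨w, q⟩, rfl, hq⟩ := Multiset.map_eq_singleton.1 hν
  simp only [Prod.mk.injEq] at hq
  obtain ⟨rfl, hq⟩ := hq
  rw [mapSnd_singleton]
  refine .mk _ ?_ ?_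
  · simp only [emb, hq, hc]
    exact (h.beta.fill C).par
  · change q.config.mem = p.config.mem
    rw [hq, hc]
    rfl

/-- `Out` for pairs of a vector and a term. -/
inductive COut (φ : Mem) (A : Term G) : Multiset (ℝ × Config G) → Prop
  | zero (h : φ = 0) : COut φ A 0
  | pos (c : Config G) (a : ℝ) (ha : 0 < a) (hφ : φ = (a : ℂ) • c.mem) (hA : c.term = A) :
      COut φ A {(a ^ 2, c)}

theorem COut.filter {n : ℕ} {Q : Vec n} {φ : Mem} {a : ℝ} (ha : 0 ≤ a) (A : Term G)
    (hφ : φ = (a : ℂ) • embVec Q) :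
    COut φ A (({(a ^ 2, ⟨n, Q, A⟩)} : Multiset (ℝ × Config G)).filter fun x => 0 < x.1) := by
  rcases ha.eq_or_lt with rfl | ha
  · rw [Multiset.filter_singleton, if_neg (by simp)]
    exact .zero (by simpa using hφ)
  · rw [Multiset.filter_singleton, if_pos (pow_pos ha 2)]
    exact .pos ⟨n, Q, A⟩ a ha hφ rfl

theorem COut.one {c : Config G} {φ : Mem} {A : Term G} (hφ : φ = c.mem) (hA : c.term = A) :
    COut φ A {(1, c)} := by
  simpa using COut.pos c 1 one_pos (by simpa using hφ) hA

theorem act_zero_matrix {C : Type} [Fintype C] (get : (ℕ → Fin 2) → C)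
    (put : (ℕ → Fin 2) → C → (ℕ → Fin 2)) (ψ : Mem) : Mem.act get put 0 ψ = 0 := by
  funext b
  simp [Mem.act]

theorem QRoot.exists_qt {n : ℕ} {Q : Vec n} {M : Term G} {μ : Multiset (ℝ × Config G)}
    (h : QRoot ⟨n, Q, M⟩ μ) :
    ∃ (ℓ : Lab G) (A B : Term G) (μ₀ μ₁ : Multiset (ℝ × Config G)), Term.QT ℓ M A B ∧
      (∀ i, ℓ = .new i → i = n) ∧ COut (ℓ.op 0 (embVec Q)) A μ₀ ∧
      COut (ℓ.op 1 (embVec Q)) B μ₁ ∧ μ = μ₀ + μ₁ := by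
  cases h with
  | n Q =>
    refine ⟨.new n, _, _, _, 0, .new n, fun i hi => by cases hi; rfl,
      COut.one ?_ rfl, .zero ?_, (add_zero _).symm⟩
    · exact (embVec_tensorKet_zero Q).symm
    · simp [Lab.op]
  | @m n Q a₀ a₁ Q₀ Q₁ M N ha₀ ha₁ hQ₀ hQ₁ hQ =>
    -- The two components of the vector decomposition are the two values of the measurement
    -- operator.
    have key := (eq_tensorKet_iff Q ![(a₀ : ℂ), a₁] ![Q₀, Q₁]).1 hQ
    refine ⟨.meas n, M, N, _, _, .meas n M N, fun i hi => (by cases hi),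
      COut.filter ha₀ M (key 0), COut.filter ha₁ N (key 1), ?_⟩
    rw [← Multiset.filter_add]
    rfl
  | u₁ Q A =>
    refine ⟨.u1 A 0, _, _, _, 0, .u1 A 0, fun i hi => (by cases hi),
      COut.one ?_ rfl, .zero ?_, (add_zero _).symm⟩
    · simp only [Lab.op, Config.mem, embVec_apply1, if_true]
    · exact act_zero_matrix _ _ _
  | u₂ Q A =>
    refine ⟨.u2 A 0 1, _, _, _, 0, .u2 A 0 1, fun i hi => (by cases hi),
      COut.one ?_ rfl, .zero ?_, (add_zero _).symm⟩
    · simp only [Lab.op, Config.mem, embVec_apply2, if_true]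
    · exact act_zero_matrix _ _ _

theorem map_eq_add {α β : Type*} {f : α → β} {s : Multiset α} {t u : Multiset β}
    (h : s.map f = t + u) : ∃ s₁ s₂, s = s₁ + s₂ ∧ s₁.map f = t ∧ s₂.map f = u := by
  classical
  induction t using Multiset.induction generalizing s with
  | empty => exact ⟨0, s, by simp, rfl, by simpa using h⟩
  | cons b t ih =>
    rw [Multiset.cons_add, ← Multiset.map_eq_cons] at h
    obtain ⟨a, ha, rfl, h⟩ := h
    obtain ⟨s₁, s₂, h1, rfl, rfl⟩ := ih h
    exact ⟨a ::ₘ s₁, s₂, by rw [Multiset.cons_add, ← h1, Multiset.cons_erase ha], by simp, rfl⟩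

theorem COut.out {φ : Mem} {A : Term G} {μ : Multiset (ℝ × Config G)} (h : COut φ A μ)
    (S : Ctx G) {ν : Multiset (ℝ × RawProgram G)}
    (hν : mapSnd RawProgram.config ν =
      μ.map fun x => (x.1, ⟨x.2.size, x.2.vec, S.fill x.2.term⟩)) :
    Out φ (S.fill A) (mapSnd emb ν) := by
  cases h with
  | zero h =>
    rw [Multiset.map_zero, mapSnd, Multiset.map_eq_zero] at hν
    subst hν
    exact .zero h
  | pos c a ha hφ hA =>
    rw [Multiset.map_singleton] at hν
    obtain ⟨⟨w, q⟩, rfl, hq⟩ := Multiset.map_eq_singleton.1 hν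
    simp only [Prod.mk.injEq] at hq
    obtain ⟨rfl, hq⟩ := hq
    rw [mapSnd_singleton]
    refine .pos _ a ha ?_ ?_
    · change φ = (a : ℂ) • q.config.mem
      rw [hq, hφ]
      rfl
    · simp only [emb, hq, hA]

theorem nquant_of_qCtx {p : RawProgram G} {μ : Multiset (ℝ × RawProgram G)}
    (h : QCtx p.config (mapSnd RawProgram.config μ)) : NQuant (emb p) (mapSnd emb μ) := by
  generalize hc : p.config = c at h
  generalize hν : mapSnd RawProgram.config μ = ν at h
  obtain ⟨Q, M, S, hS, μ', h⟩ := h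
  obtain ⟨ℓ, A, B, μ₀, μ₁, hqt, hnew, h0, h1, rfl⟩ := h.exists_qt
  rw [Multiset.map_add] at hν
  obtain ⟨ν₀, ν₁, rfl, hν₀, hν₁⟩ := map_eq_add hν
  rw [mapSnd_add]
  have hvec : (emb p).vec = embVec Q := by
    change p.config.mem = embVec Q
    rw [hc]
    rfl
  have hterm : (emb p).term = S.fill M := by simp only [emb, hc]
  refine .mk ℓ (S.fill A) (S.fill B) _ _ ?_ ?_ ?_ ?_
  · rw [hterm]
    exact hqt.fill hS
  -- The name allocated by rule `(n)` is the number of qubits, which is fresh since the registers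
  -- are those below it.
  · intro i hi
    have h1 := p.regOcc_pos i
    have h2 : (emb p).term = p.config.term := rfl
    rw [hnew i hi] at h1 ⊢
    rw [hc] at h1 h2
    rw [h2]
    simpa using h1
  · rw [hvec]
    exact h0.out S hν₀
  · rw [hvec]
    exact h1.out S hν₁

/-- Steps of programs with named registers. -/
def NStep (x : NProg G) (μ : Multiset (ℝ × NProg G)) : Prop := NBeta x μ ∨ NQuant x μ

theorem NStep.perm {x : NProg G} {μ : Multiset (ℝ × NProg G)} (h : NStep x μ)
    (τ : Equiv.Perm ℕ) : NStep (x.perm τ) (mapSnd (fun y => y.perm τ) μ) :=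
  h.imp (·.perm τ) (·.perm τ)

theorem Step.exists_nstep {x : NProg G} {m : MDist (Program G)} (h : Step (prog x) m) :
    ∃ μ, NStep x μ ∧ m.val = mapSnd prog μ := by
  suffices key : ∃ (p : RawProgram G) (μ : Multiset (ℝ × RawProgram G)),
      Program.mk p = prog x ∧ NStep (emb p) (mapSnd emb μ) ∧ m.val = mapSnd Program.mk μ by
    obtain ⟨p, μ, hp, hs, hm⟩ := key
    rw [← prog_emb] at hp
    -- The representative used by the rule differs from `x` by a permutation, along which the step
    -- is transported.
    obtain ⟨τ, rfl⟩ := prog_eq_prog hp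
    refine ⟨_, hs.perm τ, ?_⟩
    rw [mapSnd_prog_perm, mapSnd_mapSnd, hm]
    simp only [prog_emb]
  rcases h with ⟨p, μ, hp, h, hm⟩ | ⟨p, μ, hp, h, hm⟩
  · exact ⟨p, μ, hp, .inl (nbeta_of_betaCtx h), hm⟩
  · exact ⟨p, μ, hp, .inr (nquant_of_qCtx h), hm⟩

/-! ### From steps with named registers to steps of programs -/

theorem Term.Beta.mapReg {M N : Term G} (h : Term.Beta M N) (g : ℕ → ℕ) :
    Term.Beta (M.mapReg g) (N.mapReg g) := by
  induction h with
  | b M N =>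
    rw [Term.mapReg_inst]
    exact .b _ _
  | bangb M N =>
    rw [Term.mapReg_inst]
    exact .bangb _ _
  | _ => constructor; assumption

theorem Term.Beta.exists_ctx {M N : Term G} (h : Term.Beta M N) :
    ∃ (C : Ctx G) (R R' : Term G), M = C.fill R ∧ N = C.fill R' ∧
      ∀ (n : ℕ) (Q : Vec n), BetaRoot ⟨n, Q, R⟩ {(1, ⟨n, Q, R'⟩)} := by
  induction h with
  | b M N => exact ⟨.hole, _, _, rfl, rfl, fun n Q => .b Q M N⟩
  | bangb M N => exact ⟨.hole, _, _, rfl, rfl, fun n Q => .bangb Q M N⟩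
  | appL N _ ih =>
    obtain ⟨C, R, R', rfl, rfl, h⟩ := ih
    exact ⟨.appL C N, R, R', rfl, rfl, h⟩
  | appR M _ ih =>
    obtain ⟨C, R, R', rfl, rfl, h⟩ := ih
    exact ⟨.appR M C, R, R', rfl, rfl, h⟩
  | lam _ ih =>
    obtain ⟨C, R, R', rfl, rfl, h⟩ := ih
    exact ⟨.lam C, R, R', rfl, rfl, h⟩
  | blam _ ih =>
    obtain ⟨C, R, R', rfl, rfl, h⟩ := ih
    exact ⟨.blam C, R, R', rfl, rfl, h⟩
  | bang _ ih =>
    obtain ⟨C, R, R', rfl, rfl, h⟩ := ih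
    exact ⟨.bang C, R, R', rfl, rfl, h⟩
  | measP M N _ ih =>
    obtain ⟨C, R, R', rfl, rfl, h⟩ := ih
    exact ⟨.measP C M N, R, R', rfl, rfl, h⟩
  | measL P N _ ih =>
    obtain ⟨C, R, R', rfl, rfl, h⟩ := ih
    exact ⟨.measL P C N, R, R', rfl, rfl, h⟩
  | measR P M _ ih =>
    obtain ⟨C, R, R', rfl, rfl, h⟩ := ih
    exact ⟨.measR P M C, R, R', rfl, rfl, h⟩

theorem step_of_beta {x y : NProg G} (h : Term.Beta x.term y.term) (hv : y.vec = x.vec) :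
    Step (prog x) (MDist.pure (prog y)) := by
  obtain ⟨n, τ, hn⟩ := x.exists_perm
  have hn' : ∀ i, 0 < (y.perm τ).term.regOcc i ↔ i < n := fun i => by
    rw [← hn]
    simp only [NProg.perm, Term.regOcc_mapReg_perm, (h.valid x.valid).2]
  obtain ⟨Q, hs, hr, hQ, he⟩ := exists_emb _ hn
  obtain ⟨Q', hs', hr', hQ', he'⟩ := exists_emb _ hn'
  -- β keeps the registers, so one renaming and one number of qubits serve both sides, and equal
  -- memories give equal vectors.
  have hQQ : Q' = Q := embVec_injective (by rw [hQ, hQ']; simp only [NProg.perm, hv])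
  subst hQQ
  obtain ⟨C, R, R', h1, h2, hroot⟩ := (h.mapReg τ).exists_ctx
  refine .inl ⟨_, {(1, ⟨⟨n, Q', (y.perm τ).term⟩, hs', (y.perm τ).valid, hr'⟩)},
    (prog_eq he.symm).symm, ?_, ?_⟩
  · have e1 : (x.perm τ).term = C.fill R := h1
    have e2 : (y.perm τ).term = C.fill R' := h2
    simp only [Multiset.map_singleton, e1, e2]
    exact .mk Q' R R' C (hroot n Q')
  · simp only [Multiset.map_singleton, prog_eq he'.symm]
    rfl

/-- The root shapes of quantum redexes. -/
inductive Lab.Redex : Lab G → Term G → Term G → Term G → Prop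
  | new (i : ℕ) : Redex (.new i) .new (.reg i) (.reg i)
  | meas (i : ℕ) (M N : Term G) : Redex (.meas i) (.meas (.reg i) M N) M N
  | u1 (A : G.Gate1) (i : ℕ) : Redex (.u1 A i) (.app (.gate1 A) (.reg i)) (.reg i) (.reg i)
  | u2 (A : G.Gate2) (i j : ℕ) :
      Redex (.u2 A i j) (.app (.gate2 A) (.pair (.reg i) (.reg j)))
        (.pair (.reg i) (.reg j)) (.pair (.reg i) (.reg j))

theorem Term.QT.exists_ctx {ℓ : Lab G} {M A B : Term G} (h : Term.QT ℓ M A B) :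
    ∃ (S : Ctx G) (R RA RB : Term G), S.IsSurface ∧ M = S.fill R ∧ A = S.fill RA ∧
      B = S.fill RB ∧ ℓ.Redex R RA RB := by
  induction h with
  | new i => exact ⟨.hole, _, _, _, trivial, rfl, rfl, rfl, .new i⟩
  | meas i M N => exact ⟨.hole, _, _, _, trivial, rfl, rfl, rfl, .meas i M N⟩
  | u1 A i => exact ⟨.hole, _, _, _, trivial, rfl, rfl, rfl, .u1 A i⟩
  | u2 A i j => exact ⟨.hole, _, _, _, trivial, rfl, rfl, rfl, .u2 A i j⟩
  | appL N _ ih =>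
    obtain ⟨S, R, RA, RB, hS, rfl, rfl, rfl, h⟩ := ih
    exact ⟨.appL S N, R, RA, RB, hS, rfl, rfl, rfl, h⟩
  | appR M _ ih =>
    obtain ⟨S, R, RA, RB, hS, rfl, rfl, rfl, h⟩ := ih
    exact ⟨.appR M S, R, RA, RB, hS, rfl, rfl, rfl, h⟩
  | lam _ ih =>
    obtain ⟨S, R, RA, RB, hS, rfl, rfl, rfl, h⟩ := ih
    exact ⟨.lam S, R, RA, RB, hS, rfl, rfl, rfl, h⟩
  | blam _ ih =>
    obtain ⟨S, R, RA, RB, hS, rfl, rfl, rfl, h⟩ := ih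
    exact ⟨.blam S, R, RA, RB, hS, rfl, rfl, rfl, h⟩
  | measP M N _ ih =>
    obtain ⟨S, R, RA, RB, hS, rfl, rfl, rfl, h⟩ := ih
    exact ⟨.measP S M N, R, RA, RB, hS, rfl, rfl, rfl, h⟩

/-- The operation acts on the registers prescribed by the root rules, for `n` qubits. -/
def Lab.Std : Lab G → ℕ → Prop
  | .new i, n => i = n
  | .meas i, n => n = i + 1
  | .u1 _ i, n => i = 0 ∧ 0 < n
  | .u2 _ i j, n => i = 0 ∧ j = 1 ∧ 1 < n

/-- Rule `(m)` asks for two normalized vectors even if one has amplitude `0`; any state then serves.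
-/
theorem exists_isState (n : ℕ) : ∃ Q : Vec n, IsState Q := by
  refine ⟨fun b => if b = 0 then 1 else 0, ?_⟩
  rw [IsState, Finset.sum_eq_single 0]
  · simp
  · intro b _ hb
    simp [hb]
  · simp

theorem Out.exists_raw {φ : Mem} {A : Term G} {μ : Multiset (ℝ × NProg G)} (h : Out φ A μ)
    {n : ℕ} (hn : ∀ i, 0 < A.regOcc i ↔ i < n) :
    ∃ (a : ℝ) (Q : Vec n) (ν : Multiset (ℝ × RawProgram G)), 0 ≤ a ∧ IsState Q ∧
      φ = (a : ℂ) • embVec Q ∧ mapSnd Program.mk ν = mapSnd prog μ ∧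
      mapSnd RawProgram.config ν =
        ({(a ^ 2, ⟨n, Q, A⟩)} : Multiset (ℝ × Config G)).filter fun x => 0 < x.1 := by
  cases h with
  | zero h =>
    obtain ⟨Q, hQ⟩ := exists_isState n
    refine ⟨0, Q, 0, le_rfl, hQ, by simpa using h, rfl, ?_⟩
    rw [Multiset.filter_singleton, if_neg (by simp)]
    rfl
  | pos y a ha hφ hA =>
    subst hA
    obtain ⟨Q, hs, hr, hQ, he⟩ := exists_emb y hn
    refine ⟨a, Q, {(a ^ 2, ⟨⟨n, Q, y.term⟩, hs, y.valid, hr⟩)}, ha.le, hs, by rw [hφ, hQ], ?_, ?_⟩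
    · rw [mapSnd_singleton, mapSnd_singleton, ← prog_emb, he]
    · rw [mapSnd_singleton, Multiset.filter_singleton, if_pos (pow_pos ha 2)]

theorem eq_one_of_nrm {ψ : Mem} {n : ℕ} {Q : Vec n} {a : ℝ} (ha : 0 ≤ a) (hQ : IsState Q)
    (hψ : ψ.nrm = 1) (h : ψ = (a : ℂ) • embVec Q) : a = 1 := by
  rw [h, Mem.nrm_smul, (isState_iff Q).1 hQ, mul_one, ENNReal.ofReal_eq_one] at hψ
  nlinarith

theorem Out.exists_raw_of_nrm {φ : Mem} {A : Term G} {μ : Multiset (ℝ × NProg G)}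
    (h : Out φ A μ) {n : ℕ} (hn : ∀ i, 0 < A.regOcc i ↔ i < n) {Q : Vec n}
    (hφ : φ = embVec Q) (hφ1 : φ.nrm = 1) :
    ∃ (ν : Multiset (ℝ × RawProgram G)), mapSnd Program.mk ν = mapSnd prog μ ∧
      mapSnd RawProgram.config ν = {(1, ⟨n, Q, A⟩)} := by
  obtain ⟨a, Q', ν, ha, hQ', hφ', hν, hν'⟩ := h.exists_raw hn
  obtain rfl := eq_one_of_nrm ha hQ' hφ1 hφ'
  have : Q = Q' := embVec_injective (by rw [← hφ, hφ']; simp)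
  subst this
  refine ⟨ν, hν, ?_⟩
  rw [hν', Multiset.filter_singleton, if_pos (by simp), one_pow]

theorem Out.eq_zero {A : Term G} {μ : Multiset (ℝ × NProg G)} (h : Out 0 A μ) : μ = 0 := by
  cases h with
  | zero => rfl
  | pos y a ha hφ hA =>
    have := congrArg Mem.nrm hφ
    rw [Mem.nrm_zero, Mem.nrm_smul, y.norm, mul_one, eq_comm, ENNReal.ofReal_eq_zero] at this
    exact absurd this (not_le.2 (pow_pos ha 2))

theorem step_of_std {x : NProg G} {n : ℕ} (hn : ∀ i, 0 < x.term.regOcc i ↔ i < n) {ℓ : Lab G}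
    {A B : Term G} {μ ν : Multiset (ℝ × NProg G)} (h : Term.QT ℓ x.term A B)
    (h0 : Out (ℓ.op 0 x.vec) A μ) (h1 : Out (ℓ.op 1 x.vec) B ν) (hstd : ℓ.Std n)
    {m : MDist (Program G)} (hm : m.val = mapSnd prog (μ + ν)) : Step (prog x) m := by
  obtain ⟨Q, hs, hr, hQ, he⟩ := exists_emb x hn
  have hreg := fun k => h.regOcc_eq (x.valid.1 k).2
  have hnrm := ℓ.nrm_op (fun k => (h.uses_le k).trans (x.valid.1 k).1) x.vec
  rw [x.norm] at hnrm
  obtain ⟨S, R, RA, RB, hS, hterm, rfl, rfl, hroot⟩ := h.exists_ctx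
  suffices key : ∃ κ : Multiset (ℝ × RawProgram G),
      QCtx ⟨n, Q, S.fill R⟩ (mapSnd RawProgram.config κ) ∧
        mapSnd Program.mk κ = mapSnd prog (μ + ν) by
    obtain ⟨κ, hκ, hκ'⟩ := key
    refine .inr ⟨_, κ, (prog_eq ((NProg.perm_one x).trans he.symm)).symm, ?_, hm.trans hκ'.symm⟩
    change QCtx ⟨n, Q, x.term⟩ _
    rw [hterm]
    exact hκ
  cases hroot with
  | new i =>
    obtain rfl : i = n := hstd
    simp only [Lab.adds, Lab.dels] at hreg
    -- The second outcome vanishes and contributes nothing; the first then carries the whole norm,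
    -- so its weight is `1`.
    have hz : (Lab.new i : Lab G).op 1 x.vec = 0 := by simp [Lab.op]
    rw [hz] at h1 hnrm
    rw [Mem.nrm_zero, add_zero] at hnrm
    obtain rfl := h1.eq_zero
    obtain ⟨κ, hκ, hκ'⟩ := h0.exists_raw_of_nrm (n := i + 1) (Q := tensorKet Q 0) (fun k => by
      have := hn k
      have := hreg k
      split_ifs at this <;> omega) (by rw [embVec_tensorKet_zero, hQ]; rfl) hnrm
    refine ⟨κ, ?_, by rw [hκ, add_zero]⟩
    rw [hκ']
    simpa using QCtx.mk Q _ S hS _ (QRoot.n Q)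
  | u1 C i =>
    obtain ⟨rfl, hpos⟩ := hstd
    obtain ⟨n, rfl⟩ := Nat.exists_eq_succ_of_ne_zero hpos.ne'
    simp only [Lab.adds, Lab.dels] at hreg
    have hz : (Lab.u1 C 0 : Lab G).op 1 x.vec = 0 := act_zero_matrix _ _ _
    rw [hz] at h1 hnrm
    rw [Mem.nrm_zero, add_zero] at hnrm
    obtain rfl := h1.eq_zero
    obtain ⟨κ, hκ, hκ'⟩ := h0.exists_raw_of_nrm (n := n + 1) (Q := apply1 (G.mat1 C).1 Q)
      (fun k => by
        have := hn k
        have := hreg k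
        omega) (by rw [embVec_apply1, hQ]; rfl) hnrm
    refine ⟨κ, ?_, by rw [hκ, add_zero]⟩
    rw [hκ']
    simpa using QCtx.mk Q _ S hS _ (QRoot.u₁ Q C)
  | u2 C i j =>
    obtain ⟨rfl, rfl, hlt⟩ := hstd
    obtain ⟨n, rfl⟩ : ∃ k, n = k + 2 := ⟨n - 2, by omega⟩
    simp only [Lab.adds, Lab.dels] at hreg
    have hz : (Lab.u2 C 0 1 : Lab G).op 1 x.vec = 0 := act_zero_matrix _ _ _
    rw [hz] at h1 hnrm
    rw [Mem.nrm_zero, add_zero] at hnrm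
    obtain rfl := h1.eq_zero
    obtain ⟨κ, hκ, hκ'⟩ := h0.exists_raw_of_nrm (n := n + 2) (Q := apply2 (G.mat2 C).1 Q)
      (fun k => by
        have := hn k
        have := hreg k
        omega) (by rw [embVec_apply2, hQ]; rfl) hnrm
    refine ⟨κ, ?_, by rw [hκ, add_zero]⟩
    rw [hκ']
    simpa using QCtx.mk Q _ S hS _ (QRoot.u₂ Q C)
  | meas i =>
    obtain rfl : n = i + 1 := hstd
    simp only [Lab.adds, Lab.dels] at hreg
    have hu := fun k => h.uses_le k
    simp only [Lab.uses] at hu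
    have hval := x.valid.1
    obtain ⟨a₀, Q₀, κ₀, ha₀, hQ₀, hφ₀, hκ₀, hκ₀'⟩ := h0.exists_raw (n := i) fun k => by
      have := hn k
      have := hreg k
      have := hu k
      have := hval k
      split_ifs at * <;> omega
    obtain ⟨a₁, Q₁, κ₁, ha₁, hQ₁, hφ₁, hκ₁, hκ₁'⟩ := h1.exists_raw (n := i) fun k => by
      have := hn k
      have := hreg k
      have := hu k
      have := hval k
      split_ifs at * <;> omega
    have hQQ : Q = (a₀ : ℂ) • tensorKet Q₀ 0 + (a₁ : ℂ) • tensorKet Q₁ 1 :=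
      (eq_tensorKet_iff Q ![(a₀ : ℂ), a₁] ![Q₀, Q₁]).2 fun c => by
        rw [hQ]
        fin_cases c
        · exact hφ₀
        · exact hφ₁
    refine ⟨κ₀ + κ₁, ?_, by rw [mapSnd_add, mapSnd_add, hκ₀, hκ₁]⟩
    rw [mapSnd_add, hκ₀', hκ₁', ← Multiset.filter_add]
    have := QCtx.mk Q _ S hS _ (QRoot.m Q a₀ a₁ Q₀ Q₁ RA RB ha₀ ha₁ hQ₀ hQ₁ hQQ)
    convert this using 1
    rw [Multiset.insert_eq_cons, ← Multiset.singleton_add, Multiset.filter_add, Multiset.filter_add,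
      Multiset.map_add]
    simp only [Multiset.filter_singleton]
    split_ifs <;> rfl

theorem swap_lt_iff {n a b : ℕ} (h : a < n ↔ b < n) (k : ℕ) : Equiv.swap a b k < n ↔ k < n := by
  rw [Equiv.swap_apply_def]
  split_ifs <;> simp_all

/-- The convenient representative of the root rules: the registers become an initial segment, and a
swap inside it, or outside it for an allocation, moves the register acted on to its prescribed
place. -/
theorem exists_std {x : NProg G} {ℓ : Lab G} {A B : Term G} (h : Term.QT ℓ x.term A B)
    (hf : ℓ.Fresh x.term) :
    ∃ (n : ℕ) (τ : Equiv.Perm ℕ), (∀ i, 0 < (x.perm τ).term.regOcc i ↔ i < n) ∧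
      (ℓ.map τ).Std n := by
  suffices key : ∃ (n : ℕ) (τ : Equiv.Perm ℕ), (∀ i, 0 < x.term.regOcc i ↔ τ i < n) ∧
      (ℓ.map τ).Std n by
    obtain ⟨n, τ, h, hs⟩ := key
    refine ⟨n, τ, fun i => ?_, hs⟩
    have e : (x.perm τ).term.regOcc i = x.term.regOcc (τ.symm i) :=
      Term.regOcc_mapReg_perm _ _ _
    rw [e, h, Equiv.apply_symm_apply]
  obtain ⟨n, τ, hn⟩ := exists_perm_lt x.term.finite_regs
  have hn : ∀ i, 0 < x.term.regOcc i ↔ τ i < n := hn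
  -- Swapping two values on the same side of `n` keeps the registers an initial segment.
  have comp : ∀ (σ : Equiv.Perm ℕ) {a b : ℕ}, (∀ i, 0 < x.term.regOcc i ↔ σ i < n) →
      (a < n ↔ b < n) → ∀ i, 0 < x.term.regOcc i ↔ (σ.trans (Equiv.swap a b)) i < n :=
    fun σ a b hσ hab i => by rw [hσ, Equiv.trans_apply, swap_lt_iff hab]
  have hu := fun k => h.uses_le k
  cases ℓ with
  | new i =>
    have h1 := hf i rfl
    have h2 := hn i
    exact ⟨n, _, comp τ hn (a := τ i) (b := n) (by omega), by simp [Lab.map, Lab.Std]⟩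
  | meas i =>
    have h1 := hn i
    have h2 := hu i
    simp only [Lab.uses, if_true] at h2
    exact ⟨n, _, comp τ hn (a := τ i) (b := n - 1) (by omega), by
      simp only [Lab.map, Lab.Std, Equiv.coe_trans, Function.comp_apply, Equiv.swap_apply_left]
      omega⟩
  | u1 C i =>
    have h1 := hn i
    have h2 := hu i
    simp only [Lab.uses, if_true] at h2
    exact ⟨n, _, comp τ hn (a := τ i) (b := 0) (by omega), by
      simp only [Lab.map, Lab.Std, Equiv.coe_trans, Function.comp_apply, Equiv.swap_apply_left,
        true_and]
      omega⟩
  | u2 C i j =>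
    have hij : j ≠ i := by
      rintro rfl
      have := hu j
      have := (x.valid.1 j).1
      simp only [Lab.uses, if_true] at *
      omega
    have h1 := hu i
    have h2 := hu j
    simp only [Lab.uses, if_true] at h1 h2
    have h3 := comp τ hn (a := τ i) (b := 0) (by have := hn i; omega)
    generalize hσ : τ.trans (Equiv.swap (τ i) 0) = σ at h3
    have h4 : σ i = 0 := by simp [← hσ]
    have h5 : σ j ≠ 0 := fun h => hij (σ.injective (h.trans h4.symm))
    have h6 := (h3 j).1 (by omega)
    -- The second swap leaves the value `0` of the first register alone since `σ j ≠ 0`; for the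
    -- same reason `1 < n`.
    refine ⟨n, _, comp σ h3 (a := σ j) (b := 1) (by omega), ?_⟩
    simp only [Lab.map, Lab.Std, Equiv.trans_apply, Equiv.swap_apply_left, h4, true_and]
    exact ⟨Equiv.swap_apply_of_ne_of_ne h5.symm zero_ne_one, by omega⟩

theorem NQuant.step {x : NProg G} {μ : Multiset (ℝ × NProg G)} (h : NQuant x μ)
    {m : MDist (Program G)} (hm : m.val = mapSnd prog μ) : Step (prog x) m := by
  obtain ⟨ℓ, A, B, μ, ν, h, hf, h0, h1⟩ := h
  obtain ⟨n, τ, hn, hstd⟩ := exists_std h hf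
  rw [← prog_perm x τ]
  refine step_of_std hn (h.mapReg τ) (μ := mapSnd (fun y => y.perm τ) μ)
    (ν := mapSnd (fun y => y.perm τ) ν) ?_ ?_ hstd ?_
  · rw [NProg.perm, Lab.op_perm]
    exact h0.perm τ
  · rw [NProg.perm, Lab.op_perm]
    exact h1.perm τ
  · rw [hm, ← mapSnd_add, mapSnd_prog_perm]

end

end QLambda

namespace QLambda

/-! ### Lifting to weighted multisets -/

section Lift

variable {α β : Type u}

/-- Multiplication of the weights by `p`. -/
def scale (p : ℝ) (m : Multiset (ℝ × α)) : Multiset (ℝ × α) := m.map fun x => (p * x.1, x.2)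

theorem scale_add (p : ℝ) (m n : Multiset (ℝ × α)) :
    scale p (m + n) = scale p m + scale p n := Multiset.map_add _ _ _

theorem scale_singleton (p q : ℝ) (a : α) : scale p {(q, a)} = {(p * q, a)} :=
  Multiset.map_singleton _ _

theorem scale_cons (p q : ℝ) (a : α) (m : Multiset (ℝ × α)) :
    scale p ((q, a) ::ₘ m) = (p * q, a) ::ₘ scale p m := Multiset.map_cons _ _ _

theorem scale_scale (p q : ℝ) (m : Multiset (ℝ × α)) :
    scale p (scale q m) = scale (p * q) m := by
  simp [scale, Multiset.map_map, mul_assoc]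

theorem scale_one (m : Multiset (ℝ × α)) : scale 1 m = m := by simp [scale]

theorem mapSnd_scale (f : α → β) (p : ℝ) (m : Multiset (ℝ × α)) :
    mapSnd f (scale p m) = scale p (mapSnd f m) := by
  simp [scale, mapSnd, Multiset.map_map]

theorem sum_scale (p : ℝ) (m : Multiset (ℝ × α)) :
    ((scale p m).map Prod.fst).sum = p * (m.map Prod.fst).sum := by
  simp [scale, Multiset.map_map, Multiset.sum_map_mul_left]

/-- Every element of a weighted multiset is kept or makes one step. -/
def Lift (T : α → Multiset (ℝ × α) → Prop) (s t : Multiset (ℝ × α)) : Prop :=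
  ∃ u, Multiset.Rel (fun x y => ∃ m, (m = {(1, x.2)} ∨ T x.2 m) ∧ y = scale x.1 m) s u ∧ t = u.sum

variable {T : α → Multiset (ℝ × α) → Prop}

theorem Lift.zero : Lift T 0 0 := ⟨0, .zero, rfl⟩

theorem Lift.add {s t s' t' : Multiset (ℝ × α)} (h : Lift T s t) (h' : Lift T s' t') :
    Lift T (s + s') (t + t') := by
  obtain ⟨u, hu, rfl⟩ := h
  obtain ⟨u', hu', rfl⟩ := h'
  exact ⟨u + u', hu.add hu', (Multiset.sum_add _ _).symm⟩

theorem Lift.single (p : ℝ) {a : α} {m : Multiset (ℝ × α)} (h : m = {(1, a)} ∨ T a m) :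
    Lift T {(p, a)} (scale p m) :=
  ⟨{scale p m}, .cons ⟨m, h, rfl⟩ .zero, (Multiset.sum_singleton _).symm⟩

theorem Lift.pure {a : α} {m : Multiset (ℝ × α)} (h : T a m) : Lift T {(1, a)} m := by
  simpa only [scale_one] using Lift.single 1 (.inr h)

theorem Lift.keep (p : ℝ) (a : α) : Lift T {(p, a)} {(p, a)} := by
  simpa only [scale_singleton, mul_one] using Lift.single (T := T) p (a := a) (.inl rfl)

theorem Lift.refl (s : Multiset (ℝ × α)) : Lift T s s := by
  induction s using Multiset.induction with
  | empty => exact .zero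
  | cons x s ih =>
    rw [← Multiset.singleton_add]
    exact (Lift.keep x.1 x.2).add ih

theorem Lift.zero_left {t : Multiset (ℝ × α)} (h : Lift T 0 t) : t = 0 := by
  obtain ⟨u, hu, rfl⟩ := h
  rw [Multiset.rel_zero_left] at hu
  rw [hu, Multiset.sum_zero]

theorem Lift.cons_left {x : ℝ × α} {s t : Multiset (ℝ × α)} (h : Lift T (x ::ₘ s) t) :
    ∃ m t', (m = {(1, x.2)} ∨ T x.2 m) ∧ Lift T s t' ∧ t = scale x.1 m + t' := by
  obtain ⟨u, hu, rfl⟩ := h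
  obtain ⟨y, u', ⟨m, hm, rfl⟩, hu', rfl⟩ := Multiset.rel_cons_left.1 hu
  exact ⟨m, _, hm, ⟨u', hu', rfl⟩, Multiset.sum_cons _ _⟩

theorem Lift.pure_left {a : α} {t : Multiset (ℝ × α)} (h : Lift T {(1, a)} t) :
    t = {(1, a)} ∨ T a t := by
  obtain ⟨m, t', hm, hs, rfl⟩ := Lift.cons_left (x := (1, a)) (s := 0) h
  rw [hs.zero_left, add_zero, scale_one]
  exact hm

theorem Lift.cons {x : ℝ × α} {s t m : Multiset (ℝ × α)} (hm : m = {(1, x.2)} ∨ T x.2 m)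
    (h : Lift T s t) : Lift T (x ::ₘ s) (scale x.1 m + t) := by
  rw [← Multiset.singleton_add]
  exact (Lift.single x.1 hm).add h

theorem Lift.scale {s t : Multiset (ℝ × α)} (h : Lift T s t) (p : ℝ) :
    Lift T (scale p s) (scale p t) := by
  induction s using Multiset.induction generalizing t with
  | empty =>
    rw [h.zero_left]
    exact .zero
  | cons x s ih =>
    obtain ⟨m, t', hm, hs, rfl⟩ := h.cons_left
    rw [scale_add, scale_scale, scale_cons]
    exact Lift.cons (x := (p * x.1, x.2)) hm (ih hs)

theorem Lift.mapSnd {T' : β → Multiset (ℝ × β) → Prop} {f : α → β}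
    (hf : ∀ a m, T a m → T' (f a) (mapSnd f m)) {s t : Multiset (ℝ × α)} (h : Lift T s t) :
    Lift T' (mapSnd f s) (mapSnd f t) := by
  induction s using Multiset.induction generalizing t with
  | empty =>
    rw [h.zero_left]
    exact .zero
  | cons x s ih =>
    obtain ⟨m, t', hm, hs, rfl⟩ := h.cons_left
    rw [mapSnd_add, mapSnd_scale]
    have : QLambda.mapSnd f (x ::ₘ s) = (x.1, f x.2) ::ₘ QLambda.mapSnd f s :=
      Multiset.map_cons _ _ _
    rw [this]
    refine Lift.cons (x := (x.1, f x.2)) ?_ (ih hs)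
    rcases hm with rfl | hm
    · exact .inl (mapSnd_singleton _ _ _)
    · exact .inr (hf _ _ hm)

/-- The elements are joined independently. Where only one side has moved, the other catches up with
that same step. -/
theorem Lift.diamond
    (hT : ∀ a m₁ m₂, T a m₁ → T a m₂ → ∃ m, Lift T m₁ m ∧ Lift T m₂ m)
    {s t₁ t₂ : Multiset (ℝ × α)} (h₁ : Lift T s t₁) (h₂ : Lift T s t₂) :
    ∃ t, Lift T t₁ t ∧ Lift T t₂ t := by
  induction s using Multiset.induction generalizing t₁ t₂ with
  | empty =>
    rw [h₁.zero_left, h₂.zero_left]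
    exact ⟨0, .zero, .zero⟩
  | cons x s ih =>
    obtain ⟨m₁, t₁, hm₁, hs₁, rfl⟩ := h₁.cons_left
    obtain ⟨m₂, t₂, hm₂, hs₂, rfl⟩ := h₂.cons_left
    obtain ⟨t, ht₁, ht₂⟩ := ih hs₁ hs₂
    suffices key : ∃ m, Lift T m₁ m ∧ Lift T m₂ m by
      obtain ⟨m, a, b⟩ := key
      exact ⟨_, (a.scale x.1).add ht₁, (b.scale x.1).add ht₂⟩
    rcases hm₁ with rfl | hm₁
    · rcases hm₂ with rfl | hm₂
      · exact ⟨_, .refl _, .refl _⟩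
      · exact ⟨_, .pure hm₂, .refl _⟩
    · rcases hm₂ with rfl | hm₂
      · exact ⟨_, .refl _, .pure hm₁⟩
      · exact hT _ _ _ hm₁ hm₂

theorem star_lift_add {s s' t t' : Multiset (ℝ × α)} (h : Relation.ReflTransGen (Lift T) s s')
    (h' : Relation.ReflTransGen (Lift T) t t') :
    Relation.ReflTransGen (Lift T) (s + t) (s' + t') := by
  refine Relation.ReflTransGen.trans (b := s' + t) ?_ ?_
  · exact h.lift (· + t) fun _ _ h => h.add (.refl t)
  · exact h'.lift (s' + ·) fun _ _ h => (Lift.refl s').add h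

theorem star_lift_of_lift {S : α → Multiset (ℝ × α) → Prop}
    (hS : ∀ a m, S a m → Relation.ReflTransGen (Lift T) {(1, a)} m) {s t : Multiset (ℝ × α)}
    (h : Lift S s t) : Relation.ReflTransGen (Lift T) s t := by
  induction s using Multiset.induction generalizing t with
  | empty =>
    rw [h.zero_left]
  | cons x s ih =>
    obtain ⟨m, t', hm, hs, rfl⟩ := h.cons_left
    rw [← Multiset.singleton_add]
    refine star_lift_add ?_ (ih hs)
    have key : Relation.ReflTransGen (Lift T) {(1, x.2)} m := by
      rcases hm with rfl | hm
      · exact .refl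
      · exact hS _ _ hm
    have : Relation.ReflTransGen (Lift T) (QLambda.scale x.1 {(1, x.2)}) (QLambda.scale x.1 m) :=
      key.lift (QLambda.scale x.1) fun _ _ h => h.scale x.1
    rwa [scale_singleton, mul_one] at this

theorem Lift.exists_fin {s t : Multiset (ℝ × α)} (h : Lift T s t) :
    ∃ (k : ℕ) (p : Fin k → ℝ) (a : Fin k → α) (m : Fin k → Multiset (ℝ × α)),
      s = ∑ i, {(p i, a i)} ∧ t = ∑ i, QLambda.scale (p i) (m i) ∧
        ∀ i, m i = {(1, a i)} ∨ T (a i) (m i) := by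
  induction s using Multiset.induction generalizing t with
  | empty => exact ⟨0, Fin.elim0, Fin.elim0, Fin.elim0, by simp, by simp [h.zero_left], by simp⟩
  | cons x s ih =>
    obtain ⟨m, t', hm, hs, rfl⟩ := h.cons_left
    obtain ⟨k, p, a, m', rfl, rfl, hm'⟩ := ih hs
    refine ⟨k + 1, Fin.cons x.1 p, Fin.cons x.2 a, Fin.cons m m', ?_, ?_, ?_⟩
    · simp [Fin.sum_univ_succ]
    · simp [Fin.sum_univ_succ]
    · intro i
      refine Fin.cases ?_ (fun i => ?_) i
      · exact hm
      · exact hm' i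

theorem lift_sum {k : ℕ} (p : Fin k → ℝ) (a : Fin k → α) (m : Fin k → Multiset (ℝ × α))
    (h : ∀ i, m i = {(1, a i)} ∨ T (a i) (m i)) :
    Lift T (∑ i, {(p i, a i)}) (∑ i, QLambda.scale (p i) (m i)) := by
  induction k with
  | zero => exact .zero
  | succ k ih =>
    rw [Fin.sum_univ_succ, Fin.sum_univ_succ]
    exact (Lift.single _ (h 0)).add (ih _ _ _ fun i => h i.succ)

/-- The condition on the weights of a multidistribution. -/
def SubUnit (s : Multiset (ℝ × α)) : Prop := (∀ x ∈ s, 0 < x.1) ∧ (s.map Prod.fst).sum ≤ 1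

theorem MDist.subUnit (m : MDist α) : SubUnit m.val := ⟨fun x hx => (m.weight_mem x hx).1, m.sum_le⟩

/-- The multidistribution of a weighted multiset. -/
def SubUnit.mdist {s : Multiset (ℝ × α)} (h : SubUnit s) : MDist α where
  val := s
  weight_mem x hx := by
    refine ⟨h.1 x hx, le_trans ?_ h.2⟩
    refine Multiset.single_le_sum (fun y hy => ?_) _ (Multiset.mem_map_of_mem _ hx)
    obtain ⟨z, hz, rfl⟩ := Multiset.mem_map.1 hy
    exact (h.1 z hz).le
  sum_le := h.2

/-- Weights stay positive and their sum does not grow, so the joins can be built on plain multisets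
and turned into multidistributions afterwards. -/
theorem SubUnit.lift (hT : ∀ a m, T a m → SubUnit m) {s t : Multiset (ℝ × α)} (hs : SubUnit s)
    (h : Lift T s t) : SubUnit t := by
  suffices key : (∀ x ∈ t, 0 < x.1) ∧ (t.map Prod.fst).sum ≤ (s.map Prod.fst).sum from
    ⟨key.1, key.2.trans hs.2⟩
  have hpos := hs.1
  clear hs
  induction s using Multiset.induction generalizing t with
  | empty => simp [h.zero_left]
  | cons x s ih =>
    obtain ⟨m, t', hm, hs, rfl⟩ := h.cons_left
    have hm : SubUnit m := by
      rcases hm with rfl | hm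
      · simp [SubUnit]
      · exact hT _ _ hm
    have hx := hpos x (Multiset.mem_cons_self _ _)
    obtain ⟨h1, h2⟩ := ih hs fun y hy => hpos y (Multiset.mem_cons_of_mem hy)
    constructor
    · intro y hy
      rcases Multiset.mem_add.1 hy with hy | hy
      · obtain ⟨z, hz, rfl⟩ := Multiset.mem_map.1 hy
        exact mul_pos hx (hm.1 z hz)
      · exact h1 y hy
    · rw [Multiset.map_add, Multiset.sum_add, sum_scale, Multiset.map_cons, Multiset.sum_cons]
      have := mul_le_mul_of_nonneg_left hm.2 hx.le
      linarith

/-- A relation to multidistributions as a relation to weighted multisets. -/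
def OnVal (r : α → MDist α → Prop) (a : α) (m : Multiset (ℝ × α)) : Prop :=
  ∃ m' : MDist α, m'.val = m ∧ r a m'

theorem Lifting.lift {r : α → MDist α → Prop} {s t : MDist α} (h : Lifting r s t) :
    Lift (OnVal r) s.val t.val := by
  induction h with
  | refl a => exact .refl _
  | step a m h => exact .pure ⟨m, rfl, h⟩
  | sum p a m s t hs ht h ih =>
    rw [hs, ht]
    exact lift_sum p a (fun i => (m i).val) fun i => (ih i).pure_left

theorem Lift.lifting {r : α → MDist α → Prop} {s : MDist α} {t : Multiset (ℝ × α)}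
    (h : Lift (OnVal r) s.val t) : ∃ t' : MDist α, t'.val = t ∧ Lifting r s t' := by
  have hr : ∀ a m, OnVal r a m → SubUnit m := by
    rintro a m ⟨m', rfl, -⟩
    exact m'.subUnit
  obtain ⟨k, p, a, m, hs, ht, hm⟩ := h.exists_fin
  have hm' : ∀ i, ∃ m' : MDist α, m'.val = m i ∧ Lifting r (MDist.pure (a i)) m' := by
    intro i
    rcases hm i with h | ⟨m', h, h'⟩
    · exact ⟨MDist.pure (a i), h.symm, .refl _⟩
    · exact ⟨m', h, .step _ _ h'⟩
  choose m' hm' hl using hm'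
  refine ⟨(s.subUnit.lift hr h).mdist, rfl, .sum p a m' _ _ hs ?_ hl⟩
  simp only [hm']
  exact ht

theorem star_lifting {r : α → MDist α → Prop} {s : MDist α} {t : Multiset (ℝ × α)}
    (h : Relation.ReflTransGen (Lift (OnVal r)) s.val t) :
    ∃ t' : MDist α, t'.val = t ∧ Relation.ReflTransGen (Lifting r) s t' := by
  induction h with
  | refl => exact ⟨s, rfl, .refl⟩
  | tail _ h ih =>
    obtain ⟨t, rfl, ht⟩ := ih
    obtain ⟨t', h', hl⟩ := h.lifting
    exact ⟨t', h', ht.tail hl⟩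

/-- Confluence of the lifting of a relation, from the diamond property of a relation between the
relation and its transitive closure. -/
theorem confluent_lifting {r : α → MDist α → Prop} {T : α → Multiset (ℝ × α) → Prop}
    (h₁ : ∀ a m, r a m → T a m.val)
    (h₂ : ∀ a m, T a m → Relation.ReflTransGen (Lift (OnVal r)) {(1, a)} m)
    (hT : ∀ a m₁ m₂, T a m₁ → T a m₂ → ∃ m, Lift T m₁ m ∧ Lift T m₂ m) :
    Confluent (Lifting r) := by
  have h₁' : ∀ s t, Relation.ReflTransGen (Lifting r) s t →
      Relation.ReflTransGen (Lift T) s.val t.val := by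
    intro s t h
    refine h.lift MDist.val fun s t h => ?_
    -- With `f = id` this is monotonicity of `Lift` in the relation.
    have := Lift.mapSnd (T := OnVal r) (T' := T) (f := id) (fun a m ⟨m', hm, h⟩ => by
      rw [← hm]
      simpa [QLambda.mapSnd] using h₁ a m' h) h.lift
    simpa [QLambda.mapSnd] using this
  have h₂' : ∀ s t, Relation.ReflTransGen (Lift T) s t →
      Relation.ReflTransGen (Lift (OnVal r)) s t := by
    intro s t h
    induction h with
    | refl => exact .refl
    | tail _ h ih => exact ih.trans (star_lift_of_lift h₂ h)
  intro a b c hb hc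
  obtain ⟨d, hbd, hcd⟩ := Relation.church_rosser (r := Lift T) (fun a b c hb hc => by
    obtain ⟨d, h, h'⟩ := Lift.diamond hT hb hc
    exact ⟨d, .single h, .single h'⟩) (h₁' _ _ hb) (h₁' _ _ hc)
  -- The two reductions end in the same weighted multiset, and a multidistribution is determined by
  -- it.
  obtain ⟨d₁, rfl, hd₁⟩ := star_lifting (h₂' _ _ hbd)
  obtain ⟨d₂, e, hd₂⟩ := star_lifting (h₂' _ _ hcd)
  obtain rfl : d₂ = d₁ := MDist.ext e
  exact ⟨d₂, hd₁, hd₂⟩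

end Lift

end QLambda

namespace QLambda

section

variable {G : GateSet.{u}}

/-! ### The diamond property -/

theorem NProg.exists_of_star (x : NProg G) {N : Term G}
    (h : Relation.ReflTransGen Term.Beta x.term N) :
    ∃ y : NProg G, y.vec = x.vec ∧ y.term = N := by
  obtain ⟨hv, hr⟩ := Term.star_valid h x.valid
  exact ⟨⟨x.vec, N, hv, fun b hb i hi => x.supp b hb i (by rw [← hr, hi]), x.norm⟩, rfl, rfl⟩

/-- The norm of `φ` determines the positive factor `a`, and division by it determines the state; no
phase is left free. -/
theorem Out.unique {φ : Mem} {A : Term G} {μ ν : Multiset (ℝ × NProg G)} (h : Out φ A μ)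
    (h' : Out φ A ν) : μ = ν := by
  cases h with
  | zero h =>
    subst h
    exact h'.eq_zero.symm
  | pos y a ha hφ hA =>
    cases h' with
    | zero h =>
      subst h
      exact (Out.pos y a ha hφ hA).eq_zero
    | pos z b hb hφ' hA' =>
      have hab : a = b := by
        have h1 := congrArg Mem.nrm (hφ.symm.trans hφ')
        rw [Mem.nrm_smul, Mem.nrm_smul, y.norm, z.norm, mul_one, mul_one,
          ENNReal.ofReal_eq_ofReal_iff (sq_nonneg a) (sq_nonneg b)] at h1
        exact (sq_eq_sq₀ ha.le hb.le).1 h1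
      subst hab
      have hne : (a : ℂ) ≠ 0 := Complex.ofReal_ne_zero.2 ha.ne'
      have : y = z := NProg.ext (smul_right_injective _ hne (hφ.symm.trans hφ'))
        (hA.trans hA'.symm)
      rw [this]

theorem Out.smul {φ : Mem} {A : Term G} {μ : Multiset (ℝ × NProg G)} (h : Out φ A μ) {a : ℝ}
    (ha : 0 < a) : Out ((a : ℂ) • φ) A (scale (a ^ 2) μ) := by
  cases h with
  | zero h =>
    subst h
    exact .zero (smul_zero _)
  | pos y b hb hφ hA =>
    rw [scale_singleton, ← mul_pow]
    refine .pos y _ (mul_pos ha hb) ?_ hA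
    rw [hφ, smul_smul, Complex.ofReal_mul]

theorem Out.par {φ : Mem} {A A' : Term G} {μ : Multiset (ℝ × NProg G)} (h : Out φ A μ)
    (hA : Term.Par A A') : ∃ μ', Out φ A' μ' ∧ Lift NStep μ μ' := by
  cases h with
  | zero h => exact ⟨0, .zero h, .zero⟩
  | pos y a ha hφ hA' =>
    subst hA'
    obtain ⟨z, hz, hz'⟩ := y.exists_of_star hA.star
    refine ⟨_, .pos z a ha (by rw [hz, hφ]) hz', ?_⟩
    have : Lift NStep {(a ^ 2, y)} (scale (a ^ 2) {(1, z)}) :=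
      .single _ (.inr (.inl (.mk z (by rwa [hz']) hz)))
    rwa [scale_singleton, mul_one] at this

/-- A step of the normalized outcome can be computed on the unnormalized memory: by linearity the
factor `a⁻¹` passes through the operators, and the squared factors cancel in the weights. -/
theorem Out.step {φ : Mem} {A X Y : Term G} {μ κ₀ κ₁ : Multiset (ℝ × NProg G)} (h : Out φ A μ)
    {ℓ : Lab G} (hq : Term.QT ℓ A X Y) (hf : ℓ.Fresh A) (h0 : Out (ℓ.op 0 φ) X κ₀)
    (h1 : Out (ℓ.op 1 φ) Y κ₁) : Lift NStep μ (κ₀ + κ₁) := by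
  cases h with
  | zero h =>
    subst h
    rw [Lab.op_zero] at h0 h1
    rw [h0.eq_zero, h1.eq_zero]
    exact .zero
  | pos y a ha hφ hA =>
    subst hA
    have hvec : y.vec = ((a⁻¹ : ℝ) : ℂ) • φ := by
      rw [hφ, smul_smul, ← Complex.ofReal_mul, inv_mul_cancel₀ ha.ne', Complex.ofReal_one, one_smul]
    have h0' := h0.smul (inv_pos.2 ha)
    have h1' := h1.smul (inv_pos.2 ha)
    rw [← Lab.op_smul, ← hvec] at h0' h1'
    have := Lift.single (T := NStep) (a ^ 2) (.inr (.inr (.mk ℓ X Y _ _ hq hf h0' h1')))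
    rwa [← scale_add, scale_scale, inv_pow, mul_inv_cancel₀ (pow_ne_zero 2 ha.ne'),
      scale_one] at this

/-- Both qubits are `0` on the support, so exchanging them changes nothing. -/
theorem Mem.perm_swap_of_fresh {ψ : Mem} {M : Term G} (hs : ψ.SuppIn M) {i j : ℕ}
    (hi : M.regOcc i = 0) (hj : M.regOcc j = 0) : ψ.perm (Equiv.swap i j) = ψ := by
  have key : ∀ b : ℕ → Fin 2, b i = 0 → b j = 0 → b ∘ Equiv.swap i j = b := by
    intro b h1 h2
    funext k
    rw [Function.comp, Equiv.swap_apply_def]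
    split_ifs <;> simp_all
  funext b
  by_cases hb : ψ b = 0
  · by_contra hne
    rw [hb] at hne
    have h1 := hs _ hne i hi
    have h2 := hs _ hne j hj
    simp only [Function.comp, Equiv.swap_apply_left, Equiv.swap_apply_right] at h1 h2
    rw [Mem.perm, key b h2 h1] at hne
    exact hne hb
  · rw [Mem.perm, key b (hs b hb i hi) (hs b hb j hj)]

theorem Lab.nrm_op_ne_top {ℓ : Lab G} (h : ∀ k, ℓ.uses k ≤ 1) {ψ : Mem} (hψ : ψ.nrm ≠ ⊤)
    (o : Fin 2) : (ℓ.op o ψ).nrm ≠ ⊤ := by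
  have := ℓ.nrm_op h ψ
  rw [← this, ENNReal.add_ne_top] at hψ
  fin_cases o
  · exact hψ.1
  · exact hψ.2

theorem Lab.Fresh.of_qt {ℓ ℓ' : Lab G} {M A B : Term G} (hf : ℓ'.Fresh M) (h : Term.QT ℓ M A B)
    (hM : M.Valid) (hne : ∀ i, ℓ = .new i → ℓ' ≠ .new i) : ℓ'.Fresh A ∧ ℓ'.Fresh B := by
  have key : ∀ j, ℓ' = .new j → A.regOcc j = 0 ∧ B.regOcc j = 0 := by
    intro j hj
    have h1 := hf j hj
    have h2 := h.regOcc_eq (hM.1 j).2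
    have h3 : ℓ.adds j = 0 := by
      cases ℓ with
      | new i =>
        have : i ≠ j := by
          rintro rfl
          exact hne i rfl hj
        simp [Lab.adds, this]
      | _ => rfl
    omega
  exact ⟨fun j hj => (key j hj).1, fun j hj => (key j hj).2⟩

/-- Two reducts of a program have a common reduct, up to the names of the registers. -/
def NJoin (μ ν : Multiset (ℝ × NProg G)) : Prop :=
  ∃ μ' ν', Lift NStep μ μ' ∧ Lift NStep ν ν' ∧ mapSnd prog μ' = mapSnd prog ν'

theorem NJoin.symm {μ ν : Multiset (ℝ × NProg G)} (h : NJoin μ ν) : NJoin ν μ := by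
  obtain ⟨μ', ν', h1, h2, h3⟩ := h
  exact ⟨ν', μ', h2, h1, h3.symm⟩

theorem njoin_beta_beta {x : NProg G} {μ ν : Multiset (ℝ × NProg G)} (h : NBeta x μ)
    (h' : NBeta x ν) : NJoin μ ν := by
  obtain ⟨y, hy, hv⟩ := h
  obtain ⟨z, hz, hv'⟩ := h'
  obtain ⟨C, hC, hC'⟩ := hy.diamond hz
  obtain ⟨w, hw, rfl⟩ := y.exists_of_star hC.star
  exact ⟨_, _, .pure (.inl (.mk w hC hw)), .pure (.inl (.mk w hC' (by rw [hw, hv, hv']))), rfl⟩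

theorem njoin_beta_quant {x : NProg G} {μ ν : Multiset (ℝ × NProg G)} (h : NBeta x μ)
    (h' : NQuant x ν) : NJoin μ ν := by
  obtain ⟨y, hy, hv⟩ := h
  obtain ⟨ℓ, A, B, μ, ν, h, hf, h0, h1⟩ := h'
  obtain ⟨A', B', hq, hA, hB⟩ := h.par hy x.valid.2
  obtain ⟨μ', hμ, hμ'⟩ := h0.par hA
  obtain ⟨ν', hν, hν'⟩ := h1.par hB
  refine ⟨_, _, .pure (.inr (.mk ℓ A' B' μ' ν' hq (hf.mono fun i => ?_) ?_ ?_)), hμ'.add hν', rfl⟩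
  · rw [(Term.star_valid hy.star x.valid).2]
  · rwa [hv]
  · rwa [hv]

/-- Two disjoint allocations under one name could not be performed in succession, hence `hne`. -/
theorem njoin_of_ne {x : NProg G} {ℓ ℓ' : Lab G} {A B A' B' : Term G}
    {μ ν μ' ν' : Multiset (ℝ × NProg G)} (h : Term.QT ℓ x.term A B) (hf : ℓ.Fresh x.term)
    (h0 : Out (ℓ.op 0 x.vec) A μ) (h1 : Out (ℓ.op 1 x.vec) B ν)
    (h' : Term.QT ℓ' x.term A' B') (hf' : ℓ'.Fresh x.term)
    (h0' : Out (ℓ'.op 0 x.vec) A' μ') (h1' : Out (ℓ'.op 1 x.vec) B' ν')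
    (hne : ∀ i, ℓ = .new i → ℓ' ≠ .new i) : NJoin (μ + ν) (μ' + ν') := by
  have hj := h.join h' hf hf' fun k => (x.valid.1 k).1
  cases hj with
  | same =>
    rw [h0.unique h0', h1.unique h1']
    exact ⟨_, _, .refl _, .refl _, rfl⟩
  | new i j =>
    have hi := hf i rfl
    have hj := hf' j rfl
    have e : ∀ o, ((Lab.new i : Lab G).op o x.vec).perm (Equiv.swap i j) =
        (Lab.new j : Lab G).op o x.vec := by
      intro o
      rw [← Lab.op_perm, Mem.perm_swap_of_fresh x.supp hi hj, Lab.map, Equiv.swap_apply_left]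
    have a0 := h0.perm (Equiv.swap i j)
    have a1 := h1.perm (Equiv.swap i j)
    rw [e] at a0 a1
    rw [h0'.unique a0, h1'.unique a1]
    refine ⟨_, _, .refl _, .refl _, ?_⟩
    rw [← mapSnd_add, mapSnd_prog_perm]
  | @square _ _ _ _ _ _ X₀₀ X₀₁ X₁₀ X₁₁ hd hA hB hA' hB' =>
    have hne' : ∀ i, ℓ' = .new i → ℓ ≠ .new i := fun i h1 h2 => hne i h2 h1
    obtain ⟨vA, vB⟩ := h.valid hf x.valid
    obtain ⟨fA, fB⟩ := hf'.of_qt h x.valid hne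
    obtain ⟨fA', fB'⟩ := hf.of_qt h' x.valid hne'
    obtain ⟨vX₀₀, vX₀₁⟩ := hA.valid fA vA
    obtain ⟨vX₁₀, vX₁₁⟩ := hB.valid fB vB
    have hu : ∀ k, ℓ.uses k ≤ 1 := fun k => (h.uses_le k).trans (x.valid.1 k).1
    have hu' : ∀ k, ℓ'.uses k ≤ 1 := fun k => (h'.uses_le k).trans (x.valid.1 k).1
    have ht : ∀ o o', (ℓ'.op o' (ℓ.op o x.vec)).nrm ≠ ⊤ := fun o o' =>
      Lab.nrm_op_ne_top hu' (Lab.nrm_op_ne_top hu (by rw [x.norm]; exact ENNReal.one_ne_top) o) o'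
    have sM := fun o => h.suppIn x.valid x.supp o
    have sA := fun o => hA.suppIn vA (sM 0).1 o
    have sB := fun o => hB.suppIn vB (sM 1).2 o
    -- The first index is the outcome of `ℓ`, the second that of `ℓ'`. As the operators commute, the
    -- same four results serve both orders.
    obtain ⟨κ₀₀, k₀₀⟩ := Out.exists vX₀₀ (sA 0).1 (ht 0 0)
    obtain ⟨κ₀₁, k₀₁⟩ := Out.exists vX₀₁ (sA 1).2 (ht 0 1)
    obtain ⟨κ₁₀, k₁₀⟩ := Out.exists vX₁₀ (sB 0).1 (ht 1 0)
    obtain ⟨κ₁₁, k₁₁⟩ := Out.exists vX₁₁ (sB 1).2 (ht 1 1)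
    have hcomm : ∀ o o', ℓ'.op o' (ℓ.op o x.vec) = ℓ.op o (ℓ'.op o' x.vec) := fun o o' =>
      (Lab.op_comm hd o o' x.vec).symm
    have r0 := h0.step hA fA k₀₀ k₀₁
    have r1 := h1.step hB fB k₁₀ k₁₁
    rw [hcomm] at k₀₀ k₀₁ k₁₀ k₁₁
    have r0' := h0'.step hA' fA' k₀₀ k₁₀
    have r1' := h1'.step hB' fB' k₀₁ k₁₁
    refine ⟨_, _, r0.add r1, r0'.add r1', ?_⟩
    rw [add_add_add_comm]

theorem njoin_quant_quant {x : NProg G} {μ ν : Multiset (ℝ × NProg G)} (h : NQuant x μ)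
    (h' : NQuant x ν) : NJoin μ ν := by
  obtain ⟨ℓ, A, B, μ, ν, h, hf, h0, h1⟩ := h
  obtain ⟨ℓ', A', B', μ', ν', h', hf', h0', h1'⟩ := h'
  by_cases hne : ∀ i, ℓ = .new i → ℓ' ≠ .new i
  · exact njoin_of_ne h hf h0 h1 h' hf' h0' h1' hne
  push Not at hne
  obtain ⟨i, rfl, rfl⟩ := hne
  -- Both steps allocate the name `i`. The second is renamed to a fresh `j` by a swap that fixes
  -- `x`, so that `njoin_of_ne` applies.
  obtain ⟨j, hj⟩ := (x.term.finite_regs.insert i).exists_notMem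
  simp only [Set.mem_insert_iff, not_or, Term.regs, Set.mem_ofPred_eq] at hj
  obtain ⟨hji, hj⟩ := hj
  have hj : x.term.regOcc j = 0 := by omega
  have hi := hf i rfl
  have e : ∀ o, ((Lab.new i : Lab G).op o x.vec).perm (Equiv.swap i j) =
      (Lab.new j : Lab G).op o x.vec := by
    intro o
    rw [← Lab.op_perm, Mem.perm_swap_of_fresh x.supp hi hj, Lab.map, Equiv.swap_apply_left]
  have a := h'.mapReg (Equiv.swap i j)
  have a0 := h0'.perm (Equiv.swap i j)
  have a1 := h1'.perm (Equiv.swap i j)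
  rw [e] at a0 a1
  rw [Lab.map, Equiv.swap_apply_left, Term.mapReg_swap_of_fresh hi hj] at a
  obtain ⟨κ, κ', hκ, hκ', e'⟩ := njoin_of_ne h hf h0 h1 a (fun k hk => by cases hk; exact hj) a0 a1
    (fun k hk hk' => by cases hk; cases hk'; exact hji rfl)
  rw [← mapSnd_add] at hκ'
  -- Applying the swap again undoes the renaming; the join only has to agree after `prog`, which
  -- does not see it.
  have hs : Lift NStep (mapSnd (fun y => NProg.perm y (Equiv.swap i j))
      (mapSnd (fun y => NProg.perm y (Equiv.swap i j)) (μ' + ν'))) _ :=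
    hκ'.mapSnd fun a m h => NStep.perm h (Equiv.swap i j)
  have hinv : ∀ y : NProg G, (y.perm (Equiv.swap i j)).perm (Equiv.swap i j) = y := fun y => by
    rw [NProg.perm_perm, Equiv.swap_mul_self, NProg.perm_one]
  have hid : mapSnd (fun y => NProg.perm y (Equiv.swap i j))
      (mapSnd (fun y => NProg.perm y (Equiv.swap i j)) (μ' + ν')) = μ' + ν' := by
    rw [mapSnd_mapSnd]
    simp [hinv, mapSnd]
  rw [hid] at hs
  exact ⟨κ, _, hκ, hs, by rw [mapSnd_prog_perm, e']⟩

theorem NStep.join {x : NProg G} {μ ν : Multiset (ℝ × NProg G)} (h : NStep x μ)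
    (h' : NStep x ν) : NJoin μ ν := by
  rcases h with h | h
  · rcases h' with h' | h'
    · exact njoin_beta_beta h h'
    · exact njoin_beta_quant h h'
  · rcases h' with h' | h'
    · exact (njoin_beta_quant h' h).symm
    · exact njoin_quant_quant h h'

/-! ### Confluence -/

/-- Parallel β-steps and quantum steps of programs. -/
def ParStep (P : Program G) (m : Multiset (ℝ × Program G)) : Prop :=
  ∃ x μ, prog x = P ∧ NStep x μ ∧ m = mapSnd prog μ

theorem ParStep.join {P : Program G} {m₁ m₂ : Multiset (ℝ × Program G)} (h₁ : ParStep P m₁)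
    (h₂ : ParStep P m₂) : ∃ m, Lift ParStep m₁ m ∧ Lift ParStep m₂ m := by
  obtain ⟨x, μ, rfl, hμ, rfl⟩ := h₁
  obtain ⟨y, ν, hy, hν, rfl⟩ := h₂
  -- The two steps may start from different named representatives; equivariance moves the first to
  -- that of the second.
  obtain ⟨τ, rfl⟩ := prog_eq_prog hy.symm
  obtain ⟨μ', ν', h1, h2, e⟩ := (hμ.perm τ).join hν
  have hT : ∀ (a : NProg G) m, NStep a m → ParStep (prog a) (mapSnd prog m) := fun a m h =>
    ⟨a, m, rfl, h, rfl⟩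
  have h1 := h1.mapSnd hT
  have h2 := h2.mapSnd hT
  rw [mapSnd_prog_perm] at h1
  exact ⟨_, h1, e ▸ h2⟩

theorem Step.parStep {P : Program G} {m : MDist (Program G)} (h : Step P m) :
    ParStep P m.val := by
  obtain ⟨x, rfl⟩ := prog_surjective P
  obtain ⟨μ, hμ, hm⟩ := h.exists_nstep
  exact ⟨x, μ, rfl, hμ, hm⟩

theorem star_step_of_star_beta (x : NProg G) {N : Term G}
    (h : Relation.ReflTransGen Term.Beta x.term N) : ∃ y : NProg G, y.vec = x.vec ∧ y.term = N ∧
      Relation.ReflTransGen (Lift (OnVal Step)) {(1, prog x)} {(1, prog y)} := by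
  induction h with
  | refl => exact ⟨x, rfl, rfl, .refl⟩
  | tail _ h ih =>
    obtain ⟨y, hv, rfl, hy⟩ := ih
    obtain ⟨z, hz, rfl⟩ := y.exists_of_star (.single h)
    exact ⟨z, hz.trans hv, rfl, hy.tail (.pure ⟨_, rfl, step_of_beta h hz⟩)⟩

theorem ParStep.star_step {P : Program G} {m : Multiset (ℝ × Program G)} (h : ParStep P m) :
    Relation.ReflTransGen (Lift (OnVal Step)) {(1, P)} m := by
  obtain ⟨x, μ, rfl, h | h, rfl⟩ := h
  · obtain ⟨y, h, hv⟩ := h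
    obtain ⟨z, hz, hz', hs⟩ := star_step_of_star_beta x h.star
    obtain rfl : z = y := NProg.ext (hz.trans hv.symm) hz'
    rwa [mapSnd_singleton]
  · have hw := h.weights
    have hsub : SubUnit (mapSnd prog μ) := by
      refine ⟨fun y hy => ?_, ?_⟩
      · obtain ⟨z, hz, rfl⟩ := Multiset.mem_map.1 hy
        exact hw.1 z hz
      · rw [mapSnd, Multiset.map_map]
        exact hw.2.le
    exact .single (.pure ⟨hsub.mdist, rfl, h.step rfl⟩)

end

end QLambda

theorem mainTheorem3 (G : QLambda.GateSet.{u}) :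
    QLambda.Confluent (QLambda.Red G) :=
  QLambda.confluent_lifting (fun _ _ h => h.parStep) (fun _ _ h => h.star_step)
    fun _ _ _ h₁ h₂ => h₁.join h₂
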